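/- **Theorem.** Let $d\ge 1$ and let $k>d/2$ be an integer. For $f\in L^2(\mathbb R^d)$ and $m\in\mathbb N$ put $$\|f\|_{\Sigma^m}:=\|f\|_{H^m(\mathbb R^d)}+\big\||x|^m f\big\|_{L^2(\mathbb R^d)}\in[0,\infty].$$ Fix $\mu\in\mathbb R$ and consider the cubic nonlinear Schrödinger equation $$i\partial_t\psi=-\Delta\psi+\mu|\psi|^2\psi,\qquad \psi|_{t=0}=\psi_0,\qquad x\in\mathbb R^d. \tag{1}$$ For $\tau>0$ let $\psi^n$ be the iterates of the Lie splitting $$\psi^{n+1}=e^{i\tau\Delta}e^{-i\tau\mu|\psi^n|^2}\psi^n,\qquad \psi^0=\psi_0 .$$ Then for every $T>0$ and $M\ge 0$ there are constants $C>0$ and $\tau_0>0$, depending only on $d,k,T,M$ and the coefficient $\mu$ of the equation, such that the following holds. If $\psi:[0,T]\to L^2(\mathbb R^d)$ is a solution of (1), i.e. $\psi$ is differentiable in time with values in $L^2$, $|\psi(t)|^2\psi(t)\in L^2$, and (1) holds at every $t\in[0,T]$ with $\Delta$ the distributional Laplacian, and if $$\sup_{t\in[0,T]}\|\psi(t)\|_{\Sigma^{k+2}}\le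 M,$$ then for all $0<\tau<\tau_0$, $$\|\psi^n-\psi(n\tau)\|_{\Sigma^k}\le C\tau\qquad\text{for all integers } n\ge 0 \text{ with } n\tau\le T.$$ -/

import Mathlib

open MeasureTheory FourierTransform
open scoped ENNReal NNReal SchwartzMap Laplacian

noncomputable section

/-- `ℝ^d` with the Euclidean norm. -/
abbrev Rd (d : ℕ) : Type := EuclideanSpace ℝ (Fin d)

/-- The complex space `L²(ℝ^d)`. -/
abbrev L2Space (d : ℕ) : Type := Lp ℂ 2 (volume : Measure (Rd d))

/-- The norm of `H^k(ℝ^d)`, as an element of `[0, ∞]`: the `L²` norm of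
`(1 + |2πξ|²)^{k/2} f̂(ξ)`, where `f̂(ξ) = ∫ e^{-2πi x·ξ} f(x) dx` is the Fourier transform on `L²`.
It is `∞` exactly when `f` does not belong to `H^k`. -/
def sobolevENorm {d : ℕ} (k : ℕ) (f : L2Space d) : ℝ≥0∞ :=
  eLpNorm (fun ξ : Rd d =>
    (((1 + (2 * Real.pi * ‖ξ‖) ^ 2) ^ ((k : ℝ) / 2) : ℝ) : ℂ) * (𝓕 f : L2Space d) ξ) 2 volume

/-- The norm `‖f‖_{Σ^k} = ‖f‖_{H^k} + ‖|x|^k f‖_{L²}`, as an element of `[0, ∞]`. The space `Σ^k`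
consists of the `f ∈ L²` for which it is finite. -/
def sigmaENorm {d : ℕ} (k : ℕ) (f : L2Space d) : ℝ≥0∞ :=
  sobolevENorm k f + eLpNorm (fun x : Rd d => ((‖x‖ ^ k : ℝ) : ℂ) * f x) 2 volume

theorem memLp_phase_mul {d : ℕ} {θ : Rd d → ℝ} (hθ : AEStronglyMeasurable θ volume)
    (f : L2Space d) :
    MemLp (fun x => Complex.exp (Complex.I * (θ x : ℂ)) * f x) 2 volume := by
  refine (Lp.memLp f).of_le ?_ (Filter.Eventually.of_forall fun x => ?_)
  · exact (Continuous.comp_aestronglyMeasurable (g := fun r : ℝ => Complex.exp (Complex.I * r))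
      (by fun_prop) hθ).mul (Lp.aestronglyMeasurable f)
  · rw [norm_mul, mul_comm Complex.I, Complex.norm_exp_ofReal_mul_I, one_mul]

/-- Multiplication `f ↦ e^{iθ} f` on `L²(ℝ^d)` by the phase of a real function `θ`. -/
def phaseMul {d : ℕ} (θ : Rd d → ℝ) (hθ : AEStronglyMeasurable θ volume) (f : L2Space d) :
    L2Space d :=
  (memLp_phase_mul hθ f).toLp _

/-- The free Schrödinger propagator `e^{itΔ}` on `L²(ℝ^d)`, i.e. the Fourier multiplier with symbol
`e^{-it|2πξ|²}`. -/
def freePropagator {d : ℕ} (t : ℝ) (f : L2Space d) : L2Space d :=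
  𝓕⁻ (phaseMul (fun ξ : Rd d => -t * (2 * Real.pi * ‖ξ‖) ^ 2)
    (Continuous.aestronglyMeasurable (by fun_prop)) (𝓕 f : L2Space d))

/-- The flow `f ↦ e^{-itμ|f|²} f` of the nonlinear part. -/
def nonlinearFlow {d : ℕ} (μ t : ℝ) (f : L2Space d) : L2Space d :=
  phaseMul (fun x : Rd d => -t * μ * ‖f x‖ ^ 2)
    (((Lp.aestronglyMeasurable f).norm.pow 2).const_mul (-t * μ)) f

/-- The Lie splitting iterates `ψ^0 = ψ₀`, `ψ^{n+1} = e^{iτΔ} e^{-iτμ|ψ^n|²} ψ^n`. -/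
def lieSplitting {d : ℕ} (μ τ : ℝ) (ψ₀ : L2Space d) : ℕ → L2Space d
  | 0 => ψ₀
  | n + 1 => freePropagator τ (nonlinearFlow μ τ (lieSplitting μ τ ψ₀ n))

/-- `ψ` solves `i ∂_t ψ = -Δψ + μ|ψ|²ψ` on `[0, T]` with `ψ(0) = ψ₀`: at each `t ∈ [0, T]` it is
differentiable as an `L²`-valued function of time (one-sidedly at the end points), `|ψ(t)|²ψ(t)` is
in `L²`, and the equation holds with `Δ` the distributional Laplacian. -/
structure IsCubicNLSSolution {d : ℕ} (μ T : ℝ) (ψ₀ : L2Space d) (ψ : ℝ → L2Space d) : Prop where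
  initial : ψ 0 = ψ₀
  equation : ∀ t ∈ Set.Icc (0 : ℝ) T, ∃ ψ' N : L2Space d,
    HasDerivWithinAt ψ ψ' (Set.Icc 0 T) t ∧
    (∀ᵐ x : Rd d, N x = ((‖ψ t x‖ ^ 2 : ℝ) : ℂ) * ψ t x) ∧
    Complex.I • (ψ' : 𝓢'(Rd d, ℂ)) = -Δ (ψ t : 𝓢'(Rd d, ℂ)) + (μ : ℂ) • (N : 𝓢'(Rd d, ℂ))

end

/-!
# First order convergence of the Lie splitting for the cubic Schrödinger equation in `Σ^k`

The argument is "consistency and stability", carried out in the interaction picture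
`v(t) = e^{-itΔ} ψ(t)`. It cannot be run on `ψ` itself: `e^{itΔ}` is bounded on `Σ^k` but is not a
contraction there, so bounding it by a constant at each of the `T / τ` steps would be fatal. In the
interaction picture the iterates `vⁿ = e^{-inτΔ} ψⁿ` satisfy
`vⁿ⁺¹ = vⁿ + e^{-inτΔ} (e^{-iτμ|ψⁿ|²} ψⁿ - ψⁿ)`, the propagators no longer accumulate, and the
increments are of order `τ`.

*The nonlinear flow.* For `k > d/2` the space `Σ^k` is an algebra (`exists_isAlgConst`): the `H^k`
part is Young's inequality for the convolution of Fourier transforms, and the weighted part follows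
from the embedding `H^k ⊆ L^∞`. Expanding the exponential in powers of `|f|²` then gives that
`f ↦ e^{-itμ|f|²} f - f` is Lipschitz on balls of `Σ^k` with constant `O(t)`
(`exists_nonlinearFlow_lipschitz`) and equals `-itμ|f|² f` up to `O(t²)`
(`exists_nonlinearFlow_taylor`).

*The free flow.* On `H^k` it is an isometry. For the weight `|x|^k` one uses that
`e^{-itΔ} x_i e^{itΔ} = x_i + 4πt D_i`, where `D_i` has symbol `ξ_i` (`posS_pow_freeS`). Expanding
`(x_i + 4πt D_i)^k` leaves words in position and momentum operators. These are bounded by the pure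
powers `x_i^n` and `D_i^n`, that is, by the `Σ^k` norm, because for two symmetric operators whose
commutator is a scalar the norms `‖A^a B^b f‖`, with `a + b` fixed, are convex in `a` up to terms of
lower degree (`sq_norm_monomial_le`, `exists_wordNorm_le`). So `e^{itΔ}` is bounded on `Σ^k`, and
`e^{itΔ} - 1` is `O(t)` from `Σ^{k+2}` to `Σ^k`, first on Schwartz functions and then, by
approximation and lower semicontinuity of the norms, in general
(`exists_sigmaENorm_freePropagator_le`, `exists_sigmaENorm_freePropagator_sub_le`).

*The exact solution.* By `hasDerivWithinAt_freePropagator_neg`, `v` is differentiable in `L²` with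
derivative `-iμ e^{-itΔ}(|ψ|²ψ)`. The balls of `Σ^k` are convex and closed in `L²`, so bounds for
the `L²` derivative in `Σ^k` yield bounds for increments in `Σ^k`
(`smul_sub_mem_of_hasDerivWithinAt`). Applied three times, this shows that `v`, hence `ψ`, hence
`v'` is Lipschitz in `Σ^k`, and therefore that `v` has a second order Taylor remainder
(`exists_interaction_taylor`). Here the bound in `Σ^{k+2}` is used.

*Conclusion.* Together these give the error recursion `exists_error_step`, valid while the iterates
stay in a fixed ball of `Σ^k`; a discrete Gronwall argument keeps them there when `τ` is small.
-/

open Filter Topology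

/-! ### Interpolation for two operators with a scalar commutator -/

/-- A sequence that is convex up to an error `D` lies below the maximum of its end values, up to
`D n²`. -/
theorem le_max_of_almost_convex (u : ℕ → ℝ) (n : ℕ) {D : ℝ} (hD : 0 ≤ D)
    (h : ∀ a, a + 2 ≤ n → u (a + 1) ≤ (u a + u (a + 2)) / 2 + D) :
    ∀ a ≤ n, u a ≤ max (u 0) (u n) + D * n ^ 2 := by
  -- Subtracting the concave parabola `D a (n - a)` makes the sequence convex.
  set w : ℕ → ℝ := fun a => u a - D * (a * (n - a)) with hw
  have hconv : ∀ a, a + 2 ≤ n → w (a + 1) - w a ≤ w (a + 2) - w (a + 1) := by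
    intro a ha
    have := h a ha
    simp only [hw]; push_cast
    nlinarith
  have hw0 : w 0 = u 0 := by simp [hw]
  have hwn : w n = u n := by simp [hw]
  have key : ∀ a ≤ n, w a ≤ max (w 0) (w n) := by
    -- The first maximiser cannot be an interior point.
    obtain ⟨b, hb, hbmax⟩ := Finset.exists_max_image (Finset.range (n + 1)) w ⟨0, by simp⟩
    have hmax : ∀ a ≤ n, w a ≤ w b := fun a ha => hbmax a (by simp; omega)
    have hex : ∃ c, c ≤ n ∧ w c = w b := ⟨b, by simp at hb; omega, rfl⟩
    classical
    obtain ⟨hc, hcb⟩ := Nat.find_spec hex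
    intro a ha
    refine (hmax a ha).trans ?_
    rw [← hcb]
    rcases Nat.eq_zero_or_pos (Nat.find hex) with h0 | hpos
    · rw [h0]; exact le_max_left _ _
    · rcases Nat.lt_or_ge (Nat.find hex) n with hlt | hge
      · obtain ⟨c, hc'⟩ : ∃ c, Nat.find hex = c + 1 := ⟨Nat.find hex - 1, by omega⟩
        have h1 := hconv c (by omega)
        have h2 : w (c + 2) ≤ w (c + 1) := by
          rw [← hc', hcb]; exact hmax _ (by omega)
        have h3 : w c = w b := by
          refine le_antisymm (hmax _ (by omega)) ?_
          rw [← hcb, hc']; linarith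
        exact absurd ⟨by omega, h3⟩ (Nat.find_min hex (m := c) (by omega))
      · have : Nat.find hex = n := by omega
        rw [this]; exact le_max_right _ _
  intro a ha
  have h1 := key a ha
  rw [hw0, hwn] at h1
  have h2 : D * ((a : ℝ) * (n - a)) ≤ D * n ^ 2 := by
    have h3 : (a : ℝ) ≤ n := by exact_mod_cast ha
    have h4 : (0 : ℝ) ≤ a := by positivity
    gcongr
    nlinarith
  have h3 : u a = w a + D * (a * (n - a)) := by simp [hw]
  linarith

section TwoOperators

variable {V H : Type*} [AddCommGroup V] [Module ℂ V] [NormedAddCommGroup H]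
  [InnerProductSpace ℂ H]

theorem comm_pow_right {A B : V →ₗ[ℂ] V} {c : ℂ} (hc : ∀ f, A (B f) - B (A f) = c • f) (n : ℕ)
    (f : V) : A ((B ^ n) f) = (B ^ n) (A f) + ((n : ℂ) * c) • (B ^ (n - 1)) f := by
  induction n generalizing f with
  | zero => simp
  | succ n ih =>
    rw [pow_succ, Module.End.mul_apply, ih, Module.End.mul_apply,
      show A (B f) = B (A f) + c • f by rw [← hc f]; abel]
    rcases n with _ | n
    · simp
    · simp only [map_add, map_smul, Nat.add_sub_cancel]
      rw [← Module.End.mul_apply (B ^ n) B f, ← pow_succ]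
      push_cast
      module

theorem comm_pow_left {A B : V →ₗ[ℂ] V} {c : ℂ} (hc : ∀ f, A (B f) - B (A f) = c • f) (n : ℕ)
    (f : V) : (A ^ n) (B f) = B ((A ^ n) f) + ((n : ℂ) * c) • (A ^ (n - 1)) f := by
  have h := comm_pow_right (A := B) (B := A) (c := -c) (fun f => by rw [neg_smul, ← hc f]; abel) n f
  rw [h]; module

/-- One step of the interpolation: with `A` and `B` symmetric, moving one `A` to the right and one
`B` to the left in `‖A^{a+1} B^{b+1} f‖²` shows that these norms are log-convex in `a` along
`a + b = const`, up to terms of lower degree (bounded by `L`) coming from the commutator. -/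
theorem sq_norm_monomial_le {ι : V →ₗ[ℂ] H} {A B : V →ₗ[ℂ] V} {c : ℂ}
    (hA : ∀ f g, inner ℂ (ι (A f)) (ι g) = inner ℂ (ι f) (ι (A g)))
    (hB : ∀ f g, inner ℂ (ι (B f)) (ι g) = inner ℂ (ι f) (ι (B g)))
    (hc : ∀ f, A (B f) - B (A f) = c • f) (a b : ℕ) (f : V) {L : ℝ}
    (hL : ∀ i j, i + j ≤ a + b + 1 → ‖ι ((A ^ i) ((B ^ j) f))‖ ≤ L) :
    ‖ι ((A ^ (a + 1)) ((B ^ (b + 1)) f))‖ ≤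
      (‖ι ((A ^ a) ((B ^ (b + 2)) f))‖ + ‖ι ((A ^ (a + 2)) ((B ^ b) f))‖) / 2 +
        (a + 2) * (‖c‖ + 1) * L := by
  set p : ℕ → ℕ → V := fun i j => (A ^ i) ((B ^ j) f) with hp
  have hAp : ∀ i j, A (p i j) = p (i + 1) j := fun i j => by
    simp only [hp, pow_succ', Module.End.mul_apply]
  have hBp : ∀ i j, B (p i j) = p i (j + 1) - ((i : ℂ) * c) • p (i - 1) j := fun i j => by
    have := comm_pow_left hc i ((B ^ j) f)
    simp only [hp, pow_succ' B, Module.End.mul_apply]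
    rw [this]; abel
  have hBp' : ∀ i j, p i (j + 1) = B (p i j) + ((i : ℂ) * c) • p (i - 1) j := fun i j => by
    rw [hBp]; abel
  have hLn : 0 ≤ L := (norm_nonneg _).trans (hL 0 0 (by omega))
  have hmain : inner ℂ (ι (p (a + 1) (b + 1))) (ι (p (a + 1) (b + 1))) =
      inner ℂ (ι (p a (b + 2)) - ((a : ℂ) * c) • ι (p (a - 1) (b + 1))) (ι (p (a + 2) b)) +
        ((a + 2 : ℕ) * c) * inner ℂ (ι (p a (b + 1))) (ι (p (a + 1) b)) := by
    conv_lhs => rw [← hAp a (b + 1), hA, hAp, hAp, hBp' (a + 2) b]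
    rw [map_add, inner_add_right, ← hB, hBp, map_sub, map_smul, map_smul, inner_smul_right]
    simp only [show b + 1 + 1 = b + 2 from rfl,
      show a + 2 - 1 = a + 1 from rfl]
  set K : ℝ := (a + 2) * (‖c‖ + 1) * L with hK
  have hcn := norm_nonneg c
  have hsq : ‖ι (p (a + 1) (b + 1))‖ ^ 2 ≤
      (‖ι (p a (b + 2))‖ + K) * (‖ι (p (a + 2) b)‖ + K) := by
    have h0 : ‖ι (p (a + 1) (b + 1))‖ ^ 2 =
        ‖inner ℂ (ι (p (a + 1) (b + 1))) (ι (p (a + 1) (b + 1)))‖ := by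
      rw [inner_self_eq_norm_sq_to_K]; simp
    rw [h0, hmain]
    have h1 : ‖inner ℂ (ι (p a (b + 2)) - ((a : ℂ) * c) • ι (p (a - 1) (b + 1)))
        (ι (p (a + 2) b))‖ ≤ (‖ι (p a (b + 2))‖ + a * ‖c‖ * L) * ‖ι (p (a + 2) b)‖ := by
      refine (norm_inner_le_norm _ _).trans ?_
      gcongr
      refine (norm_sub_le _ _).trans ?_
      rw [norm_smul, norm_mul, Complex.norm_natCast]
      gcongr
      exact hL _ _ (by omega)
    have h2 : ‖((a + 2 : ℕ) * c) * inner ℂ (ι (p a (b + 1))) (ι (p (a + 1) b))‖ ≤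
        (a + 2) * ‖c‖ * (L * L) := by
      rw [norm_mul, norm_mul, Complex.norm_natCast]
      push_cast
      gcongr
      refine (norm_inner_le_norm _ _).trans ?_
      gcongr
      · exact hL _ _ (by omega)
      · exact hL _ _ (by omega)
    refine (norm_add_le _ _).trans ((add_le_add h1 h2).trans ?_)
    have h3 : a * ‖c‖ * L ≤ K := by
      rw [hK]; gcongr <;> linarith
    have h4 : (a + 2) * ‖c‖ * (L * L) ≤ K * K := by
      have : (a + 2) * ‖c‖ * L ≤ K := by rw [hK]; gcongr; linarith
      have h5 : L ≤ K := by
        rw [hK]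
        have : (1 : ℝ) ≤ (a + 2) * (‖c‖ + 1) := by nlinarith [(Nat.cast_nonneg a : (0 : ℝ) ≤ a)]
        nlinarith
      calc (a + 2) * ‖c‖ * (L * L) = ((a + 2) * ‖c‖ * L) * L := by ring
        _ ≤ K * K := by gcongr
    have hKn : 0 ≤ K := by positivity
    have h5 := norm_nonneg (ι (p a (b + 2)))
    have h6 := norm_nonneg (ι (p (a + 2) b))
    nlinarith
  have hKn : 0 ≤ K := by positivity
  have h5 := norm_nonneg (ι (p a (b + 2)))
  have h6 := norm_nonneg (ι (p (a + 2) b))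
  have : ‖ι (p (a + 1) (b + 1))‖ ≤ (‖ι (p a (b + 2))‖ + K + (‖ι (p (a + 2) b)‖ + K)) / 2 := by
    refine abs_le_of_sq_le_sq' ?_ (by positivity) |>.2
    nlinarith [sq_nonneg ((‖ι (p a (b + 2))‖ + K) - (‖ι (p (a + 2) b)‖ + K))]
  linarith

/-- Mixed monomials in two symmetric operators with scalar commutator are controlled by the pure
powers. -/
theorem exists_norm_monomial_le {ι : V →ₗ[ℂ] H} {A B : V →ₗ[ℂ] V} {c : ℂ}
    (hA : ∀ f g, inner ℂ (ι (A f)) (ι g) = inner ℂ (ι f) (ι (A g)))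
    (hB : ∀ f g, inner ℂ (ι (B f)) (ι g) = inner ℂ (ι f) (ι (B g)))
    (hc : ∀ f, A (B f) - B (A f) = c • f) (m : ℕ) :
    ∃ C : ℝ, 0 ≤ C ∧ ∀ (f : V) (R : ℝ), (∀ j ≤ m, ‖ι ((A ^ j) f)‖ ≤ R) →
      (∀ j ≤ m, ‖ι ((B ^ j) f)‖ ≤ R) →
      ∀ i j, i + j ≤ m → ‖ι ((A ^ i) ((B ^ j) f))‖ ≤ C * R := by
  induction m with
  | zero =>
    refine ⟨1, zero_le_one, fun f R h1 _ i j hij => ?_⟩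
    obtain rfl : i = 0 := by omega
    obtain rfl : j = 0 := by omega
    simpa using h1 0 le_rfl
  | succ m ih =>
    obtain ⟨C, hC0, hC⟩ := ih
    refine ⟨C + 1 + (m + 2) * (‖c‖ + 1) * C * (m + 1) ^ 2, by positivity,
      fun f R h1 h2 i j hij => ?_⟩
    have hR : 0 ≤ R := (norm_nonneg _).trans (h1 0 (by omega))
    have hlow : ∀ i j, i + j ≤ m → ‖ι ((A ^ i) ((B ^ j) f))‖ ≤ C * R :=
      hC f R (fun j hj => h1 j (by omega)) (fun j hj => h2 j (by omega))
    have hpos : 0 ≤ (m + 2) * (‖c‖ + 1) * (C * R) * (m + 1) ^ 2 := by positivity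
    rcases Nat.lt_or_ge (i + j) (m + 1) with hlt | hge
    · refine (hlow i j (by omega)).trans ?_
      nlinarith
    · set u : ℕ → ℝ := fun a => ‖ι ((A ^ a) ((B ^ (m + 1 - a)) f))‖ with hu
      have := le_max_of_almost_convex u (m + 1) (D := (m + 2) * (‖c‖ + 1) * (C * R))
        (by positivity) ?_ i (by omega)
      · have hui : u i = ‖ι ((A ^ i) ((B ^ j) f))‖ := by
          simp only [hu]; rw [show m + 1 - i = j by omega]
        rw [← hui]
        refine this.trans ?_
        have hmax : max (u 0) (u (m + 1)) ≤ R := by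
          refine max_le ?_ ?_
          · simpa [hu] using h2 (m + 1) le_rfl
          · simpa [hu] using h1 (m + 1) le_rfl
        push_cast
        nlinarith [mul_nonneg hC0 hR]
      · intro a ha
        have h := sq_norm_monomial_le hA hB hc a (m + 1 - (a + 2)) f (L := C * R)
          (fun i j hij => hlow i j (by omega))
        simp only [hu]
        rw [show m + 1 - (a + 1) = m + 1 - (a + 2) + 1 by omega,
          show m + 1 - a = m + 1 - (a + 2) + 2 by omega]
        refine h.trans ?_
        have : (a : ℝ) + 2 ≤ m + 2 := by
          have : (a : ℝ) ≤ m := by exact_mod_cast (by omega : a ≤ m)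
          linarith
        have := mul_nonneg hC0 hR
        gcongr

/-- The sum of `‖ι (w f)‖` over all words `w` of length at most `m` (with multiplicity) in the
letters `A` and `B`. -/
noncomputable def wordNorm (ι : V →ₗ[ℂ] H) (A B : V →ₗ[ℂ] V) : ℕ → V → ℝ
  | 0, f => ‖ι f‖
  | m + 1, f => wordNorm ι A B m f + wordNorm ι A B m (A f) + wordNorm ι A B m (B f)

theorem wordNorm_nonneg (ι : V →ₗ[ℂ] H) (A B : V →ₗ[ℂ] V) (m : ℕ) (f : V) :
    0 ≤ wordNorm ι A B m f := by
  induction m generalizing f with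
  | zero => exact norm_nonneg _
  | succ m ih => simp only [wordNorm]; linarith [ih f, ih (A f), ih (B f)]

theorem wordNorm_left_le (ι : V →ₗ[ℂ] H) (A B : V →ₗ[ℂ] V) (m : ℕ) (f : V) :
    wordNorm ι A B m (A f) ≤ wordNorm ι A B (m + 1) f := by
  simp only [wordNorm]
  linarith [wordNorm_nonneg ι A B m f, wordNorm_nonneg ι A B m (B f)]

theorem wordNorm_right_le (ι : V →ₗ[ℂ] H) (A B : V →ₗ[ℂ] V) (m : ℕ) (f : V) :
    wordNorm ι A B m (B f) ≤ wordNorm ι A B (m + 1) f := by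
  simp only [wordNorm]
  linarith [wordNorm_nonneg ι A B m f, wordNorm_nonneg ι A B m (A f)]

theorem wordNorm_left_pow_le (ι : V →ₗ[ℂ] H) (A B : V →ₗ[ℂ] V) (m k : ℕ) (f : V) :
    wordNorm ι A B m ((A ^ k) f) ≤ wordNorm ι A B (m + k) f := by
  induction k generalizing f with
  | zero => simp
  | succ k ih =>
    rw [pow_succ, Module.End.mul_apply]
    exact (ih (A f)).trans (wordNorm_left_le ι A B (m + k) f)

theorem norm_right_right_left_pow_le (ι : V →ₗ[ℂ] H) (A B : V →ₗ[ℂ] V) (k : ℕ) (f : V) :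
    ‖ι (B (B ((A ^ k) f)))‖ ≤ wordNorm ι A B (k + 2) f := by
  have h0 : ‖ι (B (B ((A ^ k) f)))‖ = wordNorm ι A B 0 (B (B ((A ^ k) f))) := rfl
  rw [h0, add_comm k 2]
  exact (wordNorm_right_le ι A B 0 _).trans ((wordNorm_right_le ι A B 1 _).trans
    (wordNorm_left_pow_le ι A B 2 k f))

theorem exists_wordNorm_le_of_monomial (ι : V →ₗ[ℂ] H) {A B : V →ₗ[ℂ] V} {c : ℂ}
    (hc : ∀ f, A (B f) - B (A f) = c • f) (m : ℕ) :
    ∃ C : ℝ, 0 ≤ C ∧ ∀ (f : V) (L : ℝ),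
      (∀ i j, i + j ≤ m → ‖ι ((A ^ i) ((B ^ j) f))‖ ≤ L) → wordNorm ι A B m f ≤ C * L := by
  induction m with
  | zero => exact ⟨1, zero_le_one, fun f L h => by simpa [wordNorm] using h 0 0 le_rfl⟩
  | succ m ih =>
    obtain ⟨C, hC0, hC⟩ := ih
    refine ⟨C + C * (1 + m * ‖c‖) + C, by positivity, fun f L h => ?_⟩
    have hL : 0 ≤ L := (norm_nonneg _).trans (h 0 0 (by omega))
    have h1 : wordNorm ι A B m f ≤ C * L := hC f L fun i j hij => h i j (by omega)
    have h2 : wordNorm ι A B m (B f) ≤ C * L := hC (B f) L fun i j hij => by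
      rw [← Module.End.mul_apply (B ^ j), ← pow_succ]
      exact h i (j + 1) (by omega)
    have h3 : wordNorm ι A B m (A f) ≤ C * ((1 + m * ‖c‖) * L) := hC (A f) _ fun i j hij => by
      have : (B ^ j) (A f) = A ((B ^ j) f) - ((j : ℂ) * c) • (B ^ (j - 1)) f := by
        rw [comm_pow_right hc]; abel
      rw [this, map_sub, map_smul, ← Module.End.mul_apply (A ^ i) A, ← pow_succ, map_sub, map_smul]
      refine (norm_sub_le _ _).trans ?_
      rw [norm_smul, norm_mul, Complex.norm_natCast, add_mul, one_mul]
      have hj : (j : ℝ) ≤ m := by exact_mod_cast (by omega : j ≤ m)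
      gcongr
      · exact h _ _ (by omega)
      · exact h _ _ (by omega)
    simp only [wordNorm]
    linarith

/-- All words of length at most `m` in two symmetric operators with scalar commutator are
controlled by the pure powers. -/
theorem exists_wordNorm_le {ι : V →ₗ[ℂ] H} {A B : V →ₗ[ℂ] V} {c : ℂ}
    (hA : ∀ f g, inner ℂ (ι (A f)) (ι g) = inner ℂ (ι f) (ι (A g)))
    (hB : ∀ f g, inner ℂ (ι (B f)) (ι g) = inner ℂ (ι f) (ι (B g)))
    (hc : ∀ f, A (B f) - B (A f) = c • f) (m : ℕ) :
    ∃ C : ℝ, 0 ≤ C ∧ ∀ (f : V) (R : ℝ), (∀ j ≤ m, ‖ι ((A ^ j) f)‖ ≤ R) →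
      (∀ j ≤ m, ‖ι ((B ^ j) f)‖ ≤ R) → wordNorm ι A B m f ≤ C * R := by
  obtain ⟨C₁, h₁, H₁⟩ := exists_norm_monomial_le hA hB hc m
  obtain ⟨C₂, h₂, H₂⟩ := exists_wordNorm_le_of_monomial ι hc m
  exact ⟨C₂ * C₁, by positivity, fun f R hf hf' => by
    rw [mul_assoc]; exact H₂ f _ (H₁ f R hf hf')⟩

theorem norm_add_smul_pow_le (ι : V →ₗ[ℂ] H) (A B : V →ₗ[ℂ] V) (s : ℂ) (k : ℕ) (f : V) :
    ‖ι (((A + s • B) ^ k) f)‖ ≤ (1 + ‖s‖) ^ k * wordNorm ι A B k f := by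
  induction k generalizing f with
  | zero => simp [wordNorm]
  | succ k ih =>
    rw [pow_succ, Module.End.mul_apply, LinearMap.add_apply, LinearMap.smul_apply, map_add,
      map_smul, map_add, map_smul]
    refine (norm_add_le _ _).trans ?_
    rw [norm_smul]
    have h1 := (ih (A f)).trans (mul_le_mul_of_nonneg_left (wordNorm_left_le ι A B k f)
      (by positivity))
    have h2 := (ih (B f)).trans (mul_le_mul_of_nonneg_left (wordNorm_right_le ι A B k f)
      (by positivity))
    rw [pow_succ]
    nlinarith [norm_nonneg s]

theorem norm_add_smul_pow_sub_le (ι : V →ₗ[ℂ] H) (A B : V →ₗ[ℂ] V) (s : ℂ) (k : ℕ) (f : V) :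
    ‖ι (((A + s • B) ^ k) f - (A ^ k) f)‖ ≤
      ‖s‖ * (k * (1 + ‖s‖) ^ k) * wordNorm ι A B k f := by
  induction k generalizing f with
  | zero => simp
  | succ k ih =>
    have : ((A + s • B) ^ (k + 1)) f - (A ^ (k + 1)) f =
        (((A + s • B) ^ k) (A f) - (A ^ k) (A f)) + s • ((A + s • B) ^ k) (B f) := by
      rw [pow_succ, pow_succ, Module.End.mul_apply, Module.End.mul_apply, LinearMap.add_apply,
        LinearMap.smul_apply, map_add, map_smul]
      abel
    rw [this, map_add, map_smul]
    refine (norm_add_le _ _).trans ?_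
    rw [norm_smul]
    have h1 := (ih (A f)).trans (mul_le_mul_of_nonneg_left (wordNorm_left_le ι A B k f)
      (by positivity))
    have h2 := mul_le_mul_of_nonneg_left ((norm_add_smul_pow_le ι A B s k (B f)).trans
      (mul_le_mul_of_nonneg_left (wordNorm_right_le ι A B k f) (by positivity))) (norm_nonneg s)
    refine (add_le_add h1 h2).trans ?_
    have h3 : (1 + ‖s‖) ^ k ≤ (1 + ‖s‖) ^ (k + 1) :=
      pow_le_pow_right₀ (by linarith [norm_nonneg s]) (by omega)
    have hW := wordNorm_nonneg ι A B (k + 1) f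
    calc _ = ‖s‖ * ((k + 1) * (1 + ‖s‖) ^ k) * wordNorm ι A B (k + 1) f := by ring
      _ ≤ ‖s‖ * ((k + 1) * (1 + ‖s‖) ^ (k + 1)) * wordNorm ι A B (k + 1) f := by gcongr
      _ = _ := by push_cast; ring

end TwoOperators

/-! ### Weighted `L²` norms and their lower semicontinuity -/

section Weighted

variable {d : ℕ}

/-- The weighted norm `‖w f‖_{L²}`, in `[0, ∞]`. It is defined for functions, not for classes in
`L²`, so that it applies to Schwartz functions as they are. -/
noncomputable def wENorm (w : Rd d → ℝ) (f : Rd d → ℂ) : ℝ≥0∞ :=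
  eLpNorm (fun x => (w x : ℂ) * f x) 2 volume

/-- The weight `(1 + |2πξ|²)^{k/2}` of `H^k`. -/
noncomputable def sobolevWeight (k : ℕ) (ξ : Rd d) : ℝ :=
  (1 + (2 * Real.pi * ‖ξ‖) ^ 2) ^ ((k : ℝ) / 2)

theorem sobolevENorm_eq (k : ℕ) (f : L2Space d) :
    sobolevENorm k f = wENorm (sobolevWeight k) (𝓕 f : L2Space d) := rfl

theorem sigmaENorm_eq (k : ℕ) (f : L2Space d) :
    sigmaENorm k f = sobolevENorm k f + wENorm (fun x => ‖x‖ ^ k) f := rfl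

@[fun_prop]
theorem continuous_sobolevWeight (k : ℕ) : Continuous (sobolevWeight (d := d) k) := by
  unfold sobolevWeight
  refine Continuous.rpow_const (by fun_prop) fun x => Or.inl (by positivity)

theorem one_le_sobolevWeight (k : ℕ) (ξ : Rd d) : 1 ≤ sobolevWeight k ξ :=
  Real.one_le_rpow (by nlinarith [sq_nonneg (2 * Real.pi * ‖ξ‖)]) (by positivity)

theorem sobolevWeight_pos (k : ℕ) (ξ : Rd d) : 0 < sobolevWeight k ξ :=
  zero_lt_one.trans_le (one_le_sobolevWeight k ξ)

theorem sobolevWeight_nonneg (k : ℕ) (ξ : Rd d) : 0 ≤ sobolevWeight k ξ :=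
  (sobolevWeight_pos k ξ).le

theorem sobolevWeight_mono {k l : ℕ} (h : k ≤ l) (ξ : Rd d) :
    sobolevWeight k ξ ≤ sobolevWeight l ξ := by
  unfold sobolevWeight
  refine Real.rpow_le_rpow_of_exponent_le (by nlinarith [sq_nonneg (2 * Real.pi * ‖ξ‖)]) ?_
  have : (k : ℝ) ≤ l := by exact_mod_cast h
  linarith

theorem sobolevWeight_add_two (k : ℕ) (ξ : Rd d) :
    sobolevWeight (k + 2) ξ = sobolevWeight k ξ * (1 + (2 * Real.pi * ‖ξ‖) ^ 2) := by
  unfold sobolevWeight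
  push_cast
  rw [show ((k : ℝ) + 2) / 2 = k / 2 + 1 by ring, Real.rpow_add (by positivity), Real.rpow_one]

theorem norm_pow_le_sobolevWeight {j k : ℕ} (h : j ≤ k) (ξ : Rd d) :
    ‖ξ‖ ^ j ≤ sobolevWeight k ξ := by
  refine le_trans ?_ (sobolevWeight_mono h ξ)
  unfold sobolevWeight
  have h1 : ‖ξ‖ ^ j = (‖ξ‖ ^ 2) ^ ((j : ℝ) / 2) := by
    rw [← Real.rpow_natCast (‖ξ‖) 2, ← Real.rpow_mul (norm_nonneg _), ← Real.rpow_natCast]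
    congr 1; push_cast; ring
  rw [h1]
  refine Real.rpow_le_rpow (by positivity) ?_ (by positivity)
  have : 1 ≤ (2 * Real.pi) ^ 2 := by nlinarith [Real.pi_gt_three]
  rw [mul_pow]
  nlinarith [sq_nonneg ‖ξ‖]

theorem sobolevWeight_add_le (k : ℕ) (ξ η : Rd d) :
    sobolevWeight k (ξ + η) ≤ 2 ^ k * (sobolevWeight k ξ + sobolevWeight k η) := by
  have key : ∀ a b : Rd d, ‖a‖ ≤ ‖b‖ → sobolevWeight k (a + b) ≤ 2 ^ k * sobolevWeight k b := by
    intro a b hab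
    unfold sobolevWeight
    have h2 : (2 : ℝ) ^ k = (4 : ℝ) ^ ((k : ℝ) / 2) := by
      rw [show (4 : ℝ) = 2 ^ (2 : ℝ) by norm_num, ← Real.rpow_mul (by norm_num),
        ← Real.rpow_natCast]
      congr 1; ring
    rw [h2, ← Real.mul_rpow (by norm_num) (by positivity)]
    refine Real.rpow_le_rpow (by positivity) ?_ (by positivity)
    have h3 : ‖a + b‖ ≤ 2 * ‖b‖ := (norm_add_le a b).trans (by linarith)
    have h4 : ‖a + b‖ ^ 2 ≤ (2 * ‖b‖) ^ 2 := pow_le_pow_left₀ (norm_nonneg _) h3 2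
    have h5 : (0 : ℝ) ≤ (2 * Real.pi) ^ 2 := by positivity
    nlinarith [mul_le_mul_of_nonneg_left h4 h5]
  have hξ := sobolevWeight_nonneg k ξ
  have hη := sobolevWeight_nonneg k η
  have h2 : (0 : ℝ) ≤ 2 ^ k := by positivity
  rcases le_total ‖ξ‖ ‖η‖ with h | h
  · refine (key ξ η h).trans ?_
    gcongr; linarith
  · rw [add_comm ξ η]
    refine (key η ξ h).trans ?_
    gcongr; linarith

theorem sobolevWeight_add_le_mul (k : ℕ) (ξ η : Rd d) :
    sobolevWeight k (ξ + η) ≤ 2 ^ (k + 1) * (sobolevWeight k ξ * sobolevWeight k η) := by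
  refine (sobolevWeight_add_le k ξ η).trans ?_
  rw [pow_succ, mul_assoc]
  have h1 := one_le_sobolevWeight k ξ
  have h2 := one_le_sobolevWeight k η
  gcongr
  nlinarith

theorem wENorm_congr {w : Rd d → ℝ} {f g : Rd d → ℂ} (h : f =ᵐ[volume] g) :
    wENorm w f = wENorm w g :=
  eLpNorm_congr_ae (h.mono fun x hx => by simp only [hx])

theorem wENorm_mono {w : Rd d → ℝ} {f g : Rd d → ℂ} (h : ∀ᵐ x, ‖f x‖ ≤ ‖g x‖) :
    wENorm w f ≤ wENorm w g :=
  eLpNorm_mono_ae (h.mono fun x hx => by rw [norm_mul, norm_mul]; gcongr)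

theorem wENorm_add_le {w : Rd d → ℝ} (hw : Continuous w) {f g : Rd d → ℂ}
    (hf : AEStronglyMeasurable f volume) (hg : AEStronglyMeasurable g volume) :
    wENorm w (f + g) ≤ wENorm w f + wENorm w g := by
  have : (fun x => (w x : ℂ) * (f + g) x) = (fun x => (w x : ℂ) * f x) + fun x => w x * g x := by
    ext x; simp [mul_add]
  unfold wENorm
  have hw' : AEStronglyMeasurable (fun x => (w x : ℂ)) volume :=
    (Complex.continuous_ofReal.comp hw).aestronglyMeasurable
  rw [this]
  exact eLpNorm_add_le (hw'.mul hf) (hw'.mul hg) (by norm_num)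

theorem wENorm_const_smul (w : Rd d → ℝ) (c : ℂ) (f : Rd d → ℂ) :
    wENorm w (c • f) = ‖c‖ₑ * wENorm w f := by
  have : (fun x => (w x : ℂ) * (c • f) x) = c • fun x => (w x : ℂ) * f x := by
    ext x; simp; ring
  unfold wENorm
  rw [this, eLpNorm_const_smul]

/-- If `|w| ≤ c |v|` then the norms compare in the same way. -/
theorem wENorm_weight_mono {w v : Rd d → ℝ} {c : ℝ≥0} (h : ∀ x, |w x| ≤ c * |v x|)
    (f : Rd d → ℂ) : wENorm w f ≤ c * wENorm v f := by
  refine eLpNorm_le_nnreal_smul_eLpNorm_of_ae_le_mul (ae_of_all _ fun x => ?_) 2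
  rw [← NNReal.coe_le_coe]
  simp only [coe_nnnorm, norm_mul, NNReal.coe_mul, Complex.norm_real, Real.norm_eq_abs]
  rw [← mul_assoc]
  exact mul_le_mul_of_nonneg_right (h x) (norm_nonneg _)

/-- Weighted `L²` norms are lower semicontinuous with respect to convergence in `L²`. -/
theorem wENorm_le_of_tendsto {w : Rd d → ℝ} (hw : Continuous w) {u : ℕ → L2Space d}
    {f : L2Space d} (h : Tendsto u atTop (𝓝 f)) {r : ℕ → ℝ≥0∞} {r' : ℝ≥0∞}
    (hr : Tendsto r atTop (𝓝 r')) (hu : ∀ j, wENorm w (u j) ≤ r j) : wENorm w f ≤ r' := by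
  obtain ⟨ns, hns, hae⟩ := (tendstoInMeasure_of_tendsto_Lp h).exists_seq_tendsto_ae
  have hw' : AEStronglyMeasurable (fun x => (w x : ℂ)) volume :=
    (Complex.continuous_ofReal.comp hw).aestronglyMeasurable
  have h1 : wENorm w f ≤ liminf (fun j => wENorm w (u (ns j))) atTop := by
    refine Lp.eLpNorm_lim_le_liminf_eLpNorm
      (fun j => hw'.mul (Lp.aestronglyMeasurable _)) _ ?_
    filter_upwards [hae] with x hx
    exact hx.const_mul _
  refine h1.trans ?_
  rw [← (hr.comp hns.tendsto_atTop).liminf_eq]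
  exact liminf_le_liminf (Eventually.of_forall fun j => hu (ns j))

theorem fourier_sub_L2 (f g : L2Space d) : 𝓕 (f - g) = 𝓕 f - 𝓕 g :=
  (Lp.fourierTransformₗᵢ (Rd d) ℂ).map_sub f g

theorem enorm_fourier_L2 (f : L2Space d) : ‖𝓕 f‖ₑ = ‖f‖ₑ := by
  rw [← ofReal_norm, ← ofReal_norm, Lp.norm_fourier_eq]

theorem sobolevENorm_add_le (k : ℕ) (f g : L2Space d) :
    sobolevENorm k (f + g) ≤ sobolevENorm k f + sobolevENorm k g := by
  rw [sobolevENorm_eq, FourierTransform.fourier_add, wENorm_congr (Lp.coeFn_add _ _)]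
  exact wENorm_add_le (by fun_prop) (Lp.aestronglyMeasurable _) (Lp.aestronglyMeasurable _)

theorem sobolevENorm_smul (k : ℕ) (c : ℂ) (f : L2Space d) :
    sobolevENorm k (c • f) = ‖c‖ₑ * sobolevENorm k f := by
  rw [sobolevENorm_eq, FourierTransform.fourier_smul, wENorm_congr (Lp.coeFn_smul _ _),
    wENorm_const_smul, sobolevENorm_eq]

theorem sobolevENorm_le_of_tendsto {k : ℕ} {u : ℕ → L2Space d}
    {f : L2Space d} (h : Tendsto u atTop (𝓝 f)) {r : ℕ → ℝ≥0∞} {r' : ℝ≥0∞}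
    (hr : Tendsto r atTop (𝓝 r')) (hu : ∀ j, sobolevENorm k (u j) ≤ r j) :
    sobolevENorm k f ≤ r' :=
  wENorm_le_of_tendsto (continuous_sobolevWeight k)
    (((Lp.fourierTransformₗᵢ (Rd d) ℂ).continuous.tendsto f).comp h) hr hu

theorem enorm_le_sobolevENorm (k : ℕ) (f : L2Space d) : ‖f‖ₑ ≤ sobolevENorm k f := by
  rw [← enorm_fourier_L2, Lp.enorm_def, sobolevENorm_eq, wENorm]
  refine eLpNorm_mono fun x => ?_
  rw [norm_mul, Complex.norm_real, Real.norm_eq_abs, abs_of_pos (sobolevWeight_pos k x)]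
  exact le_mul_of_one_le_left (norm_nonneg _) (one_le_sobolevWeight k x)

theorem sobolevENorm_mono {k l : ℕ} (h : k ≤ l) (f : L2Space d) :
    sobolevENorm k f ≤ sobolevENorm l f := by
  simp only [sobolevENorm_eq]
  simpa using wENorm_weight_mono (c := 1) (w := sobolevWeight k) (v := sobolevWeight l)
    (fun x => by
      rw [abs_of_pos (sobolevWeight_pos k x), abs_of_pos (sobolevWeight_pos l x)]
      simpa using sobolevWeight_mono h x) (𝓕 f : L2Space d)

theorem sigmaENorm_add_le (k : ℕ) (f g : L2Space d) :
    sigmaENorm k (f + g) ≤ sigmaENorm k f + sigmaENorm k g := by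
  have h1 := sobolevENorm_add_le k f g
  have h2 : wENorm (fun x => ‖x‖ ^ k) (f + g : L2Space d) ≤
      wENorm (fun x => ‖x‖ ^ k) f + wENorm (fun x => ‖x‖ ^ k) g := by
    rw [wENorm_congr (Lp.coeFn_add _ _)]
    exact wENorm_add_le (by fun_prop) (Lp.aestronglyMeasurable _) (Lp.aestronglyMeasurable _)
  simp only [sigmaENorm_eq]
  calc _ ≤ _ := add_le_add h1 h2
    _ = _ := by ring

theorem sigmaENorm_smul (k : ℕ) (c : ℂ) (f : L2Space d) :
    sigmaENorm k (c • f) = ‖c‖ₑ * sigmaENorm k f := by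
  simp only [sigmaENorm_eq, sobolevENorm_smul, mul_add]
  rw [wENorm_congr (Lp.coeFn_smul _ _), wENorm_const_smul]

theorem sigmaENorm_neg (k : ℕ) (f : L2Space d) : sigmaENorm k (-f) = sigmaENorm k f := by
  have := sigmaENorm_smul k (-1) f
  simpa using this

theorem sigmaENorm_sub_le (k : ℕ) (f g : L2Space d) :
    sigmaENorm k (f - g) ≤ sigmaENorm k f + sigmaENorm k g := by
  rw [sub_eq_add_neg, ← sigmaENorm_neg k g]; exact sigmaENorm_add_le _ _ _

theorem sigmaENorm_zero (k : ℕ) : sigmaENorm k (0 : L2Space d) = 0 := by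
  have := sigmaENorm_smul k 0 (0 : L2Space d)
  simpa using this

theorem sobolevENorm_le_sigmaENorm (k : ℕ) (f : L2Space d) :
    sobolevENorm k f ≤ sigmaENorm k f := le_self_add

theorem weight_le_sigmaENorm (k : ℕ) (f : L2Space d) :
    wENorm (fun x => ‖x‖ ^ k) f ≤ sigmaENorm k f := le_add_self

theorem enorm_le_sigmaENorm (k : ℕ) (f : L2Space d) : ‖f‖ₑ ≤ sigmaENorm k f :=
  (enorm_le_sobolevENorm k f).trans (sobolevENorm_le_sigmaENorm k f)

/-- The `Σ^k` norm is lower semicontinuous with respect to convergence in `L²`. -/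
theorem sigmaENorm_le_of_tendsto {k : ℕ} {u : ℕ → L2Space d}
    {f : L2Space d} (h : Tendsto u atTop (𝓝 f)) {r s : ℕ → ℝ≥0∞} {r' s' : ℝ≥0∞}
    (hr : Tendsto r atTop (𝓝 r')) (hs : Tendsto s atTop (𝓝 s'))
    (hu : ∀ j, sobolevENorm k (u j) ≤ r j)
    (hu' : ∀ j, wENorm (fun x => ‖x‖ ^ k) (u j) ≤ s j) :
    sigmaENorm k f ≤ r' + s' :=
  add_le_add (sobolevENorm_le_of_tendsto h hr hu) (wENorm_le_of_tendsto (by fun_prop) h hs hu')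

theorem weight_le_enorm_add {j k : ℕ} (h : j ≤ k) (f : L2Space d) :
    wENorm (fun x => ‖x‖ ^ j) f ≤ ‖f‖ₑ + wENorm (fun x => ‖x‖ ^ k) f := by
  have h1 : wENorm (fun x => ‖x‖ ^ j) f ≤ wENorm (fun x => 1 + ‖x‖ ^ k) f := by
    simpa using wENorm_weight_mono (c := 1) (w := fun x : Rd d => ‖x‖ ^ j)
      (v := fun x => 1 + ‖x‖ ^ k) (fun x => by
        rw [abs_of_nonneg (by positivity), abs_of_nonneg (by positivity), NNReal.coe_one, one_mul]
        rcases le_total ‖x‖ 1 with hx | hx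
        · exact (pow_le_one₀ (norm_nonneg _) hx).trans (by linarith [pow_nonneg (norm_nonneg x) k])
        · exact (pow_le_pow_right₀ hx h).trans (by linarith)) f
  refine h1.trans ?_
  have h2 : wENorm (fun x : Rd d => 1 + ‖x‖ ^ k) f =
      eLpNorm ((f : Rd d → ℂ) + fun x => ((‖x‖ ^ k : ℝ) : ℂ) * f x) 2 volume := by
    unfold wENorm
    congr 1; ext x; simp; ring
  rw [h2, Lp.enorm_def]
  exact eLpNorm_add_le (Lp.aestronglyMeasurable _)
    ((Continuous.aestronglyMeasurable (by fun_prop)).mul (Lp.aestronglyMeasurable _)) (by norm_num)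

theorem sigmaENorm_le_two_mul {j k : ℕ} (h : j ≤ k) (f : L2Space d) :
    sigmaENorm j f ≤ 2 * sigmaENorm k f := by
  have h1 := sobolevENorm_mono h f
  have h2 := weight_le_enorm_add h f
  have h3 := enorm_le_sigmaENorm k f
  rw [sigmaENorm_eq j, two_mul]
  calc _ ≤ sobolevENorm k f + (‖f‖ₑ + wENorm (fun x => ‖x‖ ^ k) f) := add_le_add h1 h2
    _ = ‖f‖ₑ + sigmaENorm k f := by rw [sigmaENorm_eq]; ring
    _ ≤ _ := by gcongr

/-- The balls of `Σ^k` are closed in `L²`. -/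
theorem isClosed_sigmaENorm_le (k : ℕ) (r : ℝ≥0∞) :
    IsClosed {f : L2Space d | sigmaENorm k f ≤ r} := by
  refine IsSeqClosed.isClosed fun u f hu hf => ?_
  -- Along a subsequence both parts of the norm converge in the compact space `[0, ∞]`.
  obtain ⟨a, -, φ, hφ, ha⟩ := (isCompact_univ (X := ℝ≥0∞)).tendsto_subseq
    (x := fun j => sobolevENorm k (u j)) (fun _ => Set.mem_univ _)
  obtain ⟨b, -, χ, hχ, hb⟩ := (isCompact_univ (X := ℝ≥0∞)).tendsto_subseq
    (x := fun j => wENorm (fun x => ‖x‖ ^ k) (u (φ j))) (fun _ => Set.mem_univ _)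
  have ha' := ha.comp hχ.tendsto_atTop
  have hab : a + b ≤ r := le_of_tendsto (ha'.add hb)
    (Eventually.of_forall fun j => hu (φ (χ j)))
  refine le_trans ?_ hab
  exact sigmaENorm_le_of_tendsto (hf.comp (hφ.comp hχ).tendsto_atTop) ha' hb
    (fun j => le_rfl) (fun j => le_rfl)

theorem convex_sigmaENorm_le (k : ℕ) (r : ℝ≥0∞) :
    Convex ℝ {f : L2Space d | sigmaENorm k f ≤ r} := by
  intro f hf g hg a b ha hb hab
  have hs : ∀ (c : ℝ), 0 ≤ c → ∀ f : L2Space d, sigmaENorm k (c • f) =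
      ENNReal.ofReal c * sigmaENorm k f := by
    intro c hc f
    have : c • f = (c : ℂ) • f := (Complex.coe_smul c f).symm
    rw [this, sigmaENorm_smul, ← ofReal_norm, Complex.norm_real, Real.norm_of_nonneg hc]
  refine (sigmaENorm_add_le _ _ _).trans ?_
  rw [hs a ha, hs b hb]
  calc _ ≤ ENNReal.ofReal a * r + ENNReal.ofReal b * r := by gcongr <;> assumption
    _ = r := by rw [← add_mul, ← ENNReal.ofReal_add ha hb, hab]; simp

end Weighted

/-! ### Products in `H^m` -/

section Products

variable {d : ℕ}

/-- Young's inequality `L² * L¹ ⊆ L²`. -/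
theorem lintegral_conv_sq_le {a b : Rd d → ℝ≥0∞} (ha : Measurable a) (hb : Measurable b) :
    ∫⁻ ξ, (∫⁻ η, b η * a (ξ - η)) ^ 2 ≤ (∫⁻ η, b η) ^ 2 * ∫⁻ ξ, a ξ ^ 2 := by
  have hsqrt : ∀ x : ℝ≥0∞, x ^ (1 / 2 : ℝ) * x ^ (1 / 2 : ℝ) = x := fun x => by
    rw [← ENNReal.rpow_add_of_nonneg _ _ (by norm_num) (by norm_num)]; norm_num
  have hsqrt' : ∀ x : ℝ≥0∞, (x ^ (1 / 2 : ℝ)) ^ 2 = x := fun x => by rw [sq, hsqrt]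
  have hcs : ∀ ξ, (∫⁻ η, b η * a (ξ - η)) ^ 2 ≤ (∫⁻ η, b η) * ∫⁻ η, b η * a (ξ - η) ^ 2 := by
    intro ξ
    have h := ENNReal.lintegral_mul_le_Lp_mul_Lq (volume : Measure (Rd d))
      (f := fun η => b η ^ (1 / 2 : ℝ)) (g := fun η => b η ^ (1 / 2 : ℝ) * a (ξ - η))
      Real.HolderConjugate.two_two (by fun_prop) (by fun_prop)
    have h' : ∫⁻ η, b η * a (ξ - η) ≤ (∫⁻ η, b η) ^ (1 / 2 : ℝ) *
        (∫⁻ η, b η * a (ξ - η) ^ 2) ^ (1 / 2 : ℝ) := by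
      refine le_trans (le_of_eq ?_) (h.trans (le_of_eq ?_))
      · refine lintegral_congr fun η => ?_
        simp only [Pi.mul_apply]
        rw [← mul_assoc, hsqrt]
      · simp only [ENNReal.rpow_ofNat, mul_pow, hsqrt']
    calc _ ≤ ((∫⁻ η, b η) ^ (1 / 2 : ℝ) * (∫⁻ η, b η * a (ξ - η) ^ 2) ^ (1 / 2 : ℝ)) ^ 2 := by
          gcongr
      _ = _ := by rw [mul_pow, hsqrt', hsqrt']
  calc _ ≤ ∫⁻ ξ, (∫⁻ η, b η) * ∫⁻ η, b η * a (ξ - η) ^ 2 := lintegral_mono hcs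
    _ = (∫⁻ η, b η) * ∫⁻ ξ, ∫⁻ η, b η * a (ξ - η) ^ 2 := by
        rw [lintegral_const_mul]
        exact Measurable.lintegral_prod_right'
          (f := fun p : Rd d × Rd d => b p.2 * a (p.1 - p.2) ^ 2)
          (by fun_prop)
    _ = (∫⁻ η, b η) * ∫⁻ η, ∫⁻ ξ, b η * a (ξ - η) ^ 2 := by
        rw [lintegral_lintegral_swap]
        exact Measurable.aemeasurable (by fun_prop)
    _ = (∫⁻ η, b η) * ∫⁻ η, b η * ∫⁻ ξ, a ξ ^ 2 := by
        congr 1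
        refine lintegral_congr fun η => ?_
        rw [lintegral_const_mul _ (by fun_prop), lintegral_sub_right_eq_self (fun ξ => a ξ ^ 2) η]
    _ = _ := by rw [lintegral_mul_const _ hb]; ring

theorem eLpNorm_two_eq (f : Rd d → ℂ) :
    eLpNorm f 2 volume = (∫⁻ x, ‖f x‖ₑ ^ 2) ^ (1 / 2 : ℝ) := by
  rw [eLpNorm_eq_lintegral_rpow_enorm_toReal (by norm_num) (by norm_num)]
  simp

theorem wENorm_eq_lintegral {w : Rd d → ℝ} (hw : ∀ x, 0 ≤ w x) (f : Rd d → ℂ) :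
    wENorm w f = (∫⁻ x, (ENNReal.ofReal (w x) * ‖f x‖ₑ) ^ 2) ^ (1 / 2 : ℝ) := by
  rw [wENorm, eLpNorm_two_eq]
  congr 1
  refine lintegral_congr fun x => ?_
  rw [enorm_mul, ← ofReal_norm (w x : ℂ), Complex.norm_real, Real.norm_of_nonneg (hw x)]

/-- Young's inequality in terms of norms. -/
theorem lintegral_conv_rpow_le {a b : Rd d → ℝ≥0∞} (ha : Measurable a) (hb : Measurable b) :
    (∫⁻ ξ, (∫⁻ η, b η * a (ξ - η)) ^ 2) ^ (1 / 2 : ℝ) ≤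
      (∫⁻ η, b η) * (∫⁻ ξ, a ξ ^ 2) ^ (1 / 2 : ℝ) := by
  refine (ENNReal.rpow_le_rpow (lintegral_conv_sq_le ha hb) (by norm_num)).trans (le_of_eq ?_)
  rw [ENNReal.mul_rpow_of_nonneg _ _ (by norm_num), ← ENNReal.rpow_natCast_mul]
  norm_num

theorem const_mul_lintegral_rpow (c : ℝ≥0∞) {a : Rd d → ℝ≥0∞} (ha : Measurable a) :
    (∫⁻ ξ, (c * a ξ) ^ 2) ^ (1 / 2 : ℝ) = c * (∫⁻ ξ, a ξ ^ 2) ^ (1 / 2 : ℝ) := by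
  simp only [mul_pow]
  rw [lintegral_const_mul _ (by fun_prop), ENNReal.mul_rpow_of_nonneg _ _ (by norm_num),
    ← ENNReal.rpow_natCast_mul]
  norm_num

theorem measurable_conv {a b : Rd d → ℝ≥0∞} (ha : Measurable a) (hb : Measurable b) :
    Measurable fun ξ => ∫⁻ η, b η * a (ξ - η) :=
  Measurable.lintegral_prod_right' (f := fun p : Rd d × Rd d => b p.2 * a (p.1 - p.2))
    (by fun_prop)

/-- Weighted Young inequality for a submultiplicative weight, with the full weight on both
factors. -/
theorem weighted_conv_le_of_mul {W a b h : Rd d → ℝ≥0∞} (hW : Measurable W) (ha : Measurable a)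
    (hb : Measurable b) {c : ℝ≥0∞} (hc : ∀ ξ η, W (ξ + η) ≤ c * (W ξ * W η))
    (hle : ∀ ξ, h ξ ≤ ∫⁻ η, b η * a (ξ - η)) :
    (∫⁻ ξ, (W ξ * h ξ) ^ 2) ^ (1 / 2 : ℝ) ≤
      c * ((∫⁻ η, W η * b η) * (∫⁻ ξ, (W ξ * a ξ) ^ 2) ^ (1 / 2 : ℝ)) := by
  refine le_trans ?_ (mul_le_mul_right (lintegral_conv_rpow_le (hW.mul ha) (hW.mul hb)) c)
  rw [← const_mul_lintegral_rpow _ (measurable_conv (hW.mul ha) (hW.mul hb))]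
  refine ENNReal.rpow_le_rpow (lintegral_mono fun ξ => pow_le_pow_left' ?_ 2) (by norm_num)
  refine (mul_le_mul_right (hle ξ) _).trans ?_
  rw [← lintegral_const_mul _ (by fun_prop), ← lintegral_const_mul _ (by fun_prop)]
  refine lintegral_mono fun η => ?_
  have := hc η (ξ - η)
  rw [add_sub_cancel] at this
  calc W ξ * (b η * a (ξ - η)) ≤ c * (W η * W (ξ - η)) * (b η * a (ξ - η)) := by gcongr
    _ = _ := by simp only [Pi.mul_apply]; ring

/-- Weighted Young inequality for a quasi-subadditive weight, which falls on one factor at a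
time. -/
theorem weighted_conv_le_of_add {W a b h : Rd d → ℝ≥0∞} (hW : Measurable W) (ha : Measurable a)
    (hb : Measurable b) {c : ℝ≥0∞} (hc : ∀ ξ η, W (ξ + η) ≤ c * (W ξ + W η))
    (hle : ∀ ξ, h ξ ≤ ∫⁻ η, b η * a (ξ - η)) :
    (∫⁻ ξ, (W ξ * h ξ) ^ 2) ^ (1 / 2 : ℝ) ≤
      c * ((∫⁻ η, a η) * (∫⁻ ξ, (W ξ * b ξ) ^ 2) ^ (1 / 2 : ℝ) +
        (∫⁻ η, b η) * (∫⁻ ξ, (W ξ * a ξ) ^ 2) ^ (1 / 2 : ℝ)) := by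
  set I : Rd d → ℝ≥0∞ := fun ξ => ∫⁻ η, a η * (W * b) (ξ - η) with hI
  set J : Rd d → ℝ≥0∞ := fun ξ => ∫⁻ η, b η * (W * a) (ξ - η) with hJ
  have hIm : Measurable I := measurable_conv (hW.mul hb) ha
  have hJm : Measurable J := measurable_conv (hW.mul ha) hb
  have hI' : ∀ ξ, I ξ = ∫⁻ η, a (ξ - η) * (W η * b η) := fun ξ => by
    rw [hI, ← lintegral_sub_left_eq_self _ ξ]
    simp
  have hpt : ∀ ξ, W ξ * h ξ ≤ c * (I ξ + J ξ) := by
    intro ξ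
    refine (mul_le_mul_right (hle ξ) _).trans ?_
    rw [hI', hJ, ← lintegral_add_left (by fun_prop), ← lintegral_const_mul _ (by fun_prop),
      ← lintegral_const_mul _ (by fun_prop)]
    refine lintegral_mono fun η => ?_
    have := hc η (ξ - η)
    rw [add_sub_cancel] at this
    calc W ξ * (b η * a (ξ - η)) ≤ c * (W η + W (ξ - η)) * (b η * a (ξ - η)) := by gcongr
      _ = _ := by simp only [Pi.mul_apply]; ring
  calc _ ≤ (∫⁻ ξ, (c * (I ξ + J ξ)) ^ 2) ^ (1 / 2 : ℝ) :=
        ENNReal.rpow_le_rpow (lintegral_mono fun ξ => pow_le_pow_left' (hpt ξ) 2) (by norm_num)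
    _ = c * (∫⁻ ξ, (I ξ + J ξ) ^ 2) ^ (1 / 2 : ℝ) :=
        const_mul_lintegral_rpow _ (hIm.add hJm)
    _ ≤ c * ((∫⁻ ξ, I ξ ^ 2) ^ (1 / 2 : ℝ) + (∫⁻ ξ, J ξ ^ 2) ^ (1 / 2 : ℝ)) := by
        gcongr
        have := ENNReal.lintegral_Lp_add_le (μ := (volume : Measure (Rd d))) (p := 2)
          hIm.aemeasurable hJm.aemeasurable (by norm_num)
        simpa using this
    _ ≤ _ := by
        gcongr
        · exact lintegral_conv_rpow_le (hW.mul hb) ha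
        · exact lintegral_conv_rpow_le (hW.mul ha) hb

/-- The product of two Schwartz functions. -/
noncomputable def mulS (f g : 𝓢(Rd d, ℂ)) : 𝓢(Rd d, ℂ) :=
  SchwartzMap.pairing (ContinuousLinearMap.mul ℂ ℂ) f g

@[simp]
theorem mulS_apply (f g : 𝓢(Rd d, ℂ)) (x : Rd d) : mulS f g x = f x * g x := rfl

theorem fourier_mulS (f g : 𝓢(Rd d, ℂ)) (ξ : Rd d) :
    𝓕 (mulS f g) ξ = ∫ η, 𝓕 f η * 𝓕 g (ξ - η) := by
  have hneg : ∀ (h : 𝓢(Rd d, ℂ)) (x : Rd d), 𝓕⁻ h x = 𝓕 h (-x) := fun h x => by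
    rw [SchwartzMap.fourierInv_apply_eq]; rfl
  have h1 : 𝓕⁻ (mulS f g) =
      SchwartzMap.convolution (ContinuousLinearMap.mul ℂ ℂ) (𝓕⁻ f) (𝓕⁻ g) := by
    have : 𝓕 (SchwartzMap.convolution (ContinuousLinearMap.mul ℂ ℂ) (𝓕⁻ f) (𝓕⁻ g)) =
        mulS f g := by
      rw [SchwartzMap.fourier_convolution, FourierTransform.fourier_fourierInv_eq,
        FourierTransform.fourier_fourierInv_eq]; rfl
    rw [← this, FourierTransform.fourierInv_fourier_eq]
  have h2 : 𝓕 (mulS f g) ξ = 𝓕⁻ (mulS f g) (-ξ) := by rw [hneg, neg_neg]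
  rw [h2, h1, SchwartzMap.convolution_apply, convolution_def, ← integral_neg_eq_self]
  refine integral_congr_ae (ae_of_all _ fun η => ?_)
  simp only [ContinuousLinearMap.mul_apply', hneg]
  congr 2
  · simp
  · abel_nf

theorem enorm_fourier_mulS_le (f g : 𝓢(Rd d, ℂ)) (ξ : Rd d) :
    ‖𝓕 (mulS f g) ξ‖ₑ ≤ ∫⁻ η, ‖𝓕 f η‖ₑ * ‖𝓕 g (ξ - η)‖ₑ := by
  rw [fourier_mulS]
  refine (enorm_integral_le_lintegral_enorm _).trans (le_of_eq ?_)
  simp only [enorm_mul]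

theorem sobolevENorm_toLp (k : ℕ) (f : 𝓢(Rd d, ℂ)) :
    sobolevENorm k (f.toLp 2 : L2Space d) = wENorm (sobolevWeight k) (𝓕 f : 𝓢(Rd d, ℂ)) := by
  rw [sobolevENorm_eq, SchwartzMap.toLp_fourier_eq]
  exact wENorm_congr (SchwartzMap.coeFn_toLp _ _ _)

theorem wENorm_toLp (w : Rd d → ℝ) (f : 𝓢(Rd d, ℂ)) :
    wENorm w (f.toLp 2 volume) = wENorm w f :=
  wENorm_congr (SchwartzMap.coeFn_toLp _ _ _)

theorem measurable_enorm_schwartz (f : 𝓢(Rd d, ℂ)) : Measurable fun ξ => ‖f ξ‖ₑ :=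
  f.continuous.enorm.measurable

theorem measurable_ofReal_sobolevWeight (k : ℕ) :
    Measurable fun ξ : Rd d => ENNReal.ofReal (sobolevWeight k ξ) :=
  (ENNReal.continuous_ofReal.comp (continuous_sobolevWeight k)).measurable

/-- Multiplication by a function whose Fourier transform is integrable with weight is bounded on
every `H^k`. -/
theorem sobolevENorm_mulS_le_left (k : ℕ) (f g : 𝓢(Rd d, ℂ)) :
    sobolevENorm k ((mulS f g).toLp 2) ≤
      2 ^ (k + 1) * ((∫⁻ ξ, ENNReal.ofReal (sobolevWeight k ξ) * ‖𝓕 f ξ‖ₑ) *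
        sobolevENorm k (g.toLp 2)) := by
  rw [sobolevENorm_toLp, sobolevENorm_toLp, wENorm_eq_lintegral (sobolevWeight_nonneg k),
    wENorm_eq_lintegral (sobolevWeight_nonneg k)]
  refine weighted_conv_le_of_mul (measurable_ofReal_sobolevWeight k)
    (measurable_enorm_schwartz (𝓕 g)) (measurable_enorm_schwartz (𝓕 f)) (fun ξ η => ?_)
    (enorm_fourier_mulS_le f g)
  have h2 : (2 : ℝ≥0∞) ^ (k + 1) = ENNReal.ofReal (2 ^ (k + 1)) := by
    rw [ENNReal.ofReal_pow (by norm_num)]; simp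
  rw [h2, ← ENNReal.ofReal_mul (sobolevWeight_nonneg _ _), ← ENNReal.ofReal_mul (by positivity)]
  exact ENNReal.ofReal_le_ofReal (sobolevWeight_add_le_mul k ξ η)

/-- For `k > d/2` the weight of `H^k` has a square integrable inverse, so that by Cauchy–Schwarz the
Fourier transform of an `H^k` function is integrable. -/
theorem exists_lintegral_le_wENorm {k : ℕ} (hk : (d : ℝ) / 2 < k) :
    ∃ C : ℝ≥0, ∀ f : Rd d → ℂ, AEStronglyMeasurable f volume →
      ∫⁻ ξ, ‖f ξ‖ₑ ≤ C * wENorm (sobolevWeight k) f := by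
  set S : ℝ≥0∞ := (∫⁻ ξ : Rd d, ‖((sobolevWeight k ξ)⁻¹ : ℝ)‖ₑ ^ 2) ^ (1 / 2 : ℝ) with hS
  have hSfin : S < ∞ := by
    refine ENNReal.rpow_lt_top_of_nonneg (by norm_num) (ne_of_lt ?_)
    have hint : Integrable (fun ξ : Rd d => ((1 + ‖ξ‖ ^ 2) ^ (-(2 * k : ℝ) / 2) : ℝ)) volume :=
      integrable_rpow_neg_one_add_norm_sq (by simp; linarith)
    have := hint.2
    rw [hasFiniteIntegral_iff_enorm] at this
    refine lt_of_le_of_lt (lintegral_mono fun ξ => ?_) this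
    rw [← enorm_pow, enorm_le_iff_norm_le, Real.norm_of_nonneg (by positivity),
      Real.norm_of_nonneg (by positivity)]
    unfold sobolevWeight
    rw [← Real.rpow_neg (by positivity), ← Real.rpow_natCast, ← Real.rpow_mul (by positivity)]
    have e : -((k : ℝ) / 2) * ((2 : ℕ) : ℝ) = -(2 * k : ℝ) / 2 := by push_cast; ring
    rw [e]
    refine Real.rpow_le_rpow_of_nonpos (by positivity) ?_
      (by linarith [(Nat.cast_nonneg k : (0 : ℝ) ≤ k)])
    have : 1 ≤ (2 * Real.pi) ^ 2 := by nlinarith [Real.pi_gt_three]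
    rw [mul_pow]
    nlinarith [sq_nonneg ‖ξ‖]
  refine ⟨S.toNNReal, fun f hf => ?_⟩
  rw [ENNReal.coe_toNNReal hSfin.ne]
  have h := ENNReal.lintegral_mul_le_Lp_mul_Lq (volume : Measure (Rd d))
    (f := fun ξ => ‖((sobolevWeight k ξ)⁻¹ : ℝ)‖ₑ)
    (g := fun ξ => ‖(sobolevWeight k ξ : ℂ) * f ξ‖ₑ)
    Real.HolderConjugate.two_two
    (((continuous_sobolevWeight k).inv₀ fun ξ =>
      (sobolevWeight_pos k ξ).ne').enorm.measurable.aemeasurable)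
    (((Complex.continuous_ofReal.comp (continuous_sobolevWeight k)).aestronglyMeasurable.mul
      hf).enorm)
  rw [wENorm, eLpNorm_two_eq]
  refine le_trans (le_of_eq ?_) (h.trans (le_of_eq ?_))
  · refine lintegral_congr fun ξ => ?_
    simp only [Pi.mul_apply]
    have : ‖(sobolevWeight k ξ : ℂ)‖ₑ = ‖sobolevWeight k ξ‖ₑ := by
      rw [← ofReal_norm, ← ofReal_norm, Complex.norm_real]
    rw [enorm_mul, this, ← mul_assoc, ← enorm_mul, inv_mul_cancel₀ (sobolevWeight_pos k ξ).ne']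
    simp
  · simp only [ENNReal.rpow_ofNat, hS]

/-- `H^k` is an algebra for `k > d/2`: the estimate for Schwartz functions. -/
theorem exists_sobolevENorm_mulS_le {k : ℕ} (hk : (d : ℝ) / 2 < k) :
    ∃ C : ℝ≥0, ∀ f g : 𝓢(Rd d, ℂ), sobolevENorm k ((mulS f g).toLp 2) ≤
      C * (sobolevENorm k (f.toLp 2) * sobolevENorm k (g.toLp 2)) := by
  obtain ⟨C, hC⟩ := exists_lintegral_le_wENorm hk
  refine ⟨2 ^ k * (C + C), fun f g => ?_⟩
  have hf := hC (𝓕 f : 𝓢(Rd d, ℂ)) (SchwartzMap.continuous _).aestronglyMeasurable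
  have hg := hC (𝓕 g : 𝓢(Rd d, ℂ)) (SchwartzMap.continuous _).aestronglyMeasurable
  have h2 : (2 : ℝ≥0∞) ^ k = ENNReal.ofReal (2 ^ k) := by
    rw [ENNReal.ofReal_pow (by norm_num)]; simp
  have h := weighted_conv_le_of_add (measurable_ofReal_sobolevWeight k)
    (measurable_enorm_schwartz (𝓕 g)) (measurable_enorm_schwartz (𝓕 f)) (c := 2 ^ k)
    (fun ξ η => by
      rw [h2, ← ENNReal.ofReal_add (sobolevWeight_nonneg _ _) (sobolevWeight_nonneg _ _),
        ← ENNReal.ofReal_mul (by positivity)]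
      exact ENNReal.ofReal_le_ofReal (sobolevWeight_add_le k ξ η))
    (enorm_fourier_mulS_le f g)
  simp only [← wENorm_eq_lintegral (sobolevWeight_nonneg k)] at h
  rw [sobolevENorm_toLp, sobolevENorm_toLp, sobolevENorm_toLp]
  refine h.trans ?_
  push_cast
  rw [mul_assoc]
  gcongr
  calc _ ≤ C * wENorm (sobolevWeight k) (𝓕 g : 𝓢(Rd d, ℂ)) *
        wENorm (sobolevWeight k) (𝓕 f : 𝓢(Rd d, ℂ)) +
        C * wENorm (sobolevWeight k) (𝓕 f : 𝓢(Rd d, ℂ)) *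
        wENorm (sobolevWeight k) (𝓕 g : 𝓢(Rd d, ℂ)) := by gcongr
    _ = _ := by ring

end Products

/-! ### Density of Schwartz functions, Sobolev embedding and algebra property of `H^k` -/

section Density

variable {d : ℕ}

theorem hasTemperateGrowth_sobolev_rpow (r : ℝ) :
    (fun ξ : Rd d => (((1 + (2 * Real.pi * ‖ξ‖) ^ 2) ^ r : ℝ) : ℂ)).HasTemperateGrowth := by
  have h1 := Function.hasTemperateGrowth_one_add_norm_sq_rpow (Rd d) r
  have h2 : (fun ξ : Rd d => (2 * Real.pi) • ξ).HasTemperateGrowth := by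
    have := ((2 * Real.pi) • ContinuousLinearMap.id ℝ (Rd d)).hasTemperateGrowth
    exact this
  have h3 := Function.Complex.hasTemperateGrowth_ofReal.comp (h1.comp h2)
  have h4 : (fun ξ : Rd d => (((1 + (2 * Real.pi * ‖ξ‖) ^ 2) ^ r : ℝ) : ℂ)) =
      Complex.ofReal ∘ ((fun x : Rd d => (1 + ‖x‖ ^ 2) ^ r) ∘ fun ξ => (2 * Real.pi) • ξ) := by
    funext ξ
    simp only [Function.comp_apply, norm_smul, Real.norm_of_nonneg Real.two_pi_pos.le]
  rw [h4]
  exact h3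

/-- Schwartz functions are dense in `H^k`. -/
theorem exists_schwartz_tendsto_sobolev (k : ℕ) {f : L2Space d} (hf : sobolevENorm k f < ∞) :
    ∃ u : ℕ → 𝓢(Rd d, ℂ),
      Tendsto (fun j => sobolevENorm k ((u j).toLp 2 volume - f)) atTop (𝓝 0) := by
  have hmem : MemLp (fun ξ => (sobolevWeight k ξ : ℂ) * (𝓕 f : L2Space d) ξ) 2 volume :=
    ⟨(Complex.continuous_ofReal.comp (continuous_sobolevWeight k)).aestronglyMeasurable.mul
      (Lp.aestronglyMeasurable _), hf⟩
  set G : L2Space d := hmem.toLp _ with hG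
  have hdense := SchwartzMap.denseRange_toLpCLM (E := Rd d) (F := ℂ) (p := 2)
    (μ := volume) (by norm_num) G
  obtain ⟨y, hy, hyG⟩ := mem_closure_iff_seq_limit.1 hdense
  choose g hg using hy
  set W : Rd d → ℂ := fun ξ => (((1 + (2 * Real.pi * ‖ξ‖) ^ 2) ^ (-((k : ℝ) / 2)) : ℝ) : ℂ) with hW
  have hWt : W.HasTemperateGrowth := hasTemperateGrowth_sobolev_rpow _
  refine ⟨fun j => 𝓕⁻ (SchwartzMap.smulLeftCLM ℂ W (g j)), ?_⟩
  have hlim : Tendsto (fun j => ‖y j - G‖ₑ) atTop (𝓝 0) := by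
    have := (tendsto_sub_nhds_zero_iff.2 hyG).enorm
    simpa using this
  refine hlim.congr fun j => ?_
  rw [sobolevENorm_eq, fourier_sub_L2, SchwartzMap.toLp_fourier_eq,
    FourierTransform.fourier_fourierInv_eq, Lp.enorm_def, ← hg j, wENorm]
  refine eLpNorm_congr_ae ?_
  filter_upwards [Lp.coeFn_sub
      ((SchwartzMap.smulLeftCLM ℂ W (g j)).toLp 2 volume : L2Space d) (𝓕 f),
    SchwartzMap.coeFn_toLp (SchwartzMap.smulLeftCLM ℂ W (g j)) 2 volume, hmem.coeFn_toLp,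
    Lp.coeFn_sub (SchwartzMap.toLpCLM ℝ ℂ 2 volume (g j)) G,
    SchwartzMap.coeFn_toLp (g j) 2 volume] with ξ h1 h2 h3 h4 h5
  rw [h1, h4, Pi.sub_apply, Pi.sub_apply, h2, SchwartzMap.toLpCLM_apply, h5, hG, h3,
    SchwartzMap.smulLeftCLM_apply_apply hWt]
  have : (sobolevWeight k ξ : ℂ) * W ξ = 1 := by
    rw [hW, sobolevWeight, ← Complex.ofReal_mul, ← Real.rpow_add (by positivity)]
    simp
  rw [mul_sub, smul_eq_mul, ← mul_assoc, this, one_mul]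

theorem tendsto_of_tendsto_sobolev {k : ℕ} {u : ℕ → L2Space d} {f : L2Space d}
    (h : Tendsto (fun j => sobolevENorm k (u j - f)) atTop (𝓝 0)) : Tendsto u atTop (𝓝 f) := by
  rw [← tendsto_sub_nhds_zero_iff, tendsto_zero_iff_enorm_tendsto_zero]
  exact tendsto_of_tendsto_of_tendsto_of_le_of_le tendsto_const_nhds h (fun _ => zero_le)
    (fun j => enorm_le_sobolevENorm k _)

theorem tendsto_add_sobolev {k : ℕ} {u : ℕ → L2Space d} {f : L2Space d}
    (h : Tendsto (fun j => sobolevENorm k (u j - f)) atTop (𝓝 0)) :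
    Tendsto (fun j => sobolevENorm k f + sobolevENorm k (u j - f)) atTop
      (𝓝 (sobolevENorm k f)) := by
  simpa using tendsto_const_nhds.add h

theorem sobolevENorm_le_add_sub (k : ℕ) (u f : L2Space d) :
    sobolevENorm k u ≤ sobolevENorm k f + sobolevENorm k (u - f) := by
  have := sobolevENorm_add_le k f (u - f)
  rwa [add_sub_cancel] at this

theorem enorm_schwartz_le (f : 𝓢(Rd d, ℂ)) (x : Rd d) :
    ‖f x‖ₑ ≤ ∫⁻ ξ, ‖(𝓕 f : 𝓢(Rd d, ℂ)) ξ‖ₑ := by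
  have h : f x = 𝓕⁻ ((𝓕 f : 𝓢(Rd d, ℂ)) : Rd d → ℂ) x := by
    rw [← SchwartzMap.fourierInv_coe, FourierTransform.fourierInv_fourier_eq]
  rw [h, Real.fourierInv_eq]
  refine (enorm_integral_le_lintegral_enorm _).trans (le_of_eq ?_)
  refine lintegral_congr fun ξ => ?_
  rw [← ofReal_norm, ← ofReal_norm, Circle.norm_smul]

/-- Sobolev embedding `H^k ⊆ L^∞` for `k > d/2`. -/
theorem exists_ae_enorm_le_sobolev {k : ℕ} (hk : (d : ℝ) / 2 < k) :
    ∃ C : ℝ≥0, ∀ f : L2Space d, ∀ᵐ x, ‖f x‖ₑ ≤ C * sobolevENorm k f := by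
  obtain ⟨C, hC⟩ := exists_lintegral_le_wENorm hk
  refine ⟨C + 1, fun f => ?_⟩
  rcases eq_or_ne (sobolevENorm k f) ∞ with htop | hfin
  · refine ae_of_all _ fun x => ?_
    rw [htop, ENNReal.mul_top (by simp)]; exact le_top
  · obtain ⟨u, hu⟩ := exists_schwartz_tendsto_sobolev k hfin.lt_top
    obtain ⟨ns, hns, hae⟩ := (tendstoInMeasure_of_tendsto_Lp
      (tendsto_of_tendsto_sobolev hu)).exists_seq_tendsto_ae
    filter_upwards [hae, ae_all_iff.2 fun j => SchwartzMap.coeFn_toLp (u j) 2 volume] with x hx hu'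
    have hlim := ENNReal.Tendsto.const_mul (a := ((C + 1 : ℝ≥0) : ℝ≥0∞))
      ((tendsto_add_sobolev hu).comp hns.tendsto_atTop) (Or.inr (by simp))
    refine le_of_tendsto_of_tendsto hx.enorm hlim (Eventually.of_forall fun j => ?_)
    simp only [Function.comp_apply]
    rw [hu']
    refine (enorm_schwartz_le _ _).trans
      ((hC _ (SchwartzMap.continuous _).aestronglyMeasurable).trans ?_)
    rw [← sobolevENorm_toLp]
    refine mul_le_mul' (by simp) (sobolevENorm_le_add_sub _ _ _)

theorem wENorm_mul_le {w : Rd d → ℝ} {f g : Rd d → ℂ} {c : ℝ≥0∞} (hw : Continuous w)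
    (hg : AEStronglyMeasurable g volume) (h : ∀ᵐ x, ‖f x‖ₑ ≤ c) :
    wENorm w (f * g) ≤ c * wENorm w g := by
  have h1 : (fun x => (w x : ℂ) * (f * g) x) = f • fun x => (w x : ℂ) * g x := by
    ext x; simp; ring
  rw [wENorm, h1]
  refine (eLpNorm_smul_le_eLpNorm_top_mul_eLpNorm 2
    ((Complex.continuous_ofReal.comp hw).aestronglyMeasurable.mul hg) f).trans ?_
  gcongr
  · exact essSup_le_of_ae_le _ h
  · exact le_rfl

theorem eLpNorm_mul_le_of_ae {f g : Rd d → ℂ} {c : ℝ≥0∞}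
    (hg : AEStronglyMeasurable g volume) (h : ∀ᵐ x, ‖f x‖ₑ ≤ c) :
    eLpNorm (f * g) 2 volume ≤ c * eLpNorm g 2 volume := by
  have := wENorm_mul_le (w := fun _ => 1) continuous_const hg h
  simp only [wENorm, Complex.ofReal_one, one_mul] at this
  exact this

/-- `H^k` is an algebra for `k > d/2`. -/
theorem exists_sobolevENorm_mul_le {k : ℕ} (hk : (d : ℝ) / 2 < k) :
    ∃ C : ℝ≥0, ∀ f g h : L2Space d, (h =ᵐ[volume] fun x => f x * g x) →
      sobolevENorm k f < ∞ → sobolevENorm k g < ∞ →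
      sobolevENorm k h ≤ C * (sobolevENorm k f * sobolevENorm k g) := by
  obtain ⟨C, hC⟩ := exists_sobolevENorm_mulS_le hk
  obtain ⟨B, hB⟩ := exists_ae_enorm_le_sobolev hk
  refine ⟨C, fun f g h hfg hf hg => ?_⟩
  obtain ⟨u, hu⟩ := exists_schwartz_tendsto_sobolev k hf
  obtain ⟨v, hv⟩ := exists_schwartz_tendsto_sobolev k hg
  have hu' := tendsto_add_sobolev hu
  have hv' := tendsto_add_sobolev hv
  refine sobolevENorm_le_of_tendsto (u := fun j => (mulS (u j) (v j)).toLp 2 volume)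
    (r := fun j => C * ((sobolevENorm k f + sobolevENorm k ((u j).toLp 2 volume - f)) *
      (sobolevENorm k g + sobolevENorm k ((v j).toLp 2 volume - g)))) ?_ ?_ ?_
  · -- `u_j v_j - f g = u_j (v_j - g) + (u_j - f) g`, with the first factors bounded uniformly.
    rw [← tendsto_sub_nhds_zero_iff, tendsto_zero_iff_enorm_tendsto_zero]
    have hlim : Tendsto (fun j =>
        B * (sobolevENorm k f + sobolevENorm k ((u j).toLp 2 volume - f)) *
        sobolevENorm k ((v j).toLp 2 volume - g) +
        B * sobolevENorm k ((u j).toLp 2 volume - f) * ‖g‖ₑ)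
        atTop (𝓝 (B * sobolevENorm k f * 0 + B * 0 * ‖g‖ₑ)) := by
      refine Tendsto.add (ENNReal.Tendsto.mul (ENNReal.Tendsto.const_mul hu' (Or.inr (by simp)))
        (Or.inr (by simp)) hv (Or.inr (by finiteness))) ?_
      exact ENNReal.Tendsto.mul_const (ENNReal.Tendsto.const_mul hu (Or.inr (by simp)))
        (Or.inr (by simp))
    rw [mul_zero, mul_zero, zero_mul, add_zero] at hlim
    refine tendsto_of_tendsto_of_tendsto_of_le_of_le tendsto_const_nhds hlim (fun _ => zero_le)
      (fun j => ?_)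
    have hae : ((mulS (u j) (v j)).toLp 2 volume - h : L2Space d) =ᵐ[volume]
        ((((u j).toLp 2 volume : L2Space d) : Rd d → ℂ) *
          (((v j).toLp 2 volume - g : L2Space d) : Rd d → ℂ)) +
        ((((u j).toLp 2 volume - f : L2Space d) : Rd d → ℂ) * (g : Rd d → ℂ)) := by
      filter_upwards [Lp.coeFn_sub ((mulS (u j) (v j)).toLp 2 volume : L2Space d) h,
        Lp.coeFn_sub ((v j).toLp 2 volume : L2Space d) g,
        Lp.coeFn_sub ((u j).toLp 2 volume : L2Space d) f, hfg,
        SchwartzMap.coeFn_toLp (mulS (u j) (v j)) 2 volume,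
        SchwartzMap.coeFn_toLp (u j) 2 volume, SchwartzMap.coeFn_toLp (v j) 2 volume]
        with x h1 h2 h3 h4 h5 h6 h7
      simp only [Pi.add_apply, Pi.mul_apply, h1, h2, h3, Pi.sub_apply, h4, h5, h6, h7, mulS_apply]
      ring
    rw [Lp.enorm_def, eLpNorm_congr_ae hae]
    refine (eLpNorm_add_le ((Lp.aestronglyMeasurable _).mul (Lp.aestronglyMeasurable _))
      ((Lp.aestronglyMeasurable _).mul (Lp.aestronglyMeasurable _)) (by norm_num)).trans ?_
    refine add_le_add ?_ ?_
    · refine (eLpNorm_mul_le_of_ae (Lp.aestronglyMeasurable _) (hB _)).trans ?_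
      rw [← Lp.enorm_def]
      gcongr
      · exact sobolevENorm_le_add_sub _ _ _
      · exact enorm_le_sobolevENorm k _
    · refine (eLpNorm_mul_le_of_ae (Lp.aestronglyMeasurable _) (hB _)).trans ?_
      rw [← Lp.enorm_def]
  · exact ENNReal.Tendsto.const_mul (ENNReal.Tendsto.mul hu' (Or.inr hg.ne) hv' (Or.inr hf.ne))
      (Or.inr (by simp))
  · intro j
    refine (hC _ _).trans ?_
    gcongr <;> exact sobolevENorm_le_add_sub _ _ _

/-- Complex conjugation of a Schwartz function. -/
noncomputable def conjS (f : 𝓢(Rd d, ℂ)) : 𝓢(Rd d, ℂ) :=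
  SchwartzMap.postcompCLM (𝕜 := ℝ) (Complex.conjCLE : ℂ →L[ℝ] ℂ) f

@[simp]
theorem conjS_apply (f : 𝓢(Rd d, ℂ)) (x : Rd d) : conjS f x = starRingEnd ℂ (f x) := rfl

theorem fourier_conjS (f : 𝓢(Rd d, ℂ)) (ξ : Rd d) :
    𝓕 (conjS f) ξ = starRingEnd ℂ (𝓕 f (-ξ)) := by
  rw [SchwartzMap.fourier_coe, SchwartzMap.fourier_coe, Real.fourier_eq, Real.fourier_eq,
    ← integral_conj]
  refine integral_congr_ae (ae_of_all _ fun x => ?_)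
  simp [Circle.smul_def, ← Circle.coe_inv_eq_conj, AddChar.map_neg_eq_inv]

theorem sobolevENorm_conjS (k : ℕ) (f : 𝓢(Rd d, ℂ)) :
    sobolevENorm k ((conjS f).toLp 2 volume) = sobolevENorm k (f.toLp 2 volume) := by
  rw [sobolevENorm_toLp, sobolevENorm_toLp, wENorm_eq_lintegral (sobolevWeight_nonneg k),
    wENorm_eq_lintegral (sobolevWeight_nonneg k)]
  congr 1
  rw [← lintegral_neg_eq_self]
  refine lintegral_congr fun ξ => ?_
  rw [fourier_conjS, neg_neg, RCLike.enorm_conj]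
  simp [sobolevWeight]

theorem sobolevENorm_conj_le {k : ℕ} {f h : L2Space d}
    (hfh : h =ᵐ[volume] fun x => starRingEnd ℂ (f x)) (hf : sobolevENorm k f < ∞) :
    sobolevENorm k h ≤ sobolevENorm k f := by
  obtain ⟨u, hu⟩ := exists_schwartz_tendsto_sobolev k hf
  refine sobolevENorm_le_of_tendsto (u := fun j => (conjS (u j)).toLp 2 volume) ?_
    (tendsto_add_sobolev hu) fun j => ?_
  · have h1 := tendsto_of_tendsto_sobolev hu
    rw [← tendsto_sub_nhds_zero_iff, tendsto_zero_iff_enorm_tendsto_zero] at h1 ⊢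
    refine h1.congr fun j => ?_
    rw [Lp.enorm_def, Lp.enorm_def]
    refine eLpNorm_congr_norm_ae ?_
    filter_upwards [Lp.coeFn_sub ((conjS (u j)).toLp 2 volume : L2Space d) h,
      Lp.coeFn_sub ((u j).toLp 2 volume : L2Space d) f, hfh,
      SchwartzMap.coeFn_toLp (conjS (u j)) 2 volume, SchwartzMap.coeFn_toLp (u j) 2 volume]
      with x h1 h2 h3 h4 h5
    rw [h1, h2, Pi.sub_apply, Pi.sub_apply, h3, h4, h5, conjS_apply, ← map_sub, RCLike.norm_conj]
  · rw [sobolevENorm_conjS]; exact sobolevENorm_le_add_sub _ _ _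

end Density

/-! ### Power series in the algebra `Σ^k` and the nonlinear flow -/

section Nonlinear

variable {d : ℕ}

/-- The function `F` agrees almost everywhere with an element of the closed ball of radius `r` of
`Σ^k`. -/
def SigmaBdd (k : ℕ) (r : ℝ≥0) (F : Rd d → ℂ) : Prop :=
  ∃ f : L2Space d, f =ᵐ[volume] F ∧ sigmaENorm k f ≤ r

namespace SigmaBdd

variable {k : ℕ} {r s : ℝ≥0} {F G : Rd d → ℂ}

theorem of_L2 {f : L2Space d} (h : sigmaENorm k f ≤ r) : SigmaBdd k r f := ⟨f, .rfl, h⟩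

theorem sigmaENorm_le {f : L2Space d} (h : SigmaBdd k r F) (hf : f =ᵐ[volume] F) :
    sigmaENorm k f ≤ r := by
  obtain ⟨g, hg, hgr⟩ := h
  rwa [show f = g from Lp.ext (hf.trans hg.symm)]

theorem congr (h : SigmaBdd k r F) (hFG : F =ᵐ[volume] G) : SigmaBdd k r G := by
  obtain ⟨g, hg, hgr⟩ := h
  exact ⟨g, hg.trans hFG, hgr⟩

theorem mono (h : SigmaBdd k r F) (hrs : r ≤ s) : SigmaBdd k s F := by
  obtain ⟨g, hg, hgr⟩ := h
  exact ⟨g, hg, hgr.trans (by exact_mod_cast hrs)⟩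

theorem add (hF : SigmaBdd k r F) (hG : SigmaBdd k s G) : SigmaBdd k (r + s) (F + G) := by
  obtain ⟨f, hf, hfr⟩ := hF
  obtain ⟨g, hg, hgr⟩ := hG
  refine ⟨f + g, (Lp.coeFn_add f g).trans (hf.add hg), (sigmaENorm_add_le k f g).trans ?_⟩
  push_cast
  gcongr

theorem smul (c : ℂ) (hF : SigmaBdd k r F) : SigmaBdd k (‖c‖₊ * r) (c • F) := by
  obtain ⟨f, hf, hfr⟩ := hF
  refine ⟨c • f, (Lp.coeFn_smul c f).trans (hf.const_smul c), ?_⟩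
  rw [sigmaENorm_smul, ENNReal.coe_mul]
  gcongr
  exact le_rfl

theorem sub (hF : SigmaBdd k r F) (hG : SigmaBdd k s G) : SigmaBdd k (r + s) (F - G) := by
  have := hF.add (hG.smul (-1))
  simpa [sub_eq_add_neg] using this

theorem conj (hF : SigmaBdd k r F) : SigmaBdd k r fun x => starRingEnd ℂ (F x) := by
  obtain ⟨f, hf, hfr⟩ := hF
  have hmem : MemLp (fun x => starRingEnd ℂ (f x)) 2 volume :=
    (Lp.memLp f).of_le
      (Complex.continuous_conj.comp_aestronglyMeasurable (Lp.aestronglyMeasurable f))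
      (ae_of_all _ fun x => by rw [RCLike.norm_conj])
  refine ⟨hmem.toLp _, hmem.coeFn_toLp.trans (hf.mono fun x hx => by simp only [hx]), ?_⟩
  refine le_trans (add_le_add (sobolevENorm_conj_le hmem.coeFn_toLp ?_) (le_of_eq ?_)) hfr
  · exact ((sobolevENorm_le_sigmaENorm k f).trans hfr).trans_lt ENNReal.coe_lt_top
  · refine eLpNorm_congr_norm_ae ?_
    filter_upwards [hmem.coeFn_toLp] with x hx
    rw [hx, norm_mul, norm_mul, RCLike.norm_conj]

/-- A series that converges absolutely in `Σ^k` and pointwise almost everywhere. -/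
theorem hasSum {P : ℕ → Rd d → ℂ} {β : ℕ → ℝ≥0} {b : ℝ≥0} (hP : ∀ n, SigmaBdd k (β n) (P n))
    (hβ : HasSum β b) (hF : ∀ᵐ x, HasSum (fun n => P n x) (F x)) : SigmaBdd k b F := by
  choose f hf hfβ using hP
  have hnorm : ∀ n, ‖f n‖ ≤ β n := fun n => by
    have := (enorm_le_sigmaENorm k (f n)).trans (hfβ n)
    rw [← ofReal_norm, ← ENNReal.ofReal_coe_nnreal, ENNReal.ofReal_le_ofReal_iff (by simp)] at this
    exact this
  obtain ⟨g, hg⟩ : Summable f := Summable.of_norm_bounded (g := fun n => (β n : ℝ))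
    (NNReal.summable_coe.2 hβ.summable) hnorm
  have hlim := hg.tendsto_sum_nat
  refine ⟨g, ?_, ?_⟩
  · obtain ⟨ns, hns, hae⟩ := (tendstoInMeasure_of_tendsto_Lp hlim).exists_seq_tendsto_ae
    have hsum : ∀ n, (∑ i ∈ Finset.range n, f i : L2Space d) =ᵐ[volume]
        fun x => ∑ i ∈ Finset.range n, P i x := by
      intro n
      induction n with
      | zero => simpa using! Lp.coeFn_zero ℂ 2 (volume : Measure (Rd d))
      | succ n ih =>
        rw [Finset.sum_range_succ]
        filter_upwards [Lp.coeFn_add (∑ i ∈ Finset.range n, f i) (f n), ih, hf n] with x h1 h2 h3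
        rw [h1, Pi.add_apply, h2, h3, Finset.sum_range_succ]
    filter_upwards [hae, hF, ae_all_iff.2 hsum] with x h1 h2 h3
    simp only [h3] at h1
    exact tendsto_nhds_unique h1 (h2.tendsto_sum_nat.comp hns.tendsto_atTop)
  · refine (isClosed_sigmaENorm_le k b).mem_of_tendsto hlim (Eventually.of_forall fun n => ?_)
    have hle : ∀ n, sigmaENorm k (∑ i ∈ Finset.range n, f i) ≤
        ∑ i ∈ Finset.range n, (β i : ℝ≥0∞) := by
      intro n
      induction n with
      | zero => simp [sigmaENorm_zero]
      | succ n ih =>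
        rw [Finset.sum_range_succ, Finset.sum_range_succ]
        exact (sigmaENorm_add_le _ _ _).trans (add_le_add ih (hfβ n))
    refine (hle n).trans ?_
    rw [← ENNReal.ofNNReal_finsetSum]
    exact_mod_cast hβ.summable.sum_le_tsum _ (fun _ _ => zero_le) |>.trans hβ.tsum_eq.le

end SigmaBdd

/-- `K` is an algebra constant of `Σ^k`: `‖F G‖ ≤ K ‖F‖ ‖G‖`, expressed through radii of balls, so
that `F` and `G` may be arbitrary representatives. -/
def IsAlgConst (d k : ℕ) (K : ℝ≥0) : Prop :=
  ∀ (r s : ℝ≥0) (F G : Rd d → ℂ), SigmaBdd k r F → SigmaBdd k s G →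
    SigmaBdd k (K * (r * s)) fun x => F x * G x

/-- `Σ^k` is an algebra for `k > d/2`. -/
theorem exists_isAlgConst {k : ℕ} (hk : (d : ℝ) / 2 < k) : ∃ K, IsAlgConst d k K := by
  obtain ⟨C, hC⟩ := exists_sobolevENorm_mul_le hk
  obtain ⟨B, hB⟩ := exists_ae_enorm_le_sobolev hk
  refine ⟨C + B, fun r s F G ⟨f, hf, hfr⟩ ⟨g, hg, hgs⟩ => ?_⟩
  have hsf := (sobolevENorm_le_sigmaENorm k f).trans hfr
  have hsg := (sobolevENorm_le_sigmaENorm k g).trans hgs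
  have hbd : ∀ᵐ x, ‖f x‖ₑ ≤ B * r := (hB f).mono fun x hx => hx.trans (by gcongr)
  have hmem : MemLp (fun x => f x * g x) 2 volume := by
    refine ⟨(Lp.aestronglyMeasurable f).mul (Lp.aestronglyMeasurable g), ?_⟩
    refine (eLpNorm_mul_le_of_ae (Lp.aestronglyMeasurable g) hbd).trans_lt ?_
    rw [← Lp.enorm_def]
    finiteness
  refine ⟨hmem.toLp _, hmem.coeFn_toLp.trans ?_, ?_⟩
  · filter_upwards [hf, hg] with x h1 h2
    rw [h1, h2]
  · rw [sigmaENorm_eq]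
    have h1 := hC f g _ hmem.coeFn_toLp (hsf.trans_lt ENNReal.coe_lt_top)
      (hsg.trans_lt ENNReal.coe_lt_top)
    have h2 : wENorm (fun x => ‖x‖ ^ k) (hmem.toLp _) ≤ B * r * s := by
      rw [wENorm_congr hmem.coeFn_toLp]
      refine (wENorm_mul_le (f := f) (g := g) (by fun_prop)
        (Lp.aestronglyMeasurable g) hbd).trans ?_
      gcongr
      exact (weight_le_sigmaENorm k g).trans hgs
    push_cast
    calc _ ≤ C * ((r : ℝ≥0∞) * s) + B * r * s := by
          refine add_le_add (h1.trans ?_) h2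
          gcongr
      _ = _ := by ring

/-- The function `|F|^{2n} F`. -/
noncomputable def oddPow (n : ℕ) (F : Rd d → ℂ) : Rd d → ℂ :=
  fun x => ((‖F x‖ ^ 2 : ℝ) : ℂ) ^ n * F x

theorem oddPow_zero (F : Rd d → ℂ) : oddPow 0 F = F := by
  funext x; simp [oddPow]

theorem oddPow_succ (n : ℕ) (F : Rd d → ℂ) :
    oddPow (n + 1) F = fun x => (F x * starRingEnd ℂ (F x)) * oddPow n F x := by
  ext x
  simp only [oddPow, pow_succ, Complex.mul_conj, Complex.normSq_eq_norm_sq]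
  push_cast; ring

theorem SigmaBdd.oddPow {k : ℕ} {K R : ℝ≥0} (hK : IsAlgConst d k K) {F : Rd d → ℂ}
    (hF : SigmaBdd k R F) (n : ℕ) : SigmaBdd k ((K ^ 2 * R ^ 2) ^ n * R) (oddPow n F) := by
  induction n with
  | zero => simpa [oddPow_zero] using hF
  | succ n ih =>
    rw [oddPow_succ]
    convert hK _ _ _ _ (hK _ _ _ _ hF hF.conj) ih using 1
    ring

/-- The factor `3ⁿ` is harmless, as these terms are divided by `n!` in the exponential series. -/
theorem SigmaBdd.oddPow_sub {k : ℕ} {K R δ : ℝ≥0} (hK : IsAlgConst d k K) {F G : Rd d → ℂ}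
    (hF : SigmaBdd k R F) (hG : SigmaBdd k R G) (hFG : SigmaBdd k δ (F - G)) (n : ℕ) :
    SigmaBdd k ((3 * (K ^ 2 * R ^ 2)) ^ n * δ) (_root_.oddPow n F - _root_.oddPow n G) := by
  induction n with
  | zero => simpa [oddPow_zero] using hFG
  | succ n ih =>
    -- With `P = |F|^{2n} F` and `Q = |G|^{2n} G`, the difference `|F|² P - |G|² Q` is the sum of
    -- `|F|² (P - Q)`, `F conj(F - G) Q` and `conj(G) (F - G) Q`.
    have h1 := hK _ _ _ _ (hK _ _ _ _ hF hF.conj) ih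
    have h2 := hK _ _ _ _ (hK _ _ _ _ hF hFG.conj) (hG.oddPow hK n)
    have h3 := hK _ _ _ _ (hK _ _ _ _ hG.conj hFG) (hG.oddPow hK n)
    have h := ((h1.add h2).add h3).congr (G := _root_.oddPow (n + 1) F - _root_.oddPow (n + 1) G)
      (ae_of_all _ fun x => by
        simp only [oddPow_succ, Pi.add_apply, Pi.sub_apply, map_sub]; ring)
    refine h.mono ?_
    set a := K ^ 2 * R ^ 2 with ha
    calc _ = a * (3 * a) ^ n * δ + 2 * a * (a ^ n) * δ := by rw [ha]; ring
      _ ≤ a * (3 * a) ^ n * δ + 2 * a * ((3 * a) ^ n) * δ := by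
        gcongr
        exact le_mul_of_one_le_left zero_le (by norm_num)
      _ = _ := by ring

theorem hasSum_exp_tail (z : ℂ) (j : ℕ) :
    HasSum (fun n => z ^ (n + j) / (n + j).factorial)
      (Complex.exp z - ∑ i ∈ Finset.range j, z ^ i / i.factorial) := by
  have h := NormedSpace.expSeries_div_hasSum_exp z
  rw [← Complex.exp_eq_exp_ℂ] at h
  exact (hasSum_nat_add_iff' j).2 h

/-- Summation of the tail of an exponential series in `Σ^k`: the terms from the `j`-th on
contribute a factor `‖c‖ ^ j`. -/
theorem SigmaBdd.exp_tail {k : ℕ} {b δ : ℝ≥0} {P : ℕ → Rd d → ℂ} {F : Rd d → ℂ}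
    (hP : ∀ n, SigmaBdd k (b ^ n * δ) (P n)) (c : ℂ) (j : ℕ)
    (hF : ∀ x, HasSum (fun n => c ^ (n + j) / (n + j).factorial * P (n + j) x) (F x)) :
    SigmaBdd k ((‖c‖₊ * b) ^ j * (Real.exp (‖c‖ * b)).toNNReal * δ) F := by
  have hexp : HasSum (fun n => (‖c‖₊ * b) ^ j * ((‖c‖₊ * b) ^ n / (n.factorial : ℝ≥0)) * δ)
      ((‖c‖₊ * b) ^ j * (Real.exp (‖c‖ * b)).toNNReal * δ) := by
    refine ((HasSum.mul_left _ ?_).mul_right δ)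
    rw [← NNReal.hasSum_coe, Real.coe_toNNReal _ (Real.exp_pos _).le]
    have h := NormedSpace.expSeries_div_hasSum_exp (‖c‖ * b : ℝ)
    rw [← Real.exp_eq_exp_ℝ] at h
    simpa using h
  refine SigmaBdd.hasSum (P := fun n => (c ^ (n + j) / (n + j).factorial) • P (n + j))
    (fun n => ((hP (n + j)).smul _).mono ?_) hexp (ae_of_all _ fun x => by simpa using hF x)
  have hfac : (n.factorial : ℝ≥0) ≤ (n + j).factorial := by
    exact_mod_cast Nat.factorial_le (Nat.le_add_right n j)
  rw [nnnorm_div, nnnorm_pow, Complex.nnnorm_natCast]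
  calc _ = (‖c‖₊ * b) ^ j * ((‖c‖₊ * b) ^ n / (n + j).factorial) * δ := by ring
    _ ≤ _ := by
      gcongr

theorem nonlinearFlow_ae (μ t : ℝ) (f : L2Space d) :
    nonlinearFlow μ t f =ᵐ[volume]
      fun x => Complex.exp ((-(Complex.I * (t * μ))) * ((‖f x‖ ^ 2 : ℝ) : ℂ)) * f x := by
  refine (MemLp.coeFn_toLp (memLp_phase_mul (((Lp.aestronglyMeasurable f).norm.pow 2).const_mul
    (-t * μ)) f)).trans (ae_of_all _ fun x => ?_)
  simp only
  congr 2
  simp only [Pi.pow_apply]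
  push_cast; ring

theorem norm_flow_coeff (μ t : ℝ) : ‖(-(Complex.I * (t * μ)) : ℂ)‖₊ = ‖t‖₊ * ‖μ‖₊ := by
  ext; simp

/-- The map `f ↦ e^{-itμ|f|²} f - f` is Lipschitz on balls of `Σ^k`, with a constant of order
`t`. -/
theorem exists_nonlinearFlow_lipschitz {k : ℕ} (hk : (d : ℝ) / 2 < k) (μ T : ℝ) (R : ℝ≥0) :
    ∃ L : ℝ≥0, ∀ f g : L2Space d, sigmaENorm k f ≤ R → sigmaENorm k g ≤ R →
      ∀ t : ℝ, 0 ≤ t → t ≤ T →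
        sigmaENorm k ((nonlinearFlow μ t f - f) - (nonlinearFlow μ t g - g)) ≤
          ENNReal.ofReal t * (L * sigmaENorm k (f - g)) := by
  obtain ⟨K, hK⟩ := exists_isAlgConst hk
  set b : ℝ≥0 := 3 * (K ^ 2 * R ^ 2) with hb
  refine ⟨‖μ‖₊ * b * (Real.exp (T * |μ| * b)).toNNReal, fun f g hf hg t ht htT => ?_⟩
  have hfin : sigmaENorm k (f - g) ≠ ∞ :=
    ((sigmaENorm_sub_le k f g).trans_lt (by
      refine (add_le_add hf hg).trans_lt ?_
      finiteness)).ne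
  set δ := (sigmaENorm k (f - g)).toNNReal with hδ
  have hδ' : sigmaENorm k (f - g) = δ := (ENNReal.coe_toNNReal hfin).symm
  have hP := SigmaBdd.oddPow_sub hK (SigmaBdd.of_L2 hf) (SigmaBdd.of_L2 hg)
    ((SigmaBdd.of_L2 hδ'.le).congr (Lp.coeFn_sub f g))
  set c : ℂ := -(Complex.I * (t * μ)) with hc
  have h := SigmaBdd.exp_tail (P := fun n => oddPow n f - oddPow n g) hP c 1
    (F := fun x => (Complex.exp (c * ((‖f x‖ ^ 2 : ℝ) : ℂ)) - 1) * f x -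
      (Complex.exp (c * ((‖g x‖ ^ 2 : ℝ) : ℂ)) - 1) * g x) (fun x => by
      have h1 := (hasSum_exp_tail (c * ((‖f x‖ ^ 2 : ℝ) : ℂ)) 1).mul_right (f x)
      have h2 := (hasSum_exp_tail (c * ((‖g x‖ ^ 2 : ℝ) : ℂ)) 1).mul_right (g x)
      have h3 := h1.sub h2
      simp only [Finset.sum_range_one, pow_zero, Nat.factorial_zero, Nat.cast_one, div_one] at h3
      refine (congrArg (fun P => HasSum P _) (funext fun n => ?_)).mp h3
      simp only [oddPow, Pi.sub_apply, mul_pow]; ring)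
  refine (h.sigmaENorm_le ?_).trans ?_
  · filter_upwards [Lp.coeFn_sub (nonlinearFlow μ t f - f) (nonlinearFlow μ t g - g),
      Lp.coeFn_sub (nonlinearFlow μ t f) f, Lp.coeFn_sub (nonlinearFlow μ t g) g,
      nonlinearFlow_ae μ t f, nonlinearFlow_ae μ t g] with x h1 h2 h3 h4 h5
    rw [h1, Pi.sub_apply, h2, h3, Pi.sub_apply, Pi.sub_apply, h4, h5]
    ring
  · have hcn : ‖c‖₊ = t.toNNReal * ‖μ‖₊ := by
      rw [hc, norm_flow_coeff, Real.nnnorm_of_nonneg ht, Real.toNNReal_of_nonneg ht]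
    have hcn' : ‖c‖ ≤ T * |μ| := by
      rw [← coe_nnnorm, hcn]
      push_cast
      rw [Real.coe_toNNReal _ ht, Real.norm_eq_abs]
      gcongr
    rw [hδ', ENNReal.ofReal, ← ENNReal.coe_mul, ← ENNReal.coe_mul, ENNReal.coe_le_coe, hcn, pow_one]
    calc _ ≤ (t.toNNReal * ‖μ‖₊ * b) * (Real.exp (T * |μ| * b)).toNNReal * δ := by gcongr
      _ = _ := by ring

/-- Second order expansion of the nonlinear flow in `Σ^k`. -/
theorem exists_nonlinearFlow_taylor {k : ℕ} (hk : (d : ℝ) / 2 < k) (μ T : ℝ) (R : ℝ≥0) :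
    ∃ L : ℝ≥0, ∀ f N : L2Space d, sigmaENorm k f ≤ R →
      (∀ᵐ x, N x = ((‖f x‖ ^ 2 : ℝ) : ℂ) * f x) → ∀ t : ℝ, 0 ≤ t → t ≤ T →
        sigmaENorm k (nonlinearFlow μ t f - f + (Complex.I * (t * μ)) • N) ≤
          ENNReal.ofReal t ^ 2 * L := by
  obtain ⟨K, hK⟩ := exists_isAlgConst hk
  set b : ℝ≥0 := K ^ 2 * R ^ 2 with hb
  refine ⟨(‖μ‖₊ * b) ^ 2 * (Real.exp (T * |μ| * b)).toNNReal * R, fun f N hf hN t ht htT => ?_⟩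
  set c : ℂ := -(Complex.I * (t * μ)) with hc
  have h := SigmaBdd.exp_tail (P := fun n => oddPow n f) ((SigmaBdd.of_L2 hf).oddPow hK) c 2
    (F := fun x => (Complex.exp (c * ((‖f x‖ ^ 2 : ℝ) : ℂ)) - 1 - c * ((‖f x‖ ^ 2 : ℝ) : ℂ)) * f x)
    (fun x => by
      have h1 := (hasSum_exp_tail (c * ((‖f x‖ ^ 2 : ℝ) : ℂ)) 2).mul_right (f x)
      simp only [Finset.sum_range_succ, Finset.sum_range_zero, zero_add, pow_zero,
        Nat.factorial_zero, Nat.cast_one, div_one, pow_one, Nat.factorial_one, ← sub_sub] at h1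
      refine (congrArg (fun P => HasSum P _) (funext fun n => ?_)).mp h1
      simp only [oddPow, mul_pow]; ring)
  refine (h.sigmaENorm_le ?_).trans ?_
  · filter_upwards [Lp.coeFn_add (nonlinearFlow μ t f - f) ((Complex.I * (t * μ)) • N),
      Lp.coeFn_sub (nonlinearFlow μ t f) f, Lp.coeFn_smul (Complex.I * (t * μ)) N,
      nonlinearFlow_ae μ t f, hN] with x h1 h2 h3 h4 h5
    rw [h1, Pi.add_apply, h2, h3, Pi.sub_apply, Pi.smul_apply, h4, h5, hc, smul_eq_mul]
    ring
  · have hcn : ‖c‖₊ = t.toNNReal * ‖μ‖₊ := by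
      rw [hc, norm_flow_coeff, Real.nnnorm_of_nonneg ht, Real.toNNReal_of_nonneg ht]
    have hcn' : ‖c‖ ≤ T * |μ| := by
      rw [← coe_nnnorm, hcn]
      push_cast
      rw [Real.coe_toNNReal _ ht, Real.norm_eq_abs]
      gcongr
    rw [ENNReal.ofReal, ← ENNReal.coe_pow, ← ENNReal.coe_mul, ENNReal.coe_le_coe, hcn]
    calc _ ≤ (t.toNNReal * ‖μ‖₊ * b) ^ 2 * (Real.exp (T * |μ| * b)).toNNReal * R := by gcongr
      _ = _ := by ring

/-- The cubic nonlinearity is bounded and Lipschitz on balls of `Σ^k`. -/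
theorem exists_cubic_le {k : ℕ} (hk : (d : ℝ) / 2 < k) (R : ℝ≥0) :
    ∃ L : ℝ≥0, (∀ f N : L2Space d, sigmaENorm k f ≤ R →
      (∀ᵐ x, N x = ((‖f x‖ ^ 2 : ℝ) : ℂ) * f x) → sigmaENorm k N ≤ L) ∧
      ∀ f g N P : L2Space d, sigmaENorm k f ≤ R → sigmaENorm k g ≤ R →
        (∀ᵐ x, N x = ((‖f x‖ ^ 2 : ℝ) : ℂ) * f x) →
        (∀ᵐ x, P x = ((‖g x‖ ^ 2 : ℝ) : ℂ) * g x) →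
        sigmaENorm k (N - P) ≤ L * sigmaENorm k (f - g) := by
  obtain ⟨K, hK⟩ := exists_isAlgConst hk
  refine ⟨(K ^ 2 * R ^ 2) * R + 3 * (K ^ 2 * R ^ 2), fun f N hf hN => ?_,
    fun f g N P hf hg hN hP => ?_⟩
  · have h := (SigmaBdd.of_L2 hf).oddPow hK 1
    refine (h.sigmaENorm_le ?_).trans ?_
    · filter_upwards [hN] with x hx
      rw [hx]; simp [oddPow]
    · rw [pow_one]; exact_mod_cast le_self_add
  · have hfin : sigmaENorm k (f - g) ≠ ∞ :=
      ((sigmaENorm_sub_le k f g).trans_lt (by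
        refine (add_le_add hf hg).trans_lt ?_
        finiteness)).ne
    set δ := (sigmaENorm k (f - g)).toNNReal with hδ
    have hδ' : sigmaENorm k (f - g) = δ := (ENNReal.coe_toNNReal hfin).symm
    have h := SigmaBdd.oddPow_sub hK (SigmaBdd.of_L2 hf) (SigmaBdd.of_L2 hg)
      ((SigmaBdd.of_L2 hδ'.le).congr (Lp.coeFn_sub f g)) 1
    refine (h.sigmaENorm_le ?_).trans ?_
    · filter_upwards [hN, hP, Lp.coeFn_sub N P] with x h1 h2 h3
      rw [h3, Pi.sub_apply, h1, h2]; simp [oddPow]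
    · rw [hδ', pow_one]
      norm_cast
      gcongr
      exact le_add_self

end Nonlinear

/-! ### The free propagator on `L²` -/

section FreePropagator

variable {d : ℕ}

/-- The symbol `e^{-it|2πξ|²}` of the free propagator. -/
noncomputable def chirp (t : ℝ) (ξ : Rd d) : ℂ :=
  Complex.exp (Complex.I * ((-t * (2 * Real.pi * ‖ξ‖) ^ 2 : ℝ) : ℂ))

theorem norm_chirp (t : ℝ) (ξ : Rd d) : ‖chirp t ξ‖ = 1 := by
  rw [chirp, mul_comm, Complex.norm_exp_ofReal_mul_I]

theorem chirp_add (s t : ℝ) (ξ : Rd d) : chirp (s + t) ξ = chirp s ξ * chirp t ξ := by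
  rw [chirp, chirp, chirp, ← Complex.exp_add]
  congr 1; push_cast; ring

theorem chirp_zero (ξ : Rd d) : chirp 0 ξ = 1 := by simp [chirp]

theorem norm_chirp_sub_one_le (t : ℝ) (ξ : Rd d) :
    ‖chirp t ξ - 1‖ ≤ |t| * (2 * Real.pi * ‖ξ‖) ^ 2 := by
  have := Real.norm_exp_I_mul_ofReal_sub_one_le (x := -t * (2 * Real.pi * ‖ξ‖) ^ 2)
  refine this.trans (le_of_eq ?_)
  rw [norm_mul, norm_neg, Real.norm_eq_abs, Real.norm_of_nonneg (by positivity)]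

theorem fourier_freePropagator_ae (t : ℝ) (f : L2Space d) :
    (𝓕 (freePropagator t f) : L2Space d) =ᵐ[volume]
      fun ξ => chirp t ξ * (𝓕 f : L2Space d) ξ := by
  rw [freePropagator, FourierTransform.fourier_fourierInv_eq]
  exact MemLp.coeFn_toLp _

theorem ext_fourier {f g : L2Space d} (h : (𝓕 f : L2Space d) =ᵐ[volume] (𝓕 g : L2Space d)) :
    f = g :=
  (Lp.fourierTransformₗᵢ (Rd d) ℂ).injective (Lp.ext h)

theorem freePropagator_add (t : ℝ) (f g : L2Space d) :
    freePropagator t (f + g) = freePropagator t f + freePropagator t g := by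
  refine ext_fourier ?_
  rw [FourierTransform.fourier_add]
  filter_upwards [fourier_freePropagator_ae t (f + g), fourier_freePropagator_ae t f,
    fourier_freePropagator_ae t g, Lp.coeFn_add (𝓕 f : L2Space d) (𝓕 g),
    Lp.coeFn_add (𝓕 (freePropagator t f) : L2Space d) (𝓕 (freePropagator t g))]
    with x h1 h2 h3 h4 h5
  rw [h1, h5, Pi.add_apply, h2, h3, FourierTransform.fourier_add, h4, Pi.add_apply]
  ring

theorem freePropagator_smul (t : ℝ) (c : ℂ) (f : L2Space d) :
    freePropagator t (c • f) = c • freePropagator t f := by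
  refine ext_fourier ?_
  rw [FourierTransform.fourier_smul]
  filter_upwards [fourier_freePropagator_ae t (c • f), fourier_freePropagator_ae t f,
    Lp.coeFn_smul c (𝓕 f : L2Space d),
    Lp.coeFn_smul c (𝓕 (freePropagator t f) : L2Space d)] with x h1 h2 h3 h4
  rw [h1, h4, Pi.smul_apply, h2, FourierTransform.fourier_smul, h3, Pi.smul_apply, smul_eq_mul,
    smul_eq_mul]
  ring

theorem norm_freePropagator (t : ℝ) (f : L2Space d) : ‖freePropagator t f‖ = ‖f‖ := by
  rw [← Lp.norm_fourier_eq, ← Lp.norm_fourier_eq f, Lp.norm_def, Lp.norm_def]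
  congr 1
  refine eLpNorm_congr_norm_ae ((fourier_freePropagator_ae t f).mono fun x hx => ?_)
  rw [hx, norm_mul, norm_chirp, one_mul]

/-- The free propagator as a linear isometry of `L²`. -/
noncomputable def freeLI (t : ℝ) : L2Space d →ₗᵢ[ℂ] L2Space d where
  toFun := freePropagator t
  map_add' := freePropagator_add t
  map_smul' := freePropagator_smul t
  norm_map' := norm_freePropagator t

theorem freePropagator_sub (t : ℝ) (f g : L2Space d) :
    freePropagator t (f - g) = freePropagator t f - freePropagator t g := (freeLI t).map_sub f g

theorem continuous_freePropagator (t : ℝ) : Continuous (freePropagator (d := d) t) :=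
  (freeLI t).continuous

theorem freePropagator_freePropagator (s t : ℝ) (f : L2Space d) :
    freePropagator s (freePropagator t f) = freePropagator (s + t) f := by
  refine ext_fourier ?_
  filter_upwards [fourier_freePropagator_ae s (freePropagator t f), fourier_freePropagator_ae t f,
    fourier_freePropagator_ae (s + t) f] with x h1 h2 h3
  rw [h1, h2, h3, chirp_add, mul_assoc]

theorem freePropagator_zero (f : L2Space d) : freePropagator 0 f = f := by
  refine ext_fourier ?_
  filter_upwards [fourier_freePropagator_ae 0 f] with x h1
  rw [h1, chirp_zero, one_mul]

theorem sobolevENorm_freePropagator (k : ℕ) (t : ℝ) (f : L2Space d) :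
    sobolevENorm k (freePropagator t f) = sobolevENorm k f := by
  rw [sobolevENorm_eq, sobolevENorm_eq]
  refine eLpNorm_congr_norm_ae ((fourier_freePropagator_ae t f).mono fun x hx => ?_)
  rw [hx, norm_mul, norm_mul, norm_mul, norm_chirp, one_mul]

theorem sobolevENorm_freePropagator_sub_le (k : ℕ) (t : ℝ) (f : L2Space d) :
    sobolevENorm k (freePropagator t f - f) ≤ ENNReal.ofReal |t| * sobolevENorm (k + 2) f := by
  rw [sobolevENorm_eq, sobolevENorm_eq, fourier_sub_L2, ENNReal.ofReal]
  refine eLpNorm_le_nnreal_smul_eLpNorm_of_ae_le_mul ?_ 2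
  filter_upwards [Lp.coeFn_sub (𝓕 (freePropagator t f) : L2Space d) (𝓕 f),
    fourier_freePropagator_ae t f] with x h1 h2
  rw [← NNReal.coe_le_coe, h1, Pi.sub_apply, h2]
  simp only [coe_nnnorm, norm_mul, NNReal.coe_mul, Complex.norm_real, Real.norm_eq_abs,
    abs_of_pos (sobolevWeight_pos _ x), Real.coe_toNNReal _ (abs_nonneg t)]
  rw [sobolevWeight_add_two, ← sub_one_mul, norm_mul]
  have h3 := norm_chirp_sub_one_le t x
  have h4 := sobolevWeight_nonneg k x
  calc _ ≤ sobolevWeight k x * ((|t| * (2 * Real.pi * ‖x‖) ^ 2) * ‖(𝓕 f : L2Space d) x‖) := by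
          gcongr
    _ ≤ sobolevWeight k x * ((|t| * (1 + (2 * Real.pi * ‖x‖) ^ 2)) * ‖(𝓕 f : L2Space d) x‖) := by
      gcongr; linarith
    _ = _ := by ring

end FreePropagator

/-! ### Position, momentum and the free propagator on Schwartz functions -/

section Schwartz

open LineDeriv

variable {d : ℕ}

theorem hasTemperateGrowth_exp_I_mul :
    (fun r : ℝ => Complex.exp (Complex.I * (r : ℂ))).HasTemperateGrowth := by
  have hder : ∀ n : ℕ, iteratedDeriv n (fun r : ℝ => Complex.exp (Complex.I * (r : ℂ))) =
      fun r : ℝ => Complex.I ^ n * Complex.exp (Complex.I * (r : ℂ)) := by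
    intro n
    induction n with
    | zero => simp
    | succ n ih =>
      rw [iteratedDeriv_succ, ih]
      funext r
      have h : HasDerivAt (fun r : ℝ => Complex.I ^ n * Complex.exp (Complex.I * (r : ℂ)))
          (Complex.I ^ n * (Complex.exp (Complex.I * (r : ℂ)) * (Complex.I * 1))) r :=
        (((Complex.ofRealCLM.hasDerivAt (x := r)).const_mul Complex.I).cexp).const_mul _
      rw [h.deriv]; ring
  refine ⟨(contDiff_const.mul Complex.ofRealCLM.contDiff).cexp, fun n => ⟨0, 1, fun x => ?_⟩⟩
  rw [norm_iteratedFDeriv_eq_norm_iteratedDeriv, hder, norm_mul, mul_comm Complex.I,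
    Complex.norm_exp_ofReal_mul_I]
  simp

theorem hasTemperateGrowth_chirp (t : ℝ) : (chirp (d := d) t).HasTemperateGrowth := by
  have h1 : (fun ξ : Rd d => (-t * (2 * Real.pi) ^ 2) * ‖ξ‖ ^ 2).HasTemperateGrowth :=
    (Function.HasTemperateGrowth.const _).mul (Function.hasTemperateGrowth_norm_sq (Rd d))
  have h2 := hasTemperateGrowth_exp_I_mul.comp h1
  have h3 : chirp (d := d) t = (fun r : ℝ => Complex.exp (Complex.I * (r : ℂ))) ∘
      fun ξ : Rd d => (-t * (2 * Real.pi) ^ 2) * ‖ξ‖ ^ 2 := by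
    funext ξ
    simp only [chirp, Function.comp_apply, mul_pow]
    congr 3; ring
  rw [h3]; exact h2

theorem fourierInv_fourierS (f : 𝓢(Rd d, ℂ)) : 𝓕⁻ (𝓕 f : 𝓢(Rd d, ℂ)) = f :=
  FourierTransform.fourierInv_fourier_eq f

/-- The free propagator on Schwartz functions; see `toLp_freeS` for the agreement with
`freePropagator`. -/
noncomputable def freeS (t : ℝ) : 𝓢(Rd d, ℂ) →ₗ[ℂ] 𝓢(Rd d, ℂ) where
  toFun f := 𝓕⁻ (SchwartzMap.smulLeftCLM ℂ (chirp t) (𝓕 f))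
  map_add' f g := by simp [FourierTransform.fourier_add, FourierTransform.fourierInv_add]
  map_smul' c f := by simp [FourierTransform.fourier_smul, FourierTransform.fourierInv_smul]

theorem freeS_apply (t : ℝ) (f : 𝓢(Rd d, ℂ)) :
    freeS t f = 𝓕⁻ (SchwartzMap.smulLeftCLM ℂ (chirp t) (𝓕 f)) := rfl

theorem fourier_freeS (t : ℝ) (f : 𝓢(Rd d, ℂ)) :
    𝓕 (freeS t f) = SchwartzMap.smulLeftCLM ℂ (chirp t) (𝓕 f) :=
  FourierTransform.fourier_fourierInv_eq _

theorem toLp_freeS (t : ℝ) (f : 𝓢(Rd d, ℂ)) :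
    (freeS t f).toLp 2 volume = freePropagator t (f.toLp 2 volume) := by
  refine ext_fourier ?_
  rw [SchwartzMap.toLp_fourier_eq, fourier_freeS]
  filter_upwards [fourier_freePropagator_ae t (f.toLp 2 volume),
    SchwartzMap.coeFn_toLp (SchwartzMap.smulLeftCLM ℂ (chirp t) (𝓕 f)) 2 volume,
    SchwartzMap.coeFn_toLp (𝓕 f) 2 volume] with x h1 h2 h3
  rw [h1, h2, SchwartzMap.smulLeftCLM_apply_apply (hasTemperateGrowth_chirp t),
    SchwartzMap.toLp_fourier_eq, h3, smul_eq_mul]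

/-- The `i`-th coordinate as a complex function. -/
noncomputable def coordC (i : Fin d) (x : Rd d) : ℂ := ((x i : ℝ) : ℂ)

theorem hasTemperateGrowth_coordC (i : Fin d) : (coordC i).HasTemperateGrowth :=
  (Complex.ofRealCLM.comp (EuclideanSpace.proj (𝕜 := ℝ) i)).hasTemperateGrowth

/-- The position operator: multiplication by `x_i`. -/
noncomputable def posS (i : Fin d) : 𝓢(Rd d, ℂ) →ₗ[ℂ] 𝓢(Rd d, ℂ) :=
  (SchwartzMap.smulLeftCLM ℂ (coordC i)).toLinearMap

@[simp]
theorem posS_apply (i : Fin d) (f : 𝓢(Rd d, ℂ)) (x : Rd d) : posS i f x = (x i : ℂ) * f x :=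
  SchwartzMap.smulLeftCLM_apply_apply (hasTemperateGrowth_coordC i) f x

theorem posS_pow_apply (i : Fin d) (n : ℕ) (f : 𝓢(Rd d, ℂ)) (x : Rd d) :
    (posS i ^ n) f x = (x i : ℂ) ^ n * f x := by
  induction n with
  | zero => simp
  | succ n ih => rw [pow_succ', Module.End.mul_apply, posS_apply, ih]; ring

/-- The momentum operator: the Fourier multiplier with symbol `ξ_j`. -/
noncomputable def momS (j : Fin d) : 𝓢(Rd d, ℂ) →ₗ[ℂ] 𝓢(Rd d, ℂ) where
  toFun f := 𝓕⁻ (posS j (𝓕 f))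
  map_add' f g := by simp [FourierTransform.fourier_add, FourierTransform.fourierInv_add]
  map_smul' c f := by simp [FourierTransform.fourier_smul, FourierTransform.fourierInv_smul]

theorem fourier_momS (j : Fin d) (f : 𝓢(Rd d, ℂ)) : 𝓕 (momS j f) = posS j (𝓕 f) :=
  FourierTransform.fourier_fourierInv_eq _

theorem fourier_momS_pow (j : Fin d) (n : ℕ) (f : 𝓢(Rd d, ℂ)) :
    𝓕 ((momS j ^ n) f) = (posS j ^ n) (𝓕 f) := by
  induction n with
  | zero => simp
  | succ n ih => rw [pow_succ', pow_succ', Module.End.mul_apply, fourier_momS, ih]; rfl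

/-- The unit vector in direction `i`. -/
noncomputable def unitVec (i : Fin d) : Rd d := EuclideanSpace.single i 1

theorem smulLeftCLM_inner_unitVec (i : Fin d) (f : 𝓢(Rd d, ℂ)) :
    SchwartzMap.smulLeftCLM ℂ (fun x : Rd d => inner ℝ x (unitVec i)) f = posS i f := by
  ext x
  rw [SchwartzMap.smulLeftCLM_apply_apply (by fun_prop), posS_apply]
  simp [unitVec, EuclideanSpace.inner_single_right]

theorem momS_eq (j : Fin d) (f : 𝓢(Rd d, ℂ)) :
    momS j f = (2 * Real.pi * Complex.I)⁻¹ • ∂_{unitVec j} f := by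
  have h : 𝓕 (∂_{unitVec j} f) = (2 * Real.pi * Complex.I) • posS j (𝓕 f) := by
    rw [SchwartzMap.fourier_lineDerivOp_eq, smulLeftCLM_inner_unitVec]
  have h2 : 𝓕 (momS j f) = 𝓕 ((2 * Real.pi * Complex.I)⁻¹ • ∂_{unitVec j} f) := by
    rw [fourier_momS, FourierTransform.fourier_smul, h, inv_smul_smul₀]
    simp [Real.pi_ne_zero]
  rw [← fourierInv_fourierS (momS j f), h2, fourierInv_fourierS]

theorem posS_fourierInv (i : Fin d) (G : 𝓢(Rd d, ℂ)) :
    posS i (𝓕⁻ G) = 𝓕⁻ (-(2 * Real.pi * Complex.I)⁻¹ • ∂_{unitVec i} G) := by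
  rw [FourierTransform.fourierInv_smul, SchwartzMap.fourierInv_lineDerivOp_eq,
    smulLeftCLM_inner_unitVec, smul_smul, neg_mul_neg, inv_mul_cancel₀, one_smul]
  simp [Real.pi_ne_zero]

/-- The canonical commutation relations: the commutator of position and momentum is a scalar. -/
theorem posS_momS_comm (i j : Fin d) (f : 𝓢(Rd d, ℂ)) :
    posS i (momS j f) - momS j (posS i f) =
      (-(2 * Real.pi * Complex.I)⁻¹ * (if i = j then 1 else 0)) • f := by
  rw [momS_eq, momS_eq]
  ext x
  have h1 : (∂_{unitVec j} (posS i f)) x =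
      (x i : ℂ) * (∂_{unitVec j} f) x + (if i = j then 1 else 0) * f x := by
    rw [SchwartzMap.lineDerivOp_apply_eq_fderiv, SchwartzMap.lineDerivOp_apply_eq_fderiv]
    have h2 : HasFDerivAt (coordC i) (Complex.ofRealCLM.comp (EuclideanSpace.proj (𝕜 := ℝ) i)) x :=
      (Complex.ofRealCLM.comp (EuclideanSpace.proj (𝕜 := ℝ) i)).hasFDerivAt
    have h3 := h2.mul (f.hasFDerivAt x)
    have h4 : (posS i f : Rd d → ℂ) = coordC i * f := by
      funext y; simp [coordC]
    rw [h4, h3.fderiv]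
    simp [coordC, unitVec]
    split_ifs <;> simp
  simp only [sub_apply, smul_apply, posS_apply, smul_eq_mul, h1]
  ring

/-- The inclusion of Schwartz functions into `L²`. -/
noncomputable def toL2 (d : ℕ) : 𝓢(Rd d, ℂ) →ₗ[ℂ] L2Space d :=
  (SchwartzMap.toLpCLM ℂ ℂ 2 volume).toLinearMap

theorem toL2_apply (f : 𝓢(Rd d, ℂ)) : toL2 d f = f.toLp 2 volume := rfl

theorem norm_toL2_fourier (f : 𝓢(Rd d, ℂ)) : ‖toL2 d (𝓕 f)‖ = ‖toL2 d f‖ :=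
  SchwartzMap.norm_fourier_toL2_eq f

theorem norm_toL2_freeS (t : ℝ) (f : 𝓢(Rd d, ℂ)) : ‖toL2 d (freeS t f)‖ = ‖toL2 d f‖ := by
  rw [toL2_apply, toLp_freeS, norm_freePropagator]; rfl

theorem inner_posS (i : Fin d) (f g : 𝓢(Rd d, ℂ)) :
    inner ℂ (toL2 d (posS i f)) (toL2 d g) = inner ℂ (toL2 d f) (toL2 d (posS i g)) := by
  simp only [toL2_apply, SchwartzMap.inner_toL2_toL2_eq]
  refine integral_congr_ae (ae_of_all _ fun x => ?_)
  simp only [posS_apply, RCLike.inner_apply, map_mul, Complex.conj_ofReal]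
  ring

theorem inner_toL2_fourier (f g : 𝓢(Rd d, ℂ)) :
    inner ℂ (toL2 d (𝓕 f)) (toL2 d (𝓕 g)) = inner ℂ (toL2 d f) (toL2 d g) :=
  SchwartzMap.inner_fourier_toL2_eq f g

theorem inner_momS (j : Fin d) (f g : 𝓢(Rd d, ℂ)) :
    inner ℂ (toL2 d (momS j f)) (toL2 d g) = inner ℂ (toL2 d f) (toL2 d (momS j g)) := by
  rw [← inner_toL2_fourier, fourier_momS, inner_posS, ← fourier_momS, inner_toL2_fourier]

/-- Conjugating the position operator with the free propagator adds `4πt` times the momentum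
operator. -/
theorem posS_freeS (i : Fin d) (t : ℝ) (f : 𝓢(Rd d, ℂ)) :
    posS i (freeS t f) = freeS t ((posS i + ((4 * Real.pi * t : ℝ) : ℂ) • momS i) f) := by
  have hF : 𝓕 (posS i f) = -(2 * Real.pi * Complex.I)⁻¹ • ∂_{unitVec i} (𝓕 f) := by
    conv_lhs => rw [← fourierInv_fourierS f, posS_fourierInv]
    exact FourierTransform.fourier_fourierInv_eq _
  rw [freeS_apply, freeS_apply, posS_fourierInv]
  congr 1
  rw [LinearMap.add_apply, LinearMap.smul_apply, FourierTransform.fourier_add,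
    FourierTransform.fourier_smul, fourier_momS, hF]
  ext ξ
  have h1 : (∂_{unitVec i} (SchwartzMap.smulLeftCLM ℂ (chirp t) (𝓕 f))) ξ =
      chirp t ξ * (∂_{unitVec i} (𝓕 f)) ξ -
        Complex.I * (t * (2 * Real.pi) ^ 2 * (2 * ξ i)) * chirp t ξ * (𝓕 f) ξ := by
    rw [SchwartzMap.lineDerivOp_apply_eq_fderiv, SchwartzMap.lineDerivOp_apply_eq_fderiv]
    have h2 : HasFDerivAt (fun ξ : Rd d => ‖ξ‖ ^ 2) (2 • innerSL ℝ ξ) ξ :=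
      (hasStrictFDerivAt_norm_sq ξ).hasFDerivAt
    have h3 : HasFDerivAt (fun ξ : Rd d => (((-t * (2 * Real.pi) ^ 2) * ‖ξ‖ ^ 2 : ℝ) : ℂ)) _ ξ :=
      Complex.ofRealCLM.hasFDerivAt.comp ξ (h2.const_mul (-t * (2 * Real.pi) ^ 2))
    have h4 := (h3.const_mul Complex.I).cexp
    have h5 : (fun ξ : Rd d => Complex.exp (Complex.I *
        (((-t * (2 * Real.pi) ^ 2) * ‖ξ‖ ^ 2 : ℝ) : ℂ))) = chirp t := by
      funext ξ
      simp only [chirp, mul_pow]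
      congr 3; ring
    rw [h5] at h4
    have h6 := h4.mul ((𝓕 f : 𝓢(Rd d, ℂ)).hasFDerivAt ξ)
    have h7 : (SchwartzMap.smulLeftCLM ℂ (chirp t) (𝓕 f) : Rd d → ℂ) =
        chirp t * ((𝓕 f : 𝓢(Rd d, ℂ)) : Rd d → ℂ) := by
      funext y
      rw [SchwartzMap.smulLeftCLM_apply_apply (hasTemperateGrowth_chirp t)]; rfl
    have h8 : Complex.exp (Complex.I *
        (((-t * (2 * Real.pi) ^ 2) * ‖ξ‖ ^ 2 : ℝ) : ℂ)) = chirp t ξ := congrFun h5 ξ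
    rw [h7, h6.fderiv, h8]
    simp [unitVec, EuclideanSpace.inner_single_right]
    ring
  rw [smul_apply, h1, SchwartzMap.smulLeftCLM_apply_apply (hasTemperateGrowth_chirp t),
    add_apply, smul_apply, smul_apply, posS_apply]
  simp only [smul_eq_mul]
  have hI : (2 * Real.pi * Complex.I)⁻¹ * Complex.I * (t * (2 * Real.pi) ^ 2 * 2) =
      4 * Real.pi * t := by
    have : (Real.pi : ℂ) ≠ 0 := by exact_mod_cast Real.pi_ne_zero
    field_simp [Complex.I_ne_zero]
    ring
  push_cast
  linear_combination (chirp t ξ * (ξ i : ℂ) * (𝓕 f) ξ) * hI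

theorem posS_pow_freeS (i : Fin d) (t : ℝ) (n : ℕ) (f : 𝓢(Rd d, ℂ)) :
    (posS i ^ n) (freeS t f) =
      freeS t (((posS i + ((4 * Real.pi * t : ℝ) : ℂ) • momS i) ^ n) f) := by
  induction n generalizing f with
  | zero => simp
  | succ n ih => rw [pow_succ, Module.End.mul_apply, posS_freeS, ih, pow_succ, Module.End.mul_apply]

end Schwartz

/-! ### Weighted estimates for the free propagator on Schwartz functions -/

section SchwartzEstimates

variable {d : ℕ}

theorem enorm_toL2 (f : 𝓢(Rd d, ℂ)) : ‖toL2 d f‖ₑ = eLpNorm f 2 volume := by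
  rw [toL2_apply, Lp.enorm_def]
  exact eLpNorm_congr_ae (SchwartzMap.coeFn_toLp _ _ _)

theorem sobolevENorm_schwartz_lt_top (k : ℕ) (f : 𝓢(Rd d, ℂ)) :
    sobolevENorm k (f.toLp 2 volume) < ∞ := by
  rw [sobolevENorm_toLp, wENorm]
  have h := (SchwartzMap.smulLeftCLM ℂ (fun ξ : Rd d =>
    (((1 + (2 * Real.pi * ‖ξ‖) ^ 2) ^ ((k : ℝ) / 2) : ℝ) : ℂ)) (𝓕 f)).eLpNorm_lt_top 2 volume
  refine lt_of_le_of_lt (le_of_eq (eLpNorm_congr_ae (ae_of_all _ fun ξ => ?_))) h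
  rw [SchwartzMap.smulLeftCLM_apply_apply (hasTemperateGrowth_sobolev_rpow _)]
  rfl

theorem weight_schwartz_lt_top (k : ℕ) (f : 𝓢(Rd d, ℂ)) : wENorm (fun x => ‖x‖ ^ k) f < ∞ := by
  have h := (SchwartzMap.smulLeftCLM ℂ (fun ξ : Rd d =>
    (((1 + (2 * Real.pi * ‖ξ‖) ^ 2) ^ ((k : ℝ) / 2) : ℝ) : ℂ)) f).eLpNorm_lt_top 2 volume
  refine lt_of_le_of_lt (eLpNorm_mono fun ξ => ?_) h
  rw [SchwartzMap.smulLeftCLM_apply_apply (hasTemperateGrowth_sobolev_rpow _), norm_mul, norm_smul,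
    Complex.norm_real, Complex.norm_real, Real.norm_of_nonneg (by positivity),
    Real.norm_of_nonneg (by positivity)]
  gcongr
  exact norm_pow_le_sobolevWeight le_rfl ξ

theorem sigmaENorm_schwartz_lt_top (k : ℕ) (f : 𝓢(Rd d, ℂ)) :
    sigmaENorm k (f.toLp 2 volume) < ∞ := by
  rw [sigmaENorm_eq, wENorm_toLp]
  exact ENNReal.add_lt_top.2 ⟨sobolevENorm_schwartz_lt_top k f, weight_schwartz_lt_top k f⟩

theorem enorm_posS_pow_le {j k : ℕ} (h : j ≤ k) (i : Fin d) (f : 𝓢(Rd d, ℂ)) :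
    ‖toL2 d ((posS i ^ j) f)‖ₑ ≤ 2 * sigmaENorm k (f.toLp 2 volume) := by
  have h1 : ‖toL2 d ((posS i ^ j) f)‖ₑ ≤ wENorm (fun x => ‖x‖ ^ j) (f.toLp 2 volume) := by
    rw [enorm_toL2, wENorm_toLp]
    refine eLpNorm_mono fun x => ?_
    rw [posS_pow_apply, norm_mul, norm_mul, norm_pow, Complex.norm_real, Complex.norm_real,
      Real.norm_of_nonneg (r := ‖x‖ ^ j) (by positivity)]
    gcongr
    exact PiLp.norm_apply_le x i
  refine h1.trans ((weight_le_enorm_add h _).trans ?_)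
  rw [two_mul]
  exact add_le_add (enorm_le_sigmaENorm _ _) (weight_le_sigmaENorm _ _)

theorem enorm_momS_pow_le {j k : ℕ} (h : j ≤ k) (i : Fin d) (f : 𝓢(Rd d, ℂ)) :
    ‖toL2 d ((momS i ^ j) f)‖ₑ ≤ sigmaENorm k (f.toLp 2 volume) := by
  refine le_trans ?_ (sobolevENorm_le_sigmaENorm _ _)
  have : ‖toL2 d ((momS i ^ j) f)‖ₑ = ‖toL2 d ((posS i ^ j) (𝓕 f))‖ₑ := by
    rw [← fourier_momS_pow, ← ofReal_norm, ← ofReal_norm, norm_toL2_fourier]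
  rw [this, enorm_toL2, sobolevENorm_toLp]
  refine eLpNorm_mono fun x => ?_
  rw [posS_pow_apply, norm_mul, norm_mul, norm_pow, Complex.norm_real, Complex.norm_real,
    Real.norm_of_nonneg (sobolevWeight_nonneg k x)]
  gcongr
  exact (pow_le_pow_left₀ (norm_nonneg _) (PiLp.norm_apply_le x i) j).trans
    (norm_pow_le_sobolevWeight h x)

theorem norm_pow_le_sum (k : ℕ) (x : Rd d) : ‖x‖ ^ (k + 1) ≤ d ^ k * ∑ i, |x i| ^ (k + 1) := by
  have h1 : ‖x‖ ≤ ∑ i, |x i| := by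
    rw [EuclideanSpace.norm_eq]
    refine Real.sqrt_le_iff.2 ⟨Finset.sum_nonneg fun _ _ => abs_nonneg _, ?_⟩
    exact Finset.sum_sq_le_sq_sum_of_nonneg fun i _ => norm_nonneg (x i)
  refine (pow_le_pow_left₀ (norm_nonneg x) h1 _).trans ?_
  simpa using pow_sum_le_card_mul_sum_pow (s := Finset.univ) (f := fun i => |x i|)
    (fun i _ => abs_nonneg _) k

theorem weight_le_sum_posS (k : ℕ) (g : 𝓢(Rd d, ℂ)) :
    wENorm (fun x => ‖x‖ ^ (k + 1)) g ≤
      (d : ℝ≥0∞) ^ k * ∑ i, ‖toL2 d ((posS i ^ (k + 1)) g)‖ₑ := by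
  have h : wENorm (fun x => ‖x‖ ^ (k + 1)) g ≤ (((d : ℝ≥0) ^ k : ℝ≥0) : ℝ≥0∞) *
      eLpNorm (∑ i, fun x => |x i| ^ (k + 1) * ‖g x‖) 2 volume := by
    refine eLpNorm_le_nnreal_smul_eLpNorm_of_ae_le_mul (ae_of_all _ fun x => ?_) 2
    rw [← NNReal.coe_le_coe]
    simp only [coe_nnnorm, norm_mul, NNReal.coe_mul, Complex.norm_real, Real.norm_eq_abs,
      Finset.sum_apply]
    rw [abs_of_nonneg (by positivity), abs_of_nonneg (Finset.sum_nonneg fun _ _ => by positivity),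
      ← Finset.sum_mul, ← mul_assoc]
    gcongr
    simpa using norm_pow_le_sum k x
  refine h.trans ?_
  push_cast
  gcongr
  refine (eLpNorm_sum_le (fun i _ => (Continuous.aestronglyMeasurable (by fun_prop)))
    (by norm_num)).trans (Finset.sum_le_sum fun i _ => le_of_eq ?_)
  rw [enorm_toL2]
  refine eLpNorm_congr_norm_ae (ae_of_all _ fun x => ?_)
  rw [posS_pow_apply]
  simp

/-- Words in position and momentum operators are bounded by the `Σ^k` norm. -/
theorem exists_wordNorm_le_sigma (d k : ℕ) :
    ∃ C : ℝ, 0 ≤ C ∧ ∀ (i j : Fin d) (f : 𝓢(Rd d, ℂ)),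
      wordNorm (toL2 d) (posS i) (momS j) k f ≤ C * (sigmaENorm k (f.toLp 2 volume)).toReal := by
  have h := fun i j : Fin d => exists_wordNorm_le (ι := toL2 d) (inner_posS i) (inner_momS j)
    (posS_momS_comm i j) k
  choose C hC0 hC using h
  refine ⟨∑ i, ∑ j, C i j * 2, Finset.sum_nonneg fun i _ => Finset.sum_nonneg fun j _ => by
    have := hC0 i j; positivity, fun i j f => ?_⟩
  set S := (sigmaENorm k (f.toLp 2 volume)).toReal with hS
  have hS0 : 0 ≤ S := ENNReal.toReal_nonneg
  have hfin := (sigmaENorm_schwartz_lt_top k f).ne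
  have hconv : ∀ g : 𝓢(Rd d, ℂ), ‖toL2 d g‖ₑ ≤ 2 * sigmaENorm k (f.toLp 2 volume) →
      ‖toL2 d g‖ ≤ 2 * S := fun g hg => by
    rw [← toReal_enorm, hS]
    have := ENNReal.toReal_mono (by finiteness) hg
    simpa using this
  refine (hC i j f (2 * S) (fun n hn => hconv _ (enorm_posS_pow_le hn i f)) fun n hn =>
    hconv _ ((enorm_momS_pow_le hn j f).trans ?_)).trans ?_
  · rw [two_mul]; exact le_self_add
  · rw [← mul_assoc]
    refine mul_le_mul_of_nonneg_right ?_ hS0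
    have h1 : C i j * 2 ≤ ∑ j, C i j * 2 :=
      Finset.single_le_sum (f := fun j => C i j * 2)
        (fun j _ => mul_nonneg (hC0 i j) (by norm_num)) (Finset.mem_univ j)
    exact h1.trans (Finset.single_le_sum (f := fun i => ∑ j, C i j * 2)
      (fun i _ => Finset.sum_nonneg fun j _ => mul_nonneg (hC0 i j) (by norm_num))
      (Finset.mem_univ i))

theorem sum_enorm_le {a : Fin d → 𝓢(Rd d, ℂ)} {B : ℝ} (h : ∀ i, ‖toL2 d (a i)‖ ≤ B) :
    ∑ i, ‖toL2 d (a i)‖ₑ ≤ d * ENNReal.ofReal B := by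
  refine (Finset.sum_le_card_nsmul _ _ (ENNReal.ofReal B) fun i _ => ?_).trans (by simp)
  rw [← ofReal_norm]
  exact ENNReal.ofReal_le_ofReal (h i)

theorem norm_four_pi_mul (t : ℝ) : ‖((4 * Real.pi * t : ℝ) : ℂ)‖ = 4 * Real.pi * |t| := by
  rw [Complex.norm_real, norm_mul, Real.norm_of_nonneg (by positivity), Real.norm_eq_abs]

/-- The weighted part of the boundedness of the free propagator on `Σ^{k+1}`: by `posS_pow_freeS`
the moments of `e^{itΔ} f` are those of `(x_i + 4πt D_i)^{k+1} f`. -/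
theorem exists_weight_freeS_le (d k : ℕ) (T : ℝ) :
    ∃ C : ℝ≥0, ∀ (f : 𝓢(Rd d, ℂ)) (t : ℝ), |t| ≤ T →
      wENorm (fun x => ‖x‖ ^ (k + 1)) (freePropagator t (f.toLp 2 volume)) ≤
        C * sigmaENorm (k + 1) (f.toLp 2 volume) := by
  obtain ⟨C, hC0, hC⟩ := exists_wordNorm_le_sigma d (k + 1)
  refine ⟨(d : ℝ≥0) ^ k * (d * ((1 + 4 * Real.pi * T) ^ (k + 1) * C).toNNReal), fun f t ht => ?_⟩
  have hT : 0 ≤ T := (abs_nonneg t).trans ht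
  have h1 : ∀ i, ‖toL2 d ((posS i ^ (k + 1)) (freeS t f))‖ ≤
      (1 + 4 * Real.pi * T) ^ (k + 1) * C * (sigmaENorm (k + 1) (f.toLp 2 volume)).toReal := by
    intro i
    rw [posS_pow_freeS, norm_toL2_freeS]
    refine (norm_add_smul_pow_le _ _ _ _ _ _).trans ?_
    have hw0 := wordNorm_nonneg (toL2 d) (posS i) (momS i) (k + 1) f
    rw [norm_four_pi_mul, mul_assoc _ C]
    calc _ ≤ (1 + 4 * Real.pi * T) ^ (k + 1) * wordNorm (toL2 d) (posS i) (momS i) (k + 1) f := by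
          gcongr
      _ ≤ _ := by gcongr; exact hC i i f
  rw [← toLp_freeS, wENorm_toLp]
  refine (weight_le_sum_posS k _).trans ((mul_le_mul_right (sum_enorm_le h1) _).trans
    (le_of_eq ?_))
  rw [ENNReal.ofReal_mul (by positivity), ENNReal.ofReal_toReal (sigmaENorm_schwartz_lt_top _ f).ne]
  push_cast
  simp only [ENNReal.ofReal]
  ring

theorem norm_toL2_freeS_sub_le (t : ℝ) (f : 𝓢(Rd d, ℂ)) :
    ‖toL2 d (freeS t f - f)‖ ≤ |t| * ((2 * Real.pi) ^ 2 * ∑ j, ‖toL2 d (momS j (momS j f))‖) := by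
  have hF : ∀ j, 𝓕 (momS j (momS j f)) = (posS j ^ 2) (𝓕 f) := fun j => by
    rw [← fourier_momS_pow, sq]; rfl
  rw [← norm_toL2_fourier, show 𝓕 (freeS t f - f) = 𝓕 (freeS t f) - 𝓕 f from
    (fourierCLM ℂ 𝓢(Rd d, ℂ)).map_sub _ _, fourier_freeS]
  have h2 : ‖toL2 d (SchwartzMap.smulLeftCLM ℂ (chirp t) (𝓕 f) - 𝓕 f)‖ ≤
      ‖((|t| * (2 * Real.pi) ^ 2 : ℝ) : ℂ) • toL2 d (∑ j, (posS j ^ 2) (𝓕 f))‖ := by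
    rw [← map_smul, toL2_apply, toL2_apply]
    refine Lp.norm_le_norm_of_ae_le ?_
    filter_upwards [SchwartzMap.coeFn_toLp
        (SchwartzMap.smulLeftCLM ℂ (chirp t) (𝓕 f) - 𝓕 f) 2 volume,
      SchwartzMap.coeFn_toLp
        (((|t| * (2 * Real.pi) ^ 2 : ℝ) : ℂ) • ∑ j, (posS j ^ 2) (𝓕 f)) 2 volume]
      with x h1 h2
    rw [h1, h2, sub_apply, SchwartzMap.smulLeftCLM_apply_apply (hasTemperateGrowth_chirp t),
      smul_eq_mul, ← sub_one_mul, norm_mul, smul_apply, sum_apply]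
    simp only [posS_pow_apply, ← Finset.sum_mul]
    have h3 : (∑ i, (x i : ℂ) ^ 2) = ((‖x‖ ^ 2 : ℝ) : ℂ) := by
      rw [EuclideanSpace.real_norm_sq_eq]; push_cast; rfl
    rw [h3, norm_smul, norm_mul, Complex.norm_real, Complex.norm_real,
      Real.norm_of_nonneg (by positivity), Real.norm_of_nonneg (by positivity), ← mul_assoc]
    gcongr
    refine (norm_chirp_sub_one_le t x).trans (le_of_eq (by ring))
  refine h2.trans ?_
  rw [norm_smul, Complex.norm_real, Real.norm_of_nonneg (by positivity), mul_assoc, map_sum]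
  gcongr
  refine (norm_sum_le _ _).trans (le_of_eq (Finset.sum_congr rfl fun j _ => ?_))
  rw [← hF, norm_toL2_fourier]

/-- The weighted part of the Lipschitz continuity in time of the free propagator from `Σ^{k+3}` to
`Σ^{k+1}`. -/
theorem exists_weight_freeS_sub_le (d k : ℕ) (T : ℝ) :
    ∃ C : ℝ≥0, ∀ (f : 𝓢(Rd d, ℂ)) (t : ℝ), |t| ≤ T →
      wENorm (fun x => ‖x‖ ^ (k + 1))
        (freePropagator t (f.toLp 2 volume) - f.toLp 2 volume : L2Space d) ≤
        ENNReal.ofReal |t| * (C * sigmaENorm (k + 3) (f.toLp 2 volume)) := by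
  obtain ⟨C, hC0, hC⟩ := exists_wordNorm_le_sigma d (k + 1)
  obtain ⟨C', hC0', hC'⟩ := exists_wordNorm_le_sigma d (k + 3)
  set A : ℝ := 4 * Real.pi * (((k + 1 : ℕ) : ℝ) * (1 + 4 * Real.pi * T) ^ (k + 1)) * (C * 2) +
    (2 * Real.pi) ^ 2 * (d * C') with hA
  refine ⟨(d : ℝ≥0) ^ k * (d * A.toNNReal), fun f t ht => ?_⟩
  have hT : 0 ≤ T := (abs_nonneg t).trans ht
  have hA0 : 0 ≤ A := by positivity
  set S := (sigmaENorm (k + 3) (f.toLp 2 volume)).toReal with hS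
  have hS0 : 0 ≤ S := ENNReal.toReal_nonneg
  have hfin := (sigmaENorm_schwartz_lt_top (k + 3) f).ne
  have hS1 : (sigmaENorm (k + 1) (f.toLp 2 volume)).toReal ≤ 2 * S := by
    have := ENNReal.toReal_mono (by finiteness)
      (sigmaENorm_le_two_mul (by omega : k + 1 ≤ k + 3) (f.toLp 2 volume))
    simpa [hS] using this
  have h1 : ∀ i, ‖toL2 d ((posS i ^ (k + 1)) (freeS t f - f))‖ ≤ |t| * (A * S) := by
    intro i
    set s : ℂ := ((4 * Real.pi * t : ℝ) : ℂ) with hs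
    -- The first term is of order `t` since every word in the expansion of the difference contains
    -- the factor `s`; the second one since `e^{itΔ} - 1` costs two momentum operators.
    have e : (posS i ^ (k + 1)) (freeS t f - f) =
        freeS t (((posS i + s • momS i) ^ (k + 1)) f - (posS i ^ (k + 1)) f) +
          (freeS t ((posS i ^ (k + 1)) f) - (posS i ^ (k + 1)) f) := by
      rw [map_sub, posS_pow_freeS, map_sub]; abel
    rw [e, map_add]
    refine (norm_add_le _ _).trans ?_
    rw [norm_toL2_freeS]
    have h2 : ‖toL2 d (((posS i + s • momS i) ^ (k + 1)) f - (posS i ^ (k + 1)) f)‖ ≤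
        |t| * (4 * Real.pi * (((k + 1 : ℕ) : ℝ) * (1 + 4 * Real.pi * T) ^ (k + 1)) *
          (C * 2) * S) := by
      refine (norm_add_smul_pow_sub_le _ _ _ _ _ _).trans ?_
      have hw : wordNorm (toL2 d) (posS i) (momS i) (k + 1) f ≤ C * (2 * S) :=
        (hC i i f).trans (by gcongr)
      have hw0 := wordNorm_nonneg (toL2 d) (posS i) (momS i) (k + 1) f
      rw [hs, norm_four_pi_mul]
      calc _ ≤ 4 * Real.pi * |t| * (((k + 1 : ℕ) : ℝ) * (1 + 4 * Real.pi * T) ^ (k + 1)) *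
            (C * (2 * S)) := by gcongr
        _ = _ := by ring
    have h3 : ‖toL2 d (freeS t ((posS i ^ (k + 1)) f) - (posS i ^ (k + 1)) f)‖ ≤
        |t| * ((2 * Real.pi) ^ 2 * (d * C') * S) := by
      refine (norm_toL2_freeS_sub_le t _).trans ?_
      have : ∑ j, ‖toL2 d (momS j (momS j ((posS i ^ (k + 1)) f)))‖ ≤ d * (C' * S) := by
        refine (Finset.sum_le_card_nsmul _ _ (C' * S) fun j _ => ?_).trans (by simp)
        exact (norm_right_right_left_pow_le (toL2 d) (posS i) (momS j) (k + 1) f).trans (hC' i j f)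
      calc _ ≤ |t| * ((2 * Real.pi) ^ 2 * (d * (C' * S))) := by gcongr
        _ = _ := by ring
    refine (add_le_add h2 h3).trans (le_of_eq ?_)
    rw [hA]; ring
  have e : (freePropagator t (f.toLp 2 volume) - f.toLp 2 volume : L2Space d) =
      (freeS t f - f).toLp 2 volume := by
    rw [← toLp_freeS]
    exact ((toL2 d).map_sub _ _).symm
  rw [e, wENorm_toLp]
  refine (weight_le_sum_posS k _).trans ((mul_le_mul_right (sum_enorm_le h1) _).trans
    (le_of_eq ?_))
  rw [ENNReal.ofReal_mul (abs_nonneg t), ENNReal.ofReal_mul hA0, hS, ENNReal.ofReal_toReal hfin]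
  push_cast
  simp only [ENNReal.ofReal]
  ring

end SchwartzEstimates

/-! ### Schwartz approximation in `Σ^k` -/

section Approximation

variable {d : ℕ}

/-- Slowly varying cut-offs: inverse Fourier transforms of normalized bump functions of small
support. -/
theorem exists_cutoff (d k : ℕ) : ∃ A : ℝ≥0, ∀ r : ℝ, 0 < r → r ≤ 1 → ∃ χ : 𝓢(Rd d, ℂ),
    (∀ x, ‖χ x‖ ≤ 1) ∧ (∀ x, ‖χ x - 1‖ ≤ 2 * Real.pi * r * ‖x‖) ∧
    ∫⁻ ξ, ENNReal.ofReal (sobolevWeight k ξ) * ‖(𝓕 χ : 𝓢(Rd d, ℂ)) ξ‖ₑ ≤ A := by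
  refine ⟨((1 + (2 * Real.pi) ^ 2) ^ ((k : ℝ) / 2)).toNNReal, fun r hr hr1 => ?_⟩
  let b : ContDiffBump (0 : Rd d) := ⟨r / 2, r, by positivity, by linarith⟩
  set ρ : Rd d → ℝ := b.normed volume with hρ
  have hρ0 : ∀ x, 0 ≤ ρ x := fun x => b.nonneg_normed x
  have hρc : Continuous ρ := b.continuous_normed
  have hρi : Integrable ρ volume := b.integrable_normed
  have hρ1 : ∫ x, ρ x = 1 := b.integral_normed
  have hρs : ∀ x, r < ‖x‖ → ρ x = 0 := fun x hx => by
    by_contra h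
    have : x ∈ Function.support ρ := h
    rw [hρ, b.support_normed_eq, mem_ball_zero_iff] at this
    exact lt_asymm hx this
  have hcs : HasCompactSupport (fun x => (ρ x : ℂ)) :=
    b.hasCompactSupport_normed.comp_left (g := fun y : ℝ => (y : ℂ)) Complex.ofReal_zero
  have hsm : ContDiff ℝ (↑(⊤ : ℕ∞)) (fun x => (ρ x : ℂ)) :=
    Complex.ofRealCLM.contDiff.comp (b.contDiff_normed (μ := volume))
  let φ : 𝓢(Rd d, ℂ) := hcs.toSchwartzMap hsm
  have hφ : ∀ x, φ x = (ρ x : ℂ) := fun x => rfl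
  have hφn : ∀ x, ‖φ x‖ = ρ x := fun x => by rw [hφ, Complex.norm_real, Real.norm_of_nonneg (hρ0 x)]
  have hχ : ∀ x, (𝓕⁻ φ : 𝓢(Rd d, ℂ)) x =
      ∫ v, Complex.exp (↑(2 * Real.pi * inner ℝ v x) * Complex.I) • φ v := fun x => by
    rw [SchwartzMap.fourierInv_coe, Real.fourierInv_eq']
  refine ⟨𝓕⁻ φ, fun x => ?_, fun x => ?_, ?_⟩
  · rw [hχ]
    refine (norm_integral_le_integral_norm _).trans (le_of_eq ?_)
    rw [← hρ1]
    refine integral_congr_ae (ae_of_all _ fun v => ?_)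
    simp only [norm_smul, Complex.norm_exp_ofReal_mul_I, one_mul, hφn]
  · have hint : Integrable (fun v =>
        Complex.exp (↑(2 * Real.pi * inner ℝ v x) * Complex.I) • φ v) volume := by
      refine φ.integrable.bdd_mul (c := 1) (Continuous.aestronglyMeasurable (by fun_prop))
        (ae_of_all _ fun v => ?_)
      rw [Complex.norm_exp_ofReal_mul_I]
    have h1 : (1 : ℂ) = ∫ v, φ v := by
      have : ∫ v, φ v = ((∫ v, ρ v : ℝ) : ℂ) := integral_ofReal
      rw [this, hρ1, Complex.ofReal_one]
    rw [hχ, h1, ← integral_sub hint φ.integrable]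
    have h2 : ∫ v, 2 * Real.pi * r * ‖x‖ * ρ v = 2 * Real.pi * r * ‖x‖ := by
      rw [integral_const_mul, hρ1, mul_one]
    rw [← h2]
    refine norm_integral_le_of_norm_le (hρi.const_mul _) (ae_of_all _ fun v => ?_)
    rw [smul_eq_mul, ← sub_one_mul, norm_mul, hφn]
    rcases lt_or_ge r ‖v‖ with hv | hv
    · rw [hρs v hv]; simp
    · refine mul_le_mul_of_nonneg_right ?_ (hρ0 v)
      rw [mul_comm _ Complex.I]
      refine (Real.norm_exp_I_mul_ofReal_sub_one_le).trans ?_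
      rw [norm_mul, Real.norm_of_nonneg (by positivity), mul_assoc _ r]
      gcongr
      exact (norm_inner_le_norm v x).trans (by gcongr)
  · have e : 𝓕 (𝓕⁻ φ) = φ := FourierTransform.fourier_fourierInv_eq φ
    rw [e]
    have h3 : ∫⁻ ξ, ‖φ ξ‖ₑ = 1 := by
      have : ∀ ξ, ‖φ ξ‖ₑ = ENNReal.ofReal (ρ ξ) := fun ξ => by rw [← ofReal_norm, hφn]
      simp_rw [this]
      rw [← ofReal_integral_eq_lintegral_ofReal hρi (ae_of_all _ hρ0), hρ1, ENNReal.ofReal_one]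
    calc _ ≤ ∫⁻ ξ, ENNReal.ofReal ((1 + (2 * Real.pi) ^ 2) ^ ((k : ℝ) / 2)) * ‖φ ξ‖ₑ := by
          refine lintegral_mono fun ξ => ?_
          rcases lt_or_ge r ‖ξ‖ with hv | hv
          · simp [hφ, hρs ξ hv]
          · refine mul_le_mul_left (ENNReal.ofReal_le_ofReal ?_) _
            unfold sobolevWeight
            have : ‖ξ‖ ≤ 1 := hv.trans hr1
            have h4 : 2 * Real.pi * ‖ξ‖ ≤ 2 * Real.pi := mul_le_of_le_one_right (by positivity) this
            gcongr
      _ = _ := by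
          rw [lintegral_const_mul' _ _ ENNReal.ofReal_ne_top, h3, mul_one]; rfl

/-- Every element of `Σ^{k+1}` is the `L²` limit of Schwartz functions whose `Σ^{k+1}` norms are
asymptotically bounded by a multiple of its own. -/
theorem exists_schwartz_approx (d k : ℕ) : ∃ K : ℝ≥0, ∀ f : L2Space d, sigmaENorm (k + 1) f ≠ ∞ →
    ∃ (u : ℕ → 𝓢(Rd d, ℂ)) (r : ℕ → ℝ≥0∞),
      Tendsto (fun n => (u n).toLp 2 volume) atTop (𝓝 f) ∧
      Tendsto r atTop (𝓝 (K * sigmaENorm (k + 1) f)) ∧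
      ∀ n, sigmaENorm (k + 1) ((u n).toLp 2 volume) ≤ r n := by
  obtain ⟨A, hA⟩ := exists_cutoff d (k + 1)
  set K : ℝ≥0 := 2 ^ (k + 1 + 1) * A + 1 with hK
  refine ⟨K, fun f hf => ?_⟩
  have hε : ∀ n : ℕ, (0 : ℝ) < 1 / ((n : ℝ) + 1) := fun n => Nat.one_div_pos_of_nat
  have hε1 : ∀ n : ℕ, 1 / ((n : ℝ) + 1) ≤ 1 := fun n => by
    rw [div_le_one (by positivity)]; linarith [(Nat.cast_nonneg n : (0 : ℝ) ≤ n)]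
  set ε : ℕ → ℝ≥0∞ := fun n => ENNReal.ofReal (1 / ((n : ℝ) + 1)) with hεdef
  have hεt : Tendsto ε atTop (𝓝 0) := by
    have := ENNReal.tendsto_ofReal (tendsto_one_div_add_atTop_nhds_zero_nat (𝕜 := ℝ))
    rwa [ENNReal.ofReal_zero] at this
  choose χ hχ1 hχ2 hχ3 using fun n => hA _ (hε n) (hε1 n)
  have hsob : sobolevENorm (k + 1) f < ∞ :=
    (sobolevENorm_le_sigmaENorm _ _).trans_lt (lt_top_iff_ne_top.2 hf)
  obtain ⟨g, hg⟩ := exists_schwartz_tendsto_sobolev (k + 1) hsob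
  -- The cut-off `χ n` decays rapidly, so it absorbs the weight at the cost of a constant.
  choose c hc0 hc using fun n => (χ n).decay (k + 1) 0
  have hc' : ∀ n x, ‖x‖ ^ (k + 1) * ‖χ n x‖ ≤ c n := fun n x => by
    simpa using hc n x
  have hj : ∀ n, ∃ j, (ENNReal.ofReal (c n) + 1) *
      sobolevENorm (k + 1) ((g j).toLp 2 volume - f) ≤ ε n := fun n => by
    have h1 : Tendsto (fun j => (ENNReal.ofReal (c n) + 1) *
        sobolevENorm (k + 1) ((g j).toLp 2 volume - f)) atTop (𝓝 0) := by
      simpa using ENNReal.Tendsto.const_mul hg (Or.inr (by finiteness))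
    exact (h1.eventually (ge_mem_nhds (ENNReal.ofReal_pos.2 (hε n)))).exists
  choose j hj using hj
  have hj1 : ∀ n, sobolevENorm (k + 1) ((g (j n)).toLp 2 volume - f) ≤ ε n := fun n =>
    (le_mul_of_one_le_left zero_le le_add_self).trans (hj n)
  set G : ℕ → L2Space d := fun n => (g (j n)).toLp 2 volume with hG
  set u : ℕ → 𝓢(Rd d, ℂ) := fun n => mulS (χ n) (g (j n)) with hu
  have hχe : ∀ n x, ‖χ n x‖ₑ ≤ 1 := fun n x => by
    rw [← ofReal_norm]; exact ENNReal.ofReal_le_one.2 (hχ1 n x)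
  have hχm : ∀ n, AEStronglyMeasurable (χ n) volume := fun n =>
    (χ n).continuous.aestronglyMeasurable
  have huae : ∀ n, ((u n).toLp 2 volume : L2Space d) =ᵐ[volume]
      (χ n : Rd d → ℂ) * (G n - f : L2Space d) + (χ n : Rd d → ℂ) * f := fun n => by
    filter_upwards [SchwartzMap.coeFn_toLp (u n) 2 volume,
      SchwartzMap.coeFn_toLp (g (j n)) 2 volume, Lp.coeFn_sub (G n) f] with x h1 h2 h3
    have h4 : (G n : Rd d → ℂ) x = g (j n) x := h2
    rw [Pi.add_apply, Pi.mul_apply, Pi.mul_apply, h1, h3, Pi.sub_apply, h4]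
    change χ n x * g (j n) x = _
    ring
  have hm1 : ∀ n, AEStronglyMeasurable
      ((χ n : Rd d → ℂ) * ((G n - f : L2Space d) : Rd d → ℂ)) volume :=
    fun n => (hχm n).mul (Lp.aestronglyMeasurable _)
  have hm2 : ∀ n, AEStronglyMeasurable ((χ n : Rd d → ℂ) * (f : Rd d → ℂ)) volume :=
    fun n => (hχm n).mul (Lp.aestronglyMeasurable _)
  -- The Sobolev part.
  have hS : ∀ n, sobolevENorm (k + 1) ((u n).toLp 2 volume) ≤
      (2 ^ (k + 1 + 1) * A : ℝ≥0) * (sobolevENorm (k + 1) f + ε n) := fun n => by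
    refine (sobolevENorm_mulS_le_left (k + 1) (χ n) (g (j n))).trans ?_
    push_cast
    rw [mul_assoc]
    have h1 := (sobolevENorm_le_add_sub (k + 1) (G n) f).trans
      (add_le_add le_rfl (hj1 n))
    have h2 := hχ3 n
    gcongr
  -- The weighted part.
  have hW : ∀ n, wENorm (fun x => ‖x‖ ^ (k + 1)) ((u n).toLp 2 volume) ≤
      ε n + wENorm (fun x => ‖x‖ ^ (k + 1)) f := fun n => by
    rw [wENorm_congr (huae n)]
    refine (wENorm_add_le (by fun_prop) (hm1 n) (hm2 n)).trans (add_le_add ?_ ?_)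
    · refine le_trans ?_ (hj n)
      have h1 : wENorm (fun x => ‖x‖ ^ (k + 1))
          ((χ n : Rd d → ℂ) * ((G n - f : L2Space d) : Rd d → ℂ)) ≤
          ENNReal.ofReal (c n) * ‖G n - f‖ₑ := by
        rw [Lp.enorm_def]
        refine (eLpNorm_mono fun x => ?_).trans
          (eLpNorm_const_smul (c n) (G n - f : L2Space d) 2 volume).le |>.trans ?_
        · rw [Pi.smul_apply, norm_mul, Complex.norm_real, Real.norm_of_nonneg (by positivity),
            Pi.mul_apply, norm_mul, ← mul_assoc, norm_smul, Real.norm_of_nonneg (hc0 n).le]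
          exact mul_le_mul_of_nonneg_right (hc' n x) (norm_nonneg _)
        · rw [Real.enorm_of_nonneg (hc0 n).le]
      refine h1.trans ?_
      gcongr
      · exact le_self_add
      · exact enorm_le_sobolevENorm _ _
    · refine wENorm_mono (ae_of_all _ fun x => ?_)
      rw [Pi.mul_apply, norm_mul]
      exact mul_le_of_le_one_left (norm_nonneg _) (hχ1 n x)
  refine ⟨u, fun n => K * (sigmaENorm (k + 1) f + ε n + ε n), ?_, ?_, fun n => ?_⟩
  · -- Convergence in `L²`: the weight controls `χ n * f - f`.
    rw [← tendsto_sub_nhds_zero_iff, tendsto_zero_iff_enorm_tendsto_zero]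
    have hwf : wENorm (fun x : Rd d => ‖x‖) f ≠ ∞ := by
      have h1 := weight_le_enorm_add (by omega : 1 ≤ k + 1) f
      simp only [pow_one] at h1
      have h2 := enorm_le_sigmaENorm (k + 1) f
      have h3 := weight_le_sigmaENorm (k + 1) f
      exact ne_top_of_le_ne_top (ENNReal.add_ne_top.2
        ⟨ne_top_of_le_ne_top hf h2, ne_top_of_le_ne_top hf h3⟩) h1
    have hlim : Tendsto (fun n => ε n + ENNReal.ofReal (2 * Real.pi) * ε n *
        wENorm (fun x : Rd d => ‖x‖) f) atTop (𝓝 0) := by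
      have h2 := ENNReal.Tendsto.mul_const (ENNReal.Tendsto.const_mul
        (a := ENNReal.ofReal (2 * Real.pi)) hεt (Or.inr (by finiteness))) (Or.inr hwf)
      simpa using hεt.add h2
    refine tendsto_of_tendsto_of_tendsto_of_le_of_le tendsto_const_nhds hlim (fun _ => zero_le)
      fun n => ?_
    have hae : ((u n).toLp 2 volume - f : L2Space d) =ᵐ[volume]
        (χ n : Rd d → ℂ) * (G n - f : L2Space d) + (((χ n : Rd d → ℂ) - 1) * (f : Rd d → ℂ)) := by
      filter_upwards [huae n, Lp.coeFn_sub ((u n).toLp 2 volume) f] with x h1 h2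
      rw [h2, Pi.sub_apply, h1]
      simp only [Pi.add_apply, Pi.mul_apply, Pi.sub_apply, Pi.one_apply]
      ring
    change ‖((u n).toLp 2 volume - f : L2Space d)‖ₑ ≤ _
    rw [Lp.enorm_def, eLpNorm_congr_ae hae]
    refine (eLpNorm_add_le (hm1 n) (((hχm n).sub aestronglyMeasurable_one).mul
      (Lp.aestronglyMeasurable _)) (by norm_num)).trans (add_le_add ?_ ?_)
    · refine (eLpNorm_mul_le_of_ae (Lp.aestronglyMeasurable _) (ae_of_all _ (hχe n))).trans ?_
      rw [one_mul, ← Lp.enorm_def]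
      exact (enorm_le_sobolevENorm _ _).trans (hj1 n)
    · have h1 : eLpNorm (((χ n : Rd d → ℂ) - 1) * (f : Rd d → ℂ)) 2 volume ≤
          ((2 * Real.pi * (1 / ((n : ℝ) + 1))).toNNReal : ℝ≥0∞) *
            wENorm (fun x : Rd d => ‖x‖) f := by
        refine eLpNorm_le_nnreal_smul_eLpNorm_of_ae_le_mul (ae_of_all _ fun x => ?_) 2
        rw [← NNReal.coe_le_coe]
        simp only [coe_nnnorm, NNReal.coe_mul, Pi.mul_apply, norm_mul, Pi.sub_apply, Pi.one_apply]
        rw [Real.coe_toNNReal _ (by positivity), Complex.norm_real, norm_norm, ← mul_assoc]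
        exact mul_le_mul_of_nonneg_right (hχ2 n x) (norm_nonneg _)
      refine h1.trans (le_of_eq ?_)
      congr 1
      exact ENNReal.ofReal_mul (by positivity)
  · have := ENNReal.Tendsto.const_mul (a := (K : ℝ≥0∞))
      ((tendsto_const_nhds (x := sigmaENorm (k + 1) f)).add hεt |>.add hεt) (Or.inr (by finiteness))
    simpa using this
  · have h1 : ((2 ^ (k + 1 + 1) * A : ℝ≥0) : ℝ≥0∞) ≤ K := by
      rw [hK]; exact_mod_cast le_self_add
    have h2 : (1 : ℝ≥0∞) ≤ K := by
      rw [hK]; exact_mod_cast le_add_self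
    rw [sigmaENorm_eq, sigmaENorm_eq]
    calc _ ≤ (K : ℝ≥0∞) * (sobolevENorm (k + 1) f + ε n) +
          K * (ε n + wENorm (fun x => ‖x‖ ^ (k + 1)) f) := by
          refine add_le_add ((hS n).trans (by gcongr)) ((hW n).trans ?_)
          exact le_mul_of_one_le_left zero_le h2
      _ = _ := by ring

/-- The free propagator is bounded on `Σ^k`, uniformly on bounded time intervals. -/
theorem exists_sigmaENorm_freePropagator_le (d : ℕ) {k : ℕ} (hk : 1 ≤ k) (T : ℝ) :
    ∃ C : ℝ≥0, ∀ (f : L2Space d) (t : ℝ), |t| ≤ T →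
      sigmaENorm k (freePropagator t f) ≤ C * sigmaENorm k f := by
  obtain ⟨k, rfl⟩ : ∃ l, k = l + 1 := ⟨k - 1, by omega⟩
  obtain ⟨K, hK⟩ := exists_schwartz_approx d k
  obtain ⟨C, hC⟩ := exists_weight_freeS_le d k T
  refine ⟨1 + C * K, fun f t ht => ?_⟩
  by_cases hf : sigmaENorm (k + 1) f = ∞
  · rw [hf, ENNReal.mul_top (by positivity)]; exact le_top
  obtain ⟨u, r, hu, hr, hur⟩ := hK f hf
  have hw : wENorm (fun x => ‖x‖ ^ (k + 1)) (freePropagator t f) ≤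
      C * (K * sigmaENorm (k + 1) f) :=
    wENorm_le_of_tendsto (by fun_prop) (((continuous_freePropagator t).tendsto f).comp hu)
      (ENNReal.Tendsto.const_mul hr (Or.inr (by finiteness)))
      fun n => (hC (u n) t ht).trans (by gcongr; exact hur n)
  rw [sigmaENorm_eq, sobolevENorm_freePropagator]
  push_cast
  rw [add_mul, one_mul, mul_assoc]
  exact add_le_add (sobolevENorm_le_sigmaENorm _ _) hw

/-- The free propagator is Lipschitz in time from `Σ^{k+2}` to `Σ^k`. -/
theorem exists_sigmaENorm_freePropagator_sub_le (d : ℕ) {k : ℕ} (hk : 1 ≤ k) (T : ℝ) :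
    ∃ C : ℝ≥0, ∀ (f : L2Space d), sigmaENorm (k + 2) f ≠ ∞ → ∀ t : ℝ, |t| ≤ T →
      sigmaENorm k (freePropagator t f - f) ≤
        ENNReal.ofReal |t| * (C * sigmaENorm (k + 2) f) := by
  obtain ⟨k, rfl⟩ : ∃ l, k = l + 1 := ⟨k - 1, by omega⟩
  obtain ⟨K, hK⟩ := exists_schwartz_approx d (k + 2)
  obtain ⟨C, hC⟩ := exists_weight_freeS_sub_le d k T
  refine ⟨1 + C * K, fun f hf t ht => ?_⟩
  obtain ⟨u, r, hu, hr, hur⟩ := hK f hf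
  have hw : wENorm (fun x => ‖x‖ ^ (k + 1)) (freePropagator t f - f : L2Space d) ≤
      ENNReal.ofReal |t| * (C * (K * sigmaENorm (k + 3) f)) :=
    wENorm_le_of_tendsto (by fun_prop) ((((continuous_freePropagator t).tendsto f).comp hu).sub hu)
      (ENNReal.Tendsto.const_mul (ENNReal.Tendsto.const_mul hr (Or.inr (by finiteness)))
        (Or.inr (by finiteness)))
      fun n => (hC (u n) t ht).trans (by gcongr; exact hur n)
  rw [sigmaENorm_eq]
  push_cast
  rw [add_mul, one_mul, mul_assoc, mul_add]
  refine add_le_add ((sobolevENorm_freePropagator_sub_le (k + 1) t f).trans ?_) hw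
  gcongr
  exact sobolevENorm_le_sigmaENorm _ _

end Approximation

/-! ### Mean value inequality in closed convex sets -/

/-- The difference quotient of a function whose derivative takes values in a closed convex set
belongs to that set: by Hahn–Banach it suffices to look at real functions. -/
theorem smul_sub_mem_of_hasDerivWithinAt {E : Type*} [NormedAddCommGroup E] [NormedSpace ℝ E]
    {K : Set E} (hK : Convex ℝ K) (hKc : IsClosed K) {f f' : ℝ → E} {a b : ℝ} (hab : a < b)
    (hf : ∀ x ∈ Set.Icc a b, HasDerivWithinAt f (f' x) (Set.Icc a b) x)
    (hf' : ∀ x ∈ Set.Icc a b, f' x ∈ K) : (b - a)⁻¹ • (f b - f a) ∈ K := by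
  by_contra h
  obtain ⟨l, c, hl, hc⟩ := geometric_hahn_banach_closed_point hK hKc h
  have hd : ∀ x ∈ Set.Icc a b, HasDerivWithinAt (fun x => l (f x)) (l (f' x)) (Set.Icc a b) x :=
    fun x hx => l.hasFDerivAt.comp_hasDerivWithinAt x (hf x hx)
  obtain ⟨x, hx, hxe⟩ := exists_hasDerivAt_eq_slope (fun x => l (f x)) (fun x => l (f' x)) hab
    (fun x hx => (hd x hx).continuousWithinAt)
    (fun x hx => (hd x (Set.Ioo_subset_Icc_self hx)).hasDerivAt (Icc_mem_nhds hx.1 hx.2))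
  have h1 := hl _ (hf' x (Set.Ioo_subset_Icc_self hx))
  rw [hxe] at h1
  rw [map_smul, map_sub, smul_eq_mul, inv_mul_eq_div] at hc
  exact lt_asymm h1 hc

section Evolution

variable {d : ℕ}

theorem sigmaENorm_real_smul (k : ℕ) (c : ℝ) (f : L2Space d) :
    sigmaENorm k (c • f) = ENNReal.ofReal |c| * sigmaENorm k f := by
  have : c • f = (c : ℂ) • f := (Complex.coe_smul c f).symm
  rw [this, sigmaENorm_smul, ← ofReal_norm, Complex.norm_real, Real.norm_eq_abs]

theorem sigmaENorm_sub_le_of_hasDerivWithinAt {k : ℕ} {f f' : ℝ → L2Space d} {a b : ℝ}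
    (hab : a ≤ b) {r : ℝ≥0∞}
    (hf : ∀ x ∈ Set.Icc a b, HasDerivWithinAt f (f' x) (Set.Icc a b) x)
    (hf' : ∀ x ∈ Set.Icc a b, sigmaENorm k (f' x) ≤ r) :
    sigmaENorm k (f b - f a) ≤ ENNReal.ofReal (b - a) * r := by
  rcases hab.eq_or_lt with rfl | hab
  · simp [sigmaENorm_zero]
  have h := smul_sub_mem_of_hasDerivWithinAt (convex_sigmaENorm_le k r)
    (isClosed_sigmaENorm_le k r) hab hf hf'
  have hba : 0 < b - a := sub_pos.2 hab
  have e : f b - f a = (b - a) • ((b - a)⁻¹ • (f b - f a)) := by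
    rw [smul_smul, mul_inv_cancel₀ hba.ne', one_smul]
  rw [e, sigmaENorm_real_smul, abs_of_pos hba]
  gcongr
  exact h

/-! ### The equation in the interaction picture -/

/-- Second order Taylor remainder of the Schrödinger multiplier, at the cost of three
derivatives. -/
theorem norm_chirp_sub_le (h : ℝ) (ξ : Rd d) :
    ‖chirp h ξ - 1 - (h * Complex.I) * ((-(2 * Real.pi * ‖ξ‖) ^ 2 : ℝ) : ℂ)‖ ≤
      2 * |h| * √|h| * sobolevWeight 3 ξ := by
  set a := 2 * Real.pi * ‖ξ‖ with ha
  have ha0 : 0 ≤ a := by positivity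
  set s := √|h| with hs
  have hs0 : 0 ≤ s := Real.sqrt_nonneg _
  have hs2 : s ^ 2 = |h| := Real.sq_sqrt (abs_nonneg h)
  have hw : a ^ 3 ≤ sobolevWeight 3 ξ := by
    unfold sobolevWeight
    have h1 : a ^ 3 = (a ^ 2) ^ (((3 : ℕ) : ℝ) / 2) := by
      rw [← Real.rpow_natCast a 2, ← Real.rpow_mul ha0, ← Real.rpow_natCast]
      congr 1; push_cast; ring
    rw [h1]
    exact Real.rpow_le_rpow (by positivity) (by linarith) (by positivity)
  have e : chirp h ξ - 1 - (h * Complex.I) * ((-a ^ 2 : ℝ) : ℂ) =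
      Complex.exp (Complex.I * ((-h * a ^ 2 : ℝ) : ℂ)) - 1 -
        Complex.I * ((-h * a ^ 2 : ℝ) : ℂ) := by
    rw [chirp, ← ha]; push_cast; ring
  have hθ : ‖Complex.I * ((-h * a ^ 2 : ℝ) : ℂ)‖ = (s * a) ^ 2 := by
    rw [norm_mul, Complex.norm_I, one_mul, Complex.norm_real, norm_mul, norm_neg, Real.norm_eq_abs,
      Real.norm_of_nonneg (by positivity), mul_pow s, hs2]
  have key : ‖chirp h ξ - 1 - (h * Complex.I) * ((-a ^ 2 : ℝ) : ℂ)‖ ≤ 2 * (s * a) ^ 3 := by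
    rw [e]
    have hsa : 0 ≤ s * a := by positivity
    -- Small phases use the quadratic remainder, large ones the triangle inequality.
    rcases le_total (s * a) 1 with h1 | h1
    · have h2 : (s * a) ^ 2 ≤ 1 := pow_le_one₀ hsa h1
      refine (Complex.norm_exp_sub_one_sub_id_le (hθ.trans_le h2)).trans ?_
      rw [hθ]
      nlinarith [pow_nonneg hsa 3, mul_le_mul_of_nonneg_left h1 (pow_nonneg hsa 3)]
    · refine (norm_sub_le _ _).trans ?_
      have h3 := Real.norm_exp_I_mul_ofReal_sub_one_le (x := -h * a ^ 2)
      have h4 : ‖-h * a ^ 2‖ = (s * a) ^ 2 := by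
        rw [← hθ, norm_mul Complex.I, Complex.norm_I, one_mul, Complex.norm_real]
      rw [h4] at h3
      rw [hθ]
      nlinarith [mul_le_mul_of_nonneg_left h1 (pow_nonneg hsa 2)]
  refine key.trans ?_
  rw [mul_pow s, pow_succ s 2, hs2]
  calc _ = 2 * |h| * s * a ^ 3 := by ring
    _ ≤ _ := by gcongr

/-- On `H³` the distributional Laplacian is an `L²` function, and `i` times it is the derivative of
the free propagator, with a quantitative remainder. -/
theorem exists_laplacian_L2 {f : L2Space d} (hf : sobolevENorm 3 f ≠ ∞) :
    ∃ D : L2Space d, Δ (f : 𝓢'(Rd d, ℂ)) = (D : 𝓢'(Rd d, ℂ)) ∧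
      ∀ h : ℝ, ‖freePropagator h f - f - ((h : ℂ) * Complex.I) • D‖ₑ ≤
        ENNReal.ofReal (2 * |h| * √|h|) * sobolevENorm 3 f := by
  have hc : Continuous fun ξ : Rd d => ((-(2 * Real.pi * ‖ξ‖) ^ 2 : ℝ) : ℂ) := by fun_prop
  have hmem : MemLp (fun ξ => ((-(2 * Real.pi * ‖ξ‖) ^ 2 : ℝ) : ℂ) * (𝓕 f : L2Space d) ξ) 2
      volume := by
    refine ⟨hc.aestronglyMeasurable.mul (Lp.aestronglyMeasurable _), ?_⟩
    refine lt_of_le_of_lt (eLpNorm_mono fun ξ => ?_)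
      ((sobolevENorm_mono (by norm_num : 2 ≤ 3) f).trans_lt (lt_top_iff_ne_top.2 hf))
    rw [norm_mul, norm_mul, Complex.norm_real, Complex.norm_real, norm_neg,
      Real.norm_of_nonneg (by positivity), Real.norm_of_nonneg (by positivity)]
    gcongr
    rw [show ((2 : ℕ) : ℝ) / 2 = 1 by norm_num, Real.rpow_one]
    linarith
  set G : L2Space d := hmem.toLp _ with hG
  have hFG : 𝓕 (𝓕⁻ G : L2Space d) = G := FourierTransform.fourier_fourierInv_eq G
  refine ⟨𝓕⁻ G, ?_, fun h => ?_⟩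
  · rw [TemperedDistribution.laplacian_eq_fourierMultiplierCLM,
      TemperedDistribution.fourierMultiplierCLM_apply, ← Lp.fourierInv_toTemperedDistribution_eq,
      Lp.fourier_toTemperedDistribution_eq]
    ext u
    have hg : (fun ξ : Rd d => Complex.ofReal (‖ξ‖ ^ 2)).HasTemperateGrowth := by fun_prop
    change (-(2 * Real.pi) ^ 2) • (TemperedDistribution.smulLeftCLM ℂ
      (fun ξ : Rd d => Complex.ofReal (‖ξ‖ ^ 2)) ((𝓕 f : L2Space d) : 𝓢'(Rd d, ℂ))) (𝓕⁻ u) =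
      (G : 𝓢'(Rd d, ℂ)) (𝓕⁻ u)
    rw [TemperedDistribution.smulLeftCLM_apply_apply, Lp.toTemperedDistribution_apply,
      Lp.toTemperedDistribution_apply, ← integral_smul]
    refine integral_congr_ae ?_
    filter_upwards [hmem.coeFn_toLp] with ξ h1
    rw [hG, h1, SchwartzMap.smulLeftCLM_apply_apply hg]
    simp only [smul_eq_mul, Complex.real_smul]
    push_cast
    ring
  · rw [← enorm_fourier_L2, fourier_sub_L2, fourier_sub_L2, FourierTransform.fourier_smul, hFG,
      Lp.enorm_def, sobolevENorm_eq, ENNReal.ofReal]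
    refine eLpNorm_le_nnreal_smul_eLpNorm_of_ae_le_mul ?_ 2
    filter_upwards [Lp.coeFn_sub (𝓕 (freePropagator h f) - 𝓕 f : L2Space d)
      (((h : ℂ) * Complex.I) • G), Lp.coeFn_sub (𝓕 (freePropagator h f) : L2Space d) (𝓕 f),
      Lp.coeFn_smul ((h : ℂ) * Complex.I) G, hmem.coeFn_toLp,
      fourier_freePropagator_ae h f] with ξ h1 h2 h3 h4 h5
    rw [h1, Pi.sub_apply, h2, Pi.sub_apply, h3, Pi.smul_apply, h4, h5, ← NNReal.coe_le_coe]
    simp only [coe_nnnorm, NNReal.coe_mul, norm_mul]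
    rw [Real.coe_toNNReal _ (by positivity), Complex.norm_real,
      Real.norm_of_nonneg (sobolevWeight_nonneg 3 ξ), ← mul_assoc]
    refine le_trans (le_of_eq ?_) (mul_le_mul_of_nonneg_right (norm_chirp_sub_le h ξ)
      (norm_nonneg ((𝓕 f : L2Space d) ξ)))
    rw [← norm_mul]
    congr 1
    rw [smul_eq_mul]; ring

theorem toTemperedDistribution_injective {f g : L2Space d}
    (h : (f : 𝓢'(Rd d, ℂ)) = (g : 𝓢'(Rd d, ℂ))) : f = g :=
  LinearMap.ker_eq_bot.1 (Lp.ker_toTemperedDistributionCLM_eq_bot (F := ℂ)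
    (μ := (volume : Measure (Rd d))) (p := 2)) h

/-- The interaction picture `e^{-itΔ} ψ(t)` removes the Laplacian from the equation. -/
theorem hasDerivWithinAt_freePropagator_neg {μ : ℝ} {ψ : ℝ → L2Space d} {s : Set ℝ} {t : ℝ}
    {ψ' N : L2Space d} (hψ : HasDerivWithinAt ψ ψ' s t)
    (h3 : sobolevENorm 3 (ψ t) ≠ ∞) (hN : sobolevENorm 2 N ≠ ∞)
    (heq : Complex.I • (ψ' : 𝓢'(Rd d, ℂ)) =
      -Δ (ψ t : 𝓢'(Rd d, ℂ)) + (μ : ℂ) • (N : 𝓢'(Rd d, ℂ))) :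
    HasDerivWithinAt (fun t => freePropagator (-t) (ψ t))
      (freePropagator (-t) ((-(Complex.I * μ)) • N)) s t := by
  obtain ⟨D, hD, hDt⟩ := exists_laplacian_L2 h3
  set w : L2Space d := (-(Complex.I * μ)) • N with hw
  have hψ' : ψ' = Complex.I • D + w := by
    have h1 : Complex.I • ψ' = -D + (μ : ℂ) • N := by
      refine toTemperedDistribution_injective ?_
      rw [hD] at heq
      have e := Lp.toTemperedDistributionCLM ℂ (volume : Measure (Rd d)) 2
      simp only [← Lp.toTemperedDistributionCLM_apply, map_add, map_smul, map_neg] at heq ⊢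
      exact heq
    have h2 : ψ' = -Complex.I • (Complex.I • ψ') := by
      rw [smul_smul]; simp
    rw [h2, h1, smul_add, smul_neg, hw, smul_smul]
    simp
  rw [hasDerivWithinAt_iff_isLittleO] at hψ ⊢
  set A : ℝ → L2Space d := fun x => ψ x - ψ t - (x - t) • ψ' with hA
  set B : ℝ := (sobolevENorm 3 (ψ t)).toReal with hB
  have hsw : sobolevENorm 2 w ≠ ∞ := by
    rw [hw, sobolevENorm_smul]; exact ENNReal.mul_ne_top (by finiteness) hN
  set B' : ℝ := (sobolevENorm 2 w).toReal with hB'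
  -- With `S` the free propagator, `h = x - t` and `w = ψ' - iD`, the remainder of `S(-x) ψ(x)` is
  -- `S(-x)` applied to the remainder of `ψ`, minus that of `S(h) ψ(t)`, minus `h (S(h) w - w)`.
  have hbd : ∀ x, ‖freePropagator (-x) (ψ x) - freePropagator (-t) (ψ t) -
      (x - t) • freePropagator (-t) w‖ ≤
      ‖A x‖ + (|x - t| * (2 * √|x - t| * B) + |x - t| * (|x - t| * B')) := by
    intro x
    have hS : ∀ g : L2Space d, freePropagator (-x) (freePropagator (x - t) g) =
        freePropagator (-t) g := fun g => by
      rw [freePropagator_freePropagator]; congr 1; ring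
    set z : ℂ := ((x - t : ℝ) : ℂ) with hz
    have hz' : ∀ g : L2Space d, (x - t) • g = z • g := fun g => (Complex.coe_smul _ _).symm
    have e : freePropagator (-x) (ψ x) - freePropagator (-t) (ψ t) -
        (x - t) • freePropagator (-t) w =
        freePropagator (-x) (A x - (freePropagator (x - t) (ψ t) - ψ t - (z * Complex.I) • D) -
          z • (freePropagator (x - t) w - w)) := by
      have e1 : A x - (freePropagator (x - t) (ψ t) - ψ t - (z * Complex.I) • D) -
          z • (freePropagator (x - t) w - w) =
          ψ x - freePropagator (x - t) (ψ t) - z • freePropagator (x - t) w := by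
        simp only [hA]
        rw [hz', hψ', smul_add, smul_sub, smul_smul]
        abel
      rw [e1, freePropagator_sub, freePropagator_sub,
        freePropagator_smul (-x) z, hS, hS, hz']
    rw [e, norm_freePropagator]
    refine (norm_sub_le _ _).trans ((add_le_add (norm_sub_le _ _) le_rfl).trans ?_)
    rw [add_assoc]
    refine add_le_add le_rfl (add_le_add ?_ ?_)
    · have := ENNReal.toReal_mono (by finiteness) (hDt (x - t))
      rw [toReal_enorm, ENNReal.toReal_mul, ENNReal.toReal_ofReal (by positivity)] at this
      exact this.trans (le_of_eq (by rw [hB]; ring))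
    · rw [norm_smul, hz, Complex.norm_real, Real.norm_eq_abs]
      refine mul_le_mul_of_nonneg_left ?_ (abs_nonneg _)
      have := ENNReal.toReal_mono (by finiteness) ((enorm_le_sobolevENorm 0 _).trans
        (sobolevENorm_freePropagator_sub_le 0 (x - t) w))
      rwa [toReal_enorm, ENNReal.toReal_mul, ENNReal.toReal_ofReal (abs_nonneg _)] at this
  refine (Asymptotics.IsBigO.of_norm_le fun x => hbd x).trans_isLittleO ?_
  have hlim : ∀ g : ℝ → ℝ, Continuous g → g 0 = 0 →
      (fun x => |x - t| * g (x - t)) =o[𝓝[s] t] fun x => x - t := fun g hg hg0 => by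
    have h1 : Tendsto (fun x => g (x - t)) (𝓝[s] t) (𝓝 0) := by
      have : Continuous fun x => g (x - t) := by fun_prop
      have h2 := (this.tendsto t).mono_left (nhdsWithin_le_nhds (s := s))
      simpa [hg0] using h2
    have h3 : (fun x => |x - t|) =O[𝓝[s] t] fun x => x - t :=
      (Asymptotics.isBigO_refl (fun x => x - t) _).norm_left
    simpa using h3.mul_isLittleO ((Asymptotics.isLittleO_one_iff ℝ).2 h1)
  refine hψ.norm_left.add ((hlim (fun y => 2 * √|y| * B) (by fun_prop) (by simp)).add
    (hlim (fun y => |y| * B') (by fun_prop) (by simp)))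

end Evolution

/-! ### Consistency of the splitting -/

section Convergence

variable {d : ℕ}

/-- In the interaction picture the solution has a second order Taylor remainder in `Σ^k`. -/
theorem exists_interaction_taylor {k : ℕ} (hk : (d : ℝ) / 2 < k) (hk1 : 1 ≤ k) (μ T : ℝ)
    (M : ℝ≥0) : ∃ C : ℝ≥0, ∀ (ψ₀ : L2Space d) (ψ : ℝ → L2Space d),
      IsCubicNLSSolution μ T ψ₀ ψ → (∀ t ∈ Set.Icc 0 T, sigmaENorm (k + 2) (ψ t) ≤ M) →
      ∃ N : ℝ → L2Space d,
        (∀ t ∈ Set.Icc 0 T, ∀ᵐ x, N t x = ((‖ψ t x‖ ^ 2 : ℝ) : ℂ) * ψ t x) ∧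
        ∀ t s : ℝ, 0 ≤ t → t ≤ s → s ≤ T →
          sigmaENorm k (freePropagator (-s) (ψ s) - freePropagator (-t) (ψ t) -
            (s - t) • freePropagator (-t) ((-(Complex.I * μ)) • N t)) ≤
            ENNReal.ofReal (s - t) ^ 2 * C := by
  have hk2 : (d : ℝ) / 2 < ((k + 2 : ℕ) : ℝ) := by push_cast; linarith
  obtain ⟨L₂, hL₂, -⟩ := exists_cubic_le hk2 M
  obtain ⟨L₁, -, hL₁⟩ := exists_cubic_le hk (2 * M)
  obtain ⟨CS, hCS⟩ := exists_sigmaENorm_freePropagator_le d hk1 T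
  obtain ⟨CD, hCD⟩ := exists_sigmaENorm_freePropagator_sub_le d hk1 T
  set W : ℝ≥0 := CS * (‖μ‖₊ * (2 * L₂)) with hW
  set P : ℝ≥0 := CS * W + CD * M with hP
  set Q : ℝ≥0 := CS * (‖μ‖₊ * (L₁ * P)) + CS * (CD * (‖μ‖₊ * L₂)) with hQ
  refine ⟨Q, fun ψ₀ ψ hψ hM => ?_⟩
  have hex : ∀ t, ∃ N : L2Space d, t ∈ Set.Icc 0 T →
      (∀ᵐ x, N x = ((‖ψ t x‖ ^ 2 : ℝ) : ℂ) * ψ t x) ∧ ∃ ψ' : L2Space d,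
        HasDerivWithinAt ψ ψ' (Set.Icc 0 T) t ∧
        Complex.I • (ψ' : 𝓢'(Rd d, ℂ)) =
          -Δ (ψ t : 𝓢'(Rd d, ℂ)) + (μ : ℂ) • (N : 𝓢'(Rd d, ℂ)) := fun t => by
    by_cases ht : t ∈ Set.Icc 0 T
    · obtain ⟨ψ', N, h1, h2, h3⟩ := hψ.equation t ht
      exact ⟨N, fun _ => ⟨h2, ψ', h1, h3⟩⟩
    · exact ⟨0, fun h => absurd h ht⟩
  choose N hN using hex
  set c : ℂ := -(Complex.I * μ) with hc
  have hcn : ‖c‖ₑ = ‖μ‖₊ := by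
    rw [← ofReal_norm, hc, norm_neg, norm_mul, Complex.norm_I, one_mul, Complex.norm_real]
    exact ofReal_norm μ
  set v : ℝ → L2Space d := fun t => freePropagator (-t) (ψ t) with hv
  set w : ℝ → L2Space d := fun t => freePropagator (-t) (c • N t) with hw
  have hN2 : ∀ t ∈ Set.Icc 0 T, sigmaENorm (k + 2) (N t) ≤ L₂ := fun t ht =>
    hL₂ _ _ (hM t ht) (hN t ht).1
  have hNk : ∀ t ∈ Set.Icc 0 T, sigmaENorm k (N t) ≤ 2 * L₂ := fun t ht =>
    (sigmaENorm_le_two_mul (by omega : k ≤ k + 2) _).trans (by gcongr; exact hN2 t ht)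
  have hψk : ∀ t ∈ Set.Icc 0 T, sigmaENorm k (ψ t) ≤ ((2 * M : ℝ≥0) : ℝ≥0∞) := fun t ht => by
    push_cast
    exact (sigmaENorm_le_two_mul (by omega : k ≤ k + 2) _).trans (by gcongr; exact hM t ht)
  have hderiv : ∀ t ∈ Set.Icc 0 T, HasDerivWithinAt v (w t) (Set.Icc 0 T) t := fun t ht => by
    obtain ⟨h1, ψ', h2, h3⟩ := hN t ht
    refine hasDerivWithinAt_freePropagator_neg h2 ?_ ?_ h3
    · exact ne_top_of_le_ne_top ENNReal.coe_ne_top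
        (((sobolevENorm_mono (by omega : 3 ≤ k + 2) _).trans
        (sobolevENorm_le_sigmaENorm _ _)).trans (hM t ht))
    · exact ne_top_of_le_ne_top ENNReal.coe_ne_top
        (((sobolevENorm_mono (by omega : 2 ≤ k + 2) _).trans
        (sobolevENorm_le_sigmaENorm _ _)).trans (hN2 t ht))
  have hsub : ∀ {t s : ℝ}, 0 ≤ t → s ≤ T → Set.Icc t s ⊆ Set.Icc 0 T := fun ht hs =>
    Set.Icc_subset_Icc ht hs
  have habs : ∀ t ∈ Set.Icc 0 T, |(-t)| ≤ T := fun t ht => by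
    rw [abs_neg, abs_of_nonneg ht.1]; exact ht.2
  -- `v` is Lipschitz in `Σ^k`, because its derivative is bounded there.
  have hvL : ∀ t s : ℝ, 0 ≤ t → t ≤ s → s ≤ T →
      sigmaENorm k (v s - v t) ≤ ENNReal.ofReal (s - t) * W := fun t s ht hts hs => by
    refine sigmaENorm_sub_le_of_hasDerivWithinAt hts
      (fun x hx => (hderiv x (hsub ht hs hx)).mono (hsub ht hs)) fun x hx => ?_
    have hx' := hsub ht hs hx
    refine (hCS _ _ (habs x hx')).trans ?_
    rw [sigmaENorm_smul, hcn, hW]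
    push_cast
    gcongr
    exact hNk x hx'
  -- Hence `ψ` is Lipschitz in `Σ^k`.
  have hψL : ∀ t s : ℝ, 0 ≤ t → t ≤ s → s ≤ T →
      sigmaENorm k (ψ s - ψ t) ≤ ENNReal.ofReal (s - t) * P := fun t s ht hts hs => by
    have e : ψ s - ψ t = freePropagator s (v s - v t) + (freePropagator (s - t) (ψ t) - ψ t) := by
      rw [freePropagator_sub, hv, freePropagator_freePropagator, freePropagator_freePropagator,
        add_neg_cancel, freePropagator_zero, ← sub_eq_add_neg]
      abel
    rw [e]
    have hs0 : |s| ≤ T := by rw [abs_of_nonneg (ht.trans hts)]; exact hs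
    have hst : |s - t| ≤ T := by rw [abs_of_nonneg (by linarith)]; linarith
    have hMt := hM t ⟨ht, hts.trans hs⟩
    refine (sigmaENorm_add_le _ _ _).trans ?_
    calc _ ≤ (CS : ℝ≥0∞) * (ENNReal.ofReal (s - t) * W) +
          ENNReal.ofReal |s - t| * (CD * M) := by
          refine add_le_add ((hCS _ _ hs0).trans ?_) ((hCD _ ?_ _ hst).trans ?_)
          · gcongr; exact hvL t s ht hts hs
          · exact ne_top_of_le_ne_top ENNReal.coe_ne_top hMt
          · gcongr
      _ = _ := by
          rw [abs_of_nonneg (by linarith), hP]; push_cast; ring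
  -- Hence the derivative of `v` is Lipschitz in `Σ^k`.
  have hwL : ∀ t s : ℝ, 0 ≤ t → t ≤ s → s ≤ T →
      sigmaENorm k (w s - w t) ≤ ENNReal.ofReal (s - t) * Q := fun t s ht hts hs => by
    have hs' : s ∈ Set.Icc 0 T := ⟨ht.trans hts, hs⟩
    have ht' : t ∈ Set.Icc 0 T := ⟨ht, hts.trans hs⟩
    have e : w s - w t = freePropagator (-s) (c • (N s - N t)) +
        freePropagator (-t) (freePropagator (-(s - t)) (c • N t) - c • N t) := by
      rw [smul_sub, freePropagator_sub, freePropagator_sub, freePropagator_freePropagator, hw,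
        show -t + -(s - t) = -s by ring]
      abel
    have hst : |(-(s - t))| ≤ T := by rw [abs_neg, abs_of_nonneg (by linarith)]; linarith
    have hcN : sigmaENorm (k + 2) (c • N t) ≤ ‖μ‖₊ * L₂ := by
      rw [sigmaENorm_smul, hcn]; gcongr; exact hN2 t ht'
    rw [e]
    refine (sigmaENorm_add_le _ _ _).trans ?_
    calc _ ≤ (CS : ℝ≥0∞) * (‖μ‖₊ * (L₁ * (ENNReal.ofReal (s - t) * P))) +
          CS * (ENNReal.ofReal |(-(s - t))| * (CD * (‖μ‖₊ * L₂))) := by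
          refine add_le_add ((hCS _ _ (habs s hs')).trans ?_) ((hCS _ _ (habs t ht')).trans ?_)
          · rw [sigmaENorm_smul, hcn]
            have h1 := (hL₁ _ _ _ _ (hψk s hs') (hψk t ht') (hN s hs').1 (hN t ht').1).trans
              (mul_le_mul_right (hψL t s ht hts hs) _)
            gcongr
          · have h1 := hCD (c • N t) (ne_top_of_le_ne_top (by finiteness) hcN) _ hst
            refine mul_le_mul_right (h1.trans ?_) _
            gcongr
      _ = _ := by
          rw [abs_neg, abs_of_nonneg (by linarith), hQ]; push_cast; ring
  refine ⟨N, fun t ht => (hN t ht).1, fun t s ht hts hs => ?_⟩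
  have h := sigmaENorm_sub_le_of_hasDerivWithinAt (k := k) (f := fun x => v x - x • w t)
    (f' := fun x => w x - w t) hts (r := ENNReal.ofReal (s - t) * Q) (fun x hx => ?_)
    fun x hx => ?_
  · have e : v s - v t - (s - t) • w t = (v s - s • w t) - (v t - t • w t) := by
      rw [sub_smul]; abel
    change sigmaENorm k (v s - v t - (s - t) • w t) ≤ _
    rw [e]
    refine h.trans (le_of_eq ?_)
    ring
  · have h1 := (hasDerivWithinAt_id x (Set.Icc t s)).smul_const (w t)
    rw [one_smul] at h1
    exact ((hderiv x (hsub ht hs hx)).mono (hsub ht hs)).sub h1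
  · refine (hwL t x ht hx.1 (hx.2.trans hs)).trans ?_
    gcongr
    exact hx.2

/-! ### Stability and convergence -/

/-- One step of the error recursion in the interaction picture, as long as the numerical solution
stays in a fixed ball. The constant `CS` bounds the free propagator. -/
theorem exists_error_step {k : ℕ} (hk : (d : ℝ) / 2 < k) (hk1 : 1 ≤ k) (μ T : ℝ)
    (M : ℝ≥0) : ∃ A B CS : ℝ≥0,
      (∀ (f : L2Space d) (t : ℝ), |t| ≤ T →
        sigmaENorm k (freePropagator t f) ≤ CS * sigmaENorm k f) ∧
      ∀ (ψ₀ : L2Space d) (ψ : ℝ → L2Space d),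
      IsCubicNLSSolution μ T ψ₀ ψ → (∀ t ∈ Set.Icc 0 T, sigmaENorm (k + 2) (ψ t) ≤ M) →
      ∀ (t τ : ℝ), 0 ≤ t → 0 ≤ τ → t + τ ≤ T → ∀ f : L2Space d,
        sigmaENorm k f ≤ ((2 * M + 1 : ℝ≥0) : ℝ≥0∞) →
        sigmaENorm k (freePropagator (-(t + τ)) (freePropagator τ (nonlinearFlow μ τ f)) -
            freePropagator (-(t + τ)) (ψ (t + τ))) ≤
          (1 + ENNReal.ofReal τ * A) *
            sigmaENorm k (freePropagator (-t) f - freePropagator (-t) (ψ t)) +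
          ENNReal.ofReal τ ^ 2 * B := by
  obtain ⟨C, hC⟩ := exists_interaction_taylor hk hk1 μ T M
  obtain ⟨L, hL⟩ := exists_nonlinearFlow_lipschitz hk μ T (2 * M + 1)
  obtain ⟨L', hL'⟩ := exists_nonlinearFlow_taylor hk μ T (2 * M)
  obtain ⟨CS, hCS⟩ := exists_sigmaENorm_freePropagator_le d hk1 T
  refine ⟨CS * (L * CS), CS * L' + C, CS, hCS, fun ψ₀ ψ hψ hM t τ ht hτ htτ f hf => ?_⟩
  obtain ⟨N, hN, hNt⟩ := hC ψ₀ ψ hψ hM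
  have ht' : t ∈ Set.Icc 0 T := ⟨ht, by linarith⟩
  have hτT : τ ≤ T := by linarith
  have htT : |(-t)| ≤ T := by rw [abs_neg, abs_of_nonneg ht]; exact ht'.2
  have htT' : |t| ≤ T := by rw [abs_of_nonneg ht]; exact ht'.2
  have hψk : sigmaENorm k (ψ t) ≤ ((2 * M : ℝ≥0) : ℝ≥0∞) := by
    push_cast
    exact (sigmaENorm_le_two_mul (by omega : k ≤ k + 2) _).trans (by gcongr; exact hM t ht')
  have hψk' : sigmaENorm k (ψ t) ≤ ((2 * M + 1 : ℝ≥0) : ℝ≥0∞) :=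
    hψk.trans (by exact_mod_cast le_self_add)
  set e : L2Space d := freePropagator (-t) f - freePropagator (-t) (ψ t) with he
  set X : L2Space d := (nonlinearFlow μ τ f - f) - (nonlinearFlow μ τ (ψ t) - ψ t) with hX
  set Y : L2Space d := nonlinearFlow μ τ (ψ t) - ψ t + (Complex.I * (τ * μ)) • N t with hY
  set Z : L2Space d := freePropagator (-(t + τ)) (ψ (t + τ)) - freePropagator (-t) (ψ t) -
    (t + τ - t) • freePropagator (-t) ((-(Complex.I * μ)) • N t) with hZ
  have hfe : f - ψ t = freePropagator t e := by
    rw [he, freePropagator_sub, freePropagator_freePropagator, freePropagator_freePropagator,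
      add_neg_cancel, freePropagator_zero, freePropagator_zero]
  have hXb : sigmaENorm k X ≤ ENNReal.ofReal τ * (L * (CS * sigmaENorm k e)) := by
    refine (hL f (ψ t) hf hψk' τ hτ hτT).trans ?_
    rw [hfe]
    have := hCS e t htT'
    gcongr
  have hYb : sigmaENorm k Y ≤ ENNReal.ofReal τ ^ 2 * L' := hL' _ _ hψk (hN t ht') τ hτ hτT
  have hZb : sigmaENorm k Z ≤ ENNReal.ofReal τ ^ 2 * C :=
    (hNt t (t + τ) ht (by linarith) htτ).trans (by rw [add_sub_cancel_left])
  -- The new error is the old one, plus the stability term `X`, plus the local errors `Y` and `Z` of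
  -- the nonlinear flow and of the exact solution; their first order terms cancel.
  have key : freePropagator (-(t + τ)) (freePropagator τ (nonlinearFlow μ τ f)) -
      freePropagator (-(t + τ)) (ψ (t + τ)) =
      e + freePropagator (-t) X + freePropagator (-t) Y - Z := by
    have h1 : (t + τ - t) • freePropagator (-t) ((-(Complex.I * μ)) • N t) =
        -freePropagator (-t) ((Complex.I * (τ * μ)) • N t) := by
      rw [add_sub_cancel_left, freePropagator_smul, freePropagator_smul,
        show τ • (-(Complex.I * (μ : ℂ))) • freePropagator (-t) (N t) =
          (τ : ℂ) • (-(Complex.I * (μ : ℂ))) • freePropagator (-t) (N t) from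
          (Complex.coe_smul _ _).symm, smul_smul, ← neg_smul]
      congr 1; ring
    rw [freePropagator_freePropagator, show -(t + τ) + τ = -t by ring, hZ, h1, hX, hY, he,
      freePropagator_add]
    simp only [freePropagator_sub]
    abel
  rw [key]
  calc _ ≤ sigmaENorm k e + CS * sigmaENorm k X + CS * sigmaENorm k Y + sigmaENorm k Z := by
        refine (sigmaENorm_sub_le _ _ _).trans (add_le_add ?_ le_rfl)
        refine (sigmaENorm_add_le _ _ _).trans (add_le_add ?_ (hCS _ _ htT))
        exact (sigmaENorm_add_le _ _ _).trans (add_le_add le_rfl (hCS _ _ htT))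
    _ ≤ sigmaENorm k e + CS * (ENNReal.ofReal τ * (L * (CS * sigmaENorm k e))) +
          CS * (ENNReal.ofReal τ ^ 2 * L') + ENNReal.ofReal τ ^ 2 * C := by gcongr
    _ = _ := by push_cast; ring

theorem mainTheorem2 (d : ℕ) (hd : 1 ≤ d) (k : ℕ) (hk : (d : ℝ) / 2 < (k : ℝ)) (μ : ℝ)
    (T : ℝ) (hT : 0 < T) (M : ℝ≥0) :
    ∃ C : ℝ, 0 < C ∧ ∃ τ₀ : ℝ, 0 < τ₀ ∧
      ∀ (ψ₀ : L2Space d) (ψ : ℝ → L2Space d),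
        IsCubicNLSSolution μ T ψ₀ ψ →
        (⨆ t ∈ Set.Icc (0 : ℝ) T, sigmaENorm (k + 2) (ψ t)) ≤ (M : ℝ≥0∞) →
        ∀ τ : ℝ, 0 < τ → τ < τ₀ → ∀ n : ℕ, (n : ℝ) * τ ≤ T →
          sigmaENorm k (lieSplitting μ τ ψ₀ n - ψ ((n : ℝ) * τ)) ≤ ENNReal.ofReal (C * τ) := by
  have hk1 : 1 ≤ k := by
    by_contra h
    have h0 : k = 0 := by omega
    have : (0 : ℝ) ≤ (d : ℝ) / 2 := by positivity
    rw [h0, Nat.cast_zero] at hk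
    linarith
  obtain ⟨A, B, CS, hCS, hstep⟩ := exists_error_step hk hk1 μ T M
  -- The discrete Gronwall bound for the error in the interaction picture is `K τ`.
  set K : ℝ := T * B * Real.exp (A * T) with hK
  have hK0 : 0 ≤ K := by positivity
  refine ⟨CS * K + 1, by positivity, 1 / (CS * K + 1), by positivity, ?_⟩
  intro ψ₀ ψ hψ hsup τ hτ hττ n hn
  have hM : ∀ t ∈ Set.Icc 0 T, sigmaENorm (k + 2) (ψ t) ≤ M := fun t ht =>
    (le_iSup₂ (f := fun t (_ : t ∈ Set.Icc (0 : ℝ) T) => sigmaENorm (k + 2) (ψ t)) t ht).trans hsup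
  have hτ1 : (CS * K + 1) * τ ≤ 1 := by
    rw [lt_div_iff₀ (by positivity)] at hττ
    linarith
  set u := lieSplitting μ τ ψ₀ with hu
  -- `E` dominates the solution of the recursion `e (n + 1) = (1 + A τ) e n + B τ²`, `e 0 = 0`.
  set E : ℕ → ℝ := fun n => n * B * τ ^ 2 * (1 + A * τ) ^ n with hE
  have hE0 : ∀ n, 0 ≤ E n := fun n => by positivity
  have hEK : ∀ n : ℕ, (n : ℝ) * τ ≤ T → E n ≤ K * τ := fun n hn => by
    have h1 : (1 + A * τ) ^ n ≤ Real.exp (A * T) := by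
      calc (1 + (A : ℝ) * τ) ^ n ≤ Real.exp (A * τ) ^ n := by
            gcongr; rw [add_comm]; exact Real.add_one_le_exp _
        _ = Real.exp (A * (n * τ)) := by rw [← Real.exp_nat_mul]; congr 1; ring
        _ ≤ _ := by gcongr
    calc E n = (n * τ) * B * (1 + A * τ) ^ n * τ := by rw [hE]; ring
      _ ≤ T * B * Real.exp (A * T) * τ := by gcongr
  -- A bound on the error in the interaction picture carries over to the error itself.
  have hpull : ∀ n : ℕ, (n : ℝ) * τ ≤ T →
      sigmaENorm k (freePropagator (-(n * τ)) (u n) - freePropagator (-(n * τ)) (ψ (n * τ))) ≤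
        ENNReal.ofReal (E n) →
      sigmaENorm k (u n - ψ (n * τ)) ≤ ENNReal.ofReal ((CS * K + 1) * τ) := fun n hn h => by
    have e : u n - ψ (n * τ) = freePropagator (n * τ)
        (freePropagator (-(n * τ)) (u n) - freePropagator (-(n * τ)) (ψ (n * τ))) := by
      rw [freePropagator_sub, freePropagator_freePropagator, freePropagator_freePropagator,
        add_neg_cancel, freePropagator_zero, freePropagator_zero]
    rw [e]
    refine (hCS _ _ (by rw [abs_of_nonneg (by positivity)]; exact hn)).trans ?_
    calc _ ≤ (CS : ℝ≥0∞) * ENNReal.ofReal (K * τ) := by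
          gcongr; exact h.trans (ENNReal.ofReal_le_ofReal (hEK n hn))
      _ = ENNReal.ofReal (CS * (K * τ)) := by
          rw [ENNReal.ofReal_mul CS.coe_nonneg, ENNReal.ofReal_coe_nnreal]
      _ ≤ _ := ENNReal.ofReal_le_ofReal (by nlinarith)
  have hmain : ∀ n : ℕ, (n : ℝ) * τ ≤ T →
      sigmaENorm k (freePropagator (-(n * τ)) (u n) - freePropagator (-(n * τ)) (ψ (n * τ))) ≤
        ENNReal.ofReal (E n) := by
    intro n
    induction n with
    | zero =>
      intro _
      have : u 0 = ψ 0 := hψ.initial.symm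
      simp [this, sigmaENorm_zero]
    | succ n ih =>
      intro hn
      have hn' : (n : ℝ) * τ + τ ≤ T := by push_cast at hn; linarith
      have hnT : (n : ℝ) * τ ≤ T := by linarith
      have hn0 : 0 ≤ (n : ℝ) * τ := by positivity
      -- The smallness of `τ` keeps the numerical solution in the ball of radius `2 M + 1`.
      have hball : sigmaENorm k (u n) ≤ ((2 * M + 1 : ℝ≥0) : ℝ≥0∞) := by
        have h1 : sigmaENorm k (u n - ψ (n * τ)) ≤ 1 := (hpull n hnT (ih hnT)).trans (by
          rw [← ENNReal.ofReal_one]; exact ENNReal.ofReal_le_ofReal hτ1)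
        have h2 : sigmaENorm k (ψ (n * τ)) ≤ 2 * M :=
          (sigmaENorm_le_two_mul (by omega : k ≤ k + 2) _).trans
            (by gcongr; exact hM _ ⟨hn0, hnT⟩)
        have h3 := sigmaENorm_add_le k (ψ (n * τ)) (u n - ψ (n * τ))
        rw [add_sub_cancel] at h3
        push_cast
        exact h3.trans (add_le_add h2 h1)
      have h := hstep ψ₀ ψ hψ hM (n * τ) τ hn0 hτ.le hn' (u n) hball
      have hcast : ((n + 1 : ℕ) : ℝ) * τ = n * τ + τ := by push_cast; ring
      rw [hcast]
      refine (show _ ≤ _ from h).trans ?_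
      calc _ ≤ (1 + ENNReal.ofReal τ * A) * ENNReal.ofReal (E n) + ENNReal.ofReal τ ^ 2 * B := by
            gcongr; exact ih hnT
        _ = ENNReal.ofReal ((1 + τ * A) * E n + τ ^ 2 * B) := by
            rw [ENNReal.ofReal_add (by have := hE0 n; positivity) (by positivity),
              ENNReal.ofReal_mul (p := 1 + τ * A) (by positivity),
              ENNReal.ofReal_add (by norm_num) (by positivity),
              ENNReal.ofReal_mul (p := τ) hτ.le, ENNReal.ofReal_mul (p := τ ^ 2) (by positivity),
              ENNReal.ofReal_pow hτ.le, ENNReal.ofReal_one, ENNReal.ofReal_coe_nnreal,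
              ENNReal.ofReal_coe_nnreal]
        _ ≤ ENNReal.ofReal (E (n + 1)) := by
            refine ENNReal.ofReal_le_ofReal ?_
            have h1 : 1 ≤ (1 + A * τ) ^ (n + 1) :=
              one_le_pow₀ (by have : 0 ≤ A * τ := by positivity
                              linarith)
            have h2 : τ ^ 2 * B ≤ τ ^ 2 * B * (1 + A * τ) ^ (n + 1) :=
              le_mul_of_one_le_right (by positivity) h1
            calc (1 + τ * A) * E n + τ ^ 2 * B
                ≤ (1 + τ * A) * E n + τ ^ 2 * B * (1 + A * τ) ^ (n + 1) := by linarith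
              _ = E (n + 1) := by simp only [hE]; push_cast; ring
  exact hpull n hn (hmain n hn)

end Convergence
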